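/- **Setting.** *The group.* Let $\widetilde{GL}{}^+_2$ be the double cover $p_{GL}:\widetilde{GL}{}^+_2\to GL^+_2(\mathbb R)$ whose elements are pairs $(g,\epsilon)$ with $g=\begin{pmatrix}a&b\\c&d\end{pmatrix}\in GL_2^+(\mathbb R)$ and $\epsilon$ holomorphic on the upper half plane with $\epsilon(\tau)^2=c\tau+d$; the product is $(g,\epsilon)(g',\epsilon')=(gg',(\epsilon\circ g')\,\epsilon')$. For $z\in\mathbb C^\times$ let $\delta(z)=(\text{multiplication by }z^2\text{ on }\mathbb C=\mathbb R^2,\ \epsilon_z)$ with $\epsilon_z(i)=z$. Every $g\in\widetilde{GL}{}^+_2$ factorises uniquely as $g=\tilde{\mathbf Q}(g)\tilde{\mathbf R}(g)$ with $\tilde{\mathbf Q}(g)\in\delta(S^1)$ and $\tilde{\mathbf R}(g)=\big(\begin{pmatrix}a&b\\0&c\end{pmatrix},\sqrt c\big)$, $a,c>0$. For $k\in\{0,1,2\}$ put $\tilde\alpha_k=\delta(e^{\pi i(k/3+5/12)})$ and $\tilde{\mathbf Q}_k(g)=\tilde\alpha_k\,\tilde{\mathbf Q}(\tilde\alpha_k^{-1}g\tilde\alpha_k)\,\tilde\alpha_k^{-1}$.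 *Spin surfaces.* A spin structure on an oriented surface is a principal $\widetilde{GL}{}^+_2$-bundle with an equivariant bundle map (along $p_{GL}$) to the bundle of oriented frames; a spin map is a bundle map which covers the derivative of a local diffeomorphism. Let $\mathbb C^{NS}$ and $\mathbb C^{R}$ be the trivial bundle $\mathbb C^\times\times\widetilde{GL}{}^+_2$ with $(z,g)\mapsto p_{GL}(g)$ and $(z,g)\mapsto z\,p_{GL}(g)$ as projections to frames. A spin surface here is a compact one whose boundary components, numbered by $1,\dots,B$, are parametrised by spin embeddings $\tilde\varphi_i$ (over embeddings $\varphi_i$, with disjoint images) of collars $\{1\le|z|<R_i\}$ in $\mathbb C^{NS}$ or $\mathbb C^{R}$; the circles $\varphi_i(S^1)$ are precisely the boundary. *Triangulations.* Let $\Delta\subset\mathbb C$ be the triangle with vertices $e^{2\pi ik/3}$, $k\in\mathbb Z/3$; its $k$-th edge joins the vertices $k$ and $k+1$. A marked combinatorial surface is a finite oriented simplicial surface $\mathcal C$ together with an orientation of each edge, a preferred edge of each triangle, and, for each boundary component, a parametrisation $f_i$ of it by $\partial\Delta$ (so that it has three edges), orientation reversing with respect to the adjacent triangles; boundary edges are oriented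 by $f_i$. The $k$-th edge of a triangle $\sigma$ is the $k$-th one counterclockwise, starting with the preferred edge as the $0$-th. A spin triangulated surface $\Sigma$ is a spin surface with a marked combinatorial surface $\mathcal C$, a homeomorphism $\varphi:|\mathcal C|\to\Sigma$, and for each triangle $\sigma$ a spin map $\tilde\chi_\sigma$ from $\Delta$ (with the trivial spin structure, as for $NS$) which covers the characteristic map $\chi_\sigma:\Delta\to\sigma\to\Sigma$ ($k$-th edge to $k$-th edge); moreover $\varphi\circ f_i=\varphi_i\circ\varphi_S$ on $\partial\Delta$, where $\varphi_S(z)=z/|z|$. *Edge signs.* Let $e$ be an edge, with triangle $\sigma_R$ on its right, as whose $k_R$-th edge it appears. If $e$ is an inner edge, it is the $k_L$-th edge of the triangle $\sigma_L$ on its left; if $e$ is an edge of the $i$-th boundary component, let it be the $f_i$-image of the $k_L$-th edge of $\Delta$. Write $g_p(\tilde f)$ for the group element with $\tilde f(p,1)=(f(p),g_p(\tilde f))$. The edge sign $s(e)\in\{\pm1\}$ is defined by $$\delta(s(e))=\begin{cases}\tilde{\mathbf Q}_{k_R}\big(g_p(\tilde\chi_{\sigma_L}^{-1}\circ\tilde\chi_{\sigma_R})\big)\,\delta(e^{-\pi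 i(k_L/3-k_R/3+1/2)})&e\text{ inner},\\ \tilde{\mathbf Q}_{k_R}\big(g_p(\tilde\varphi_i^{-1}\circ\tilde\chi_{\sigma_R})\big)\,\delta(e^{-\pi i(k_L/3-k_R/3+1/2)})&i\text{ of type }NS,\\ \tilde{\mathbf Q}_{k_R}\big(g_p(\tilde\varphi_i^{-1}\circ\tilde\chi_{\sigma_R})\big)\,\delta(e^{-\pi i(-k_R/3-1/6+1/2)})&i\text{ of type }R,\end{cases}$$ where $p$ is the midpoint of the $k_R$-th edge of $\Delta$. *State sum.* Let $A$ be a Frobenius algebra (algebra with product $\mu$ and unit $\eta$, coalgebra with coproduct $\Delta_A$ and counit $\epsilon_A$, such that $\Delta_A$ is a map of bimodules) in a symmetric monoidal category with symmetric braiding $\sigma$. Put $b=\epsilon_A\circ\mu$, $t=\epsilon_A\circ\mu\circ(\mu\otimes\mathrm{id})$, $c_{-1}=\Delta_A\circ\eta$, $c_{+1}=\sigma_{A,A}\circ c_{-1}$, and let $N=(b\otimes\mathrm{id})\circ(\mathrm{id}\otimes\sigma_{A,A})\circ(\mathrm{id}\otimes c_{-1})$ be the Nakayama automorphism. Assume that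 $A$ is $\Delta$-separable, $\mu\circ\Delta_A=\mathrm{id}_A$, and that $N\circ N=\mathrm{id}_A$. For a spin triangulated surface $\Sigma$ let $$T_{\rm triang}(\Sigma)=\Big(\bigotimes_{\sigma}t\Big)\circ\tau\circ\Big(\bigotimes_e c_{s(e)}\Big):\mathbf 1\to A^{\otimes 3B},$$ with a copy of $c_{s(e)}$ for each edge and of $t$ for each triangle, where the permutation $\tau$ connects the first (second) output of $c_{s(e)}$ to what lies on the left (right) of $e$: for the $k$-th edge of a triangle this is input $k+1$ of its copy of $t$ $(k=0,1,2)$; and the first output for the $k$-th edge of the $i$-th boundary component is tensor factor $3(i-1)+k+1$ of $A^{\otimes3B}$. Finally $T(\Sigma)=T_A(\Sigma):A^{\otimes 3B}\to\mathbf 1$ is $T_{\rm triang}(\Sigma)$ with each outgoing leg made ingoing by means of $b$; that is, $b$ pairs the $k$-th ingoing leg (first argument) with the $k$-th factor of $T_{\rm triang}(\Sigma)$ (second argument). *Gluing.* Let $(i,j,\varepsilon)$ be spin gluing data: distinct boundary components $i,j$ of $\Sigma$, both of type $NS$ or both of type $R$, and $\varepsilon\in\{\pm1\}$. Put $s(z)=1/z$,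 and let $\tilde s^{\varepsilon}$ be the lift of $s$ to $\mathbb C^{NS}$ resp. $\mathbb C^{R}$ with $\tilde s^\varepsilon(1,1)=(1,\delta(-i\varepsilon))$ resp. $(1,\delta(i\varepsilon))$ (in $\delta(\pm i\varepsilon)$, $i=\sqrt{-1}$). The glued surface $\Sigma^\varepsilon_{i\#j}$ is the quotient of $\Sigma$ in which the $j$-th boundary is identified with the $i$-th by $\tilde\varphi_i\circ\tilde s^\varepsilon\circ\tilde\varphi_j^{-1}$ on spin bundles (with the smooth and the spin structure defined by the collars), and by $f_i\circ s_{\mathcal C}\circ f_j^{-1}$ on $\mathcal C$, where $s_{\mathcal C}$ is complex conjugation on $\partial\Delta$; its triangulation, spin lifts, marking and remaining boundary parametrisations (in the same order) are those induced from $\Sigma$, where a glued edge gets its orientation from the $j$-th boundary. Assume that $(i,j)$ is simplicial gluing data, i.e. that the quotient of $\mathcal C$ is again a simplicial complex triangulating the glued surface, so that $\Sigma^\varepsilon_{i\#j}$ is a spin triangulated surface. Let $$\Gamma_{i,j,\varepsilon}=\tau_{ij}\circ\big(c_\varepsilon^{\otimes3}\otimes\mathrm{id}_A^{\otimes3(B-2)}\big):A^{\otimes3(B-2)}\to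 A^{\otimes3B},$$ where $\tau_{ij}$ is the permutation which moves the tensor factors $1,\dots,6$ to the places $3i-2,\ 3j,\ 3i-1,\ 3j-1,\ 3i,\ 3j-2$, in this order, and keeps the order of the remaining factors. **Statement.** In this setting: 1. if the edge $e$ of $\Sigma^\varepsilon_{i\#j}$ arises by gluing the edge $e_i$ of the $i$-th boundary to the edge $e_j$ of the $j$-th boundary, then $s(e)=\varepsilon\,s(e_i)\,s(e_j)$; 2. $T(\Sigma^\varepsilon_{i\#j})=T(\Sigma)\circ\Gamma_{i,j,\varepsilon}$. -/

import Mathlib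

open CategoryTheory MonoidalCategory
open scoped Manifold ContDiff MatrixGroups UpperHalfPlane

universe u v₁ u₁

noncomputable section

/-! ## The double cover of `GL(2, ℝ)⁺` -/

/-- The group `GL̃⁺₂`: pairs `(g, ε)` with `g ∈ GL⁺₂` and `ε : ℍ → ℂ` holomorphic with
`ε(z)² = j_g(z) = c z + d`. -/
@[ext]
structure GLTilde where
  mat : GL(2, ℝ)⁺
  eps : ℍ → ℂ
  holo : MDifferentiable 𝓘(ℂ) 𝓘(ℂ) eps
  sq : ∀ z, eps z ^ 2 = UpperHalfPlane.denom (mat : GL (Fin 2) ℝ) z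

namespace GLTilde

theorem det_pos (g : GL(2, ℝ)⁺) : 0 < (g : GL (Fin 2) ℝ).det.val := g.2

theorem eps_ne_zero (g : GLTilde) (z : ℍ) : g.eps z ≠ 0 := by
  intro h
  have h1 := g.sq z
  rw [h] at h1
  exact UpperHalfPlane.denom_ne_zero _ z (by rw [← h1]; simp)

theorem mdiff_inv {f : ℍ → ℂ} (hf : MDifferentiable 𝓘(ℂ) 𝓘(ℂ) f) (h0 : ∀ z, f z ≠ 0) :
    MDifferentiable 𝓘(ℂ) 𝓘(ℂ) fun z => (f z)⁻¹ := by
  rw [UpperHalfPlane.mdifferentiable_iff] at hf ⊢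
  exact hf.inv fun z _ => h0 _

theorem mdiff_mul {f g : ℍ → ℂ} (hf : MDifferentiable 𝓘(ℂ) 𝓘(ℂ) f)
    (hg : MDifferentiable 𝓘(ℂ) 𝓘(ℂ) g) :
    MDifferentiable 𝓘(ℂ) 𝓘(ℂ) fun z => f z * g z := by
  rw [UpperHalfPlane.mdifferentiable_iff] at hf hg ⊢
  exact hf.mul hg

instance : Mul GLTilde where
  mul g h :=
    { mat := g.mat * h.mat
      eps := fun z => g.eps ((h.mat : GL (Fin 2) ℝ) • z) * h.eps z
      holo := mdiff_mul
        (g.holo.comp (UpperHalfPlane.mdifferentiable_smul (det_pos h.mat))) h.holo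
      sq := fun z => by
        have h1 := UpperHalfPlane.denom_cocycle (g.mat : GL (Fin 2) ℝ) (h.mat : GL (Fin 2) ℝ)
          z.im_ne_zero
        have h2 := UpperHalfPlane.coe_smul_of_det_pos (det_pos h.mat) z
        rw [mul_pow, g.sq, h.sq, h2]
        exact h1.symm }

instance : One GLTilde where
  one :=
    { mat := 1
      eps := fun _ => 1
      holo := mdifferentiable_const
      sq := fun z => by simp }

instance : Inv GLTilde where
  inv g :=
    { mat := g.mat⁻¹
      eps := fun z => (g.eps ((g.mat⁻¹ : GL (Fin 2) ℝ) • z))⁻¹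
      holo := mdiff_inv
        (g.holo.comp (UpperHalfPlane.mdifferentiable_smul (det_pos g.mat⁻¹)))
        fun z => g.eps_ne_zero _
      sq := fun z => by
        have h1 := UpperHalfPlane.denom_cocycle (g.mat : GL (Fin 2) ℝ)
          ((g.mat⁻¹ : GL(2, ℝ)⁺) : GL (Fin 2) ℝ) z.im_ne_zero
        have h2 := UpperHalfPlane.coe_smul_of_det_pos (det_pos g.mat⁻¹) z
        have h3 : (g.mat : GL (Fin 2) ℝ) * ((g.mat⁻¹ : GL(2, ℝ)⁺) : GL (Fin 2) ℝ) = 1 := by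
          simp
        rw [h3, ← h2] at h1
        simp only [UpperHalfPlane.denom_one] at h1
        rw [inv_pow, g.sq]
        exact inv_eq_of_mul_eq_one_right h1.symm }

theorem mul_mat (g h : GLTilde) : (g * h).mat = g.mat * h.mat := rfl

theorem mul_eps (g h : GLTilde) (z : ℍ) :
    (g * h).eps z = g.eps ((h.mat : GL (Fin 2) ℝ) • z) * h.eps z := rfl

theorem one_mat : (1 : GLTilde).mat = 1 := rfl

theorem one_eps (z : ℍ) : (1 : GLTilde).eps z = 1 := rfl

theorem inv_mat (g : GLTilde) : (g⁻¹).mat = g.mat⁻¹ := rfl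

theorem inv_eps (g : GLTilde) (z : ℍ) :
    (g⁻¹).eps z = (g.eps ((g.mat⁻¹ : GL (Fin 2) ℝ) • z))⁻¹ := rfl

instance : Group GLTilde :=
  Group.ofLeftAxioms
    (fun a b c => by
      ext z
      · simp [mul_mat, mul_assoc]
      · simp [mul_eps, mul_mat, mul_smul, mul_assoc])
    (fun a => by
      ext z
      · simp [mul_mat, one_mat]
      · simp [mul_eps, one_eps])
    (fun a => by
      ext z
      · simp [mul_mat, inv_mat, one_mat]
      · simp [mul_eps, inv_eps, one_eps, a.eps_ne_zero])

/-- `(g, ε)` is determined by `g` and `ε(i)`; the topology is that of pairs `(g, ε(i))`. -/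
instance : TopologicalSpace GLTilde :=
  TopologicalSpace.induced
    (fun g => (((g.mat : GL (Fin 2) ℝ) : Matrix (Fin 2) (Fin 2) ℝ), g.eps UpperHalfPlane.I))
    inferInstance

/-- The linear map of `ℝ² = ℂ` given by the matrix `p_GL(g)`. -/
def toCLM (g : GLTilde) : ℂ →L[ℝ] ℂ :=
  LinearMap.toContinuousLinearMap
    (Matrix.toLin Complex.basisOneI Complex.basisOneI
      ((g.mat : GL (Fin 2) ℝ) : Matrix (Fin 2) (Fin 2) ℝ))

/-- An element of `GL⁺₂` from a matrix of positive determinant. -/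
def posMat (m : Matrix (Fin 2) (Fin 2) ℝ) (h : 0 < m.det) : GL(2, ℝ)⁺ :=
  ⟨Matrix.GeneralLinearGroup.mkOfDetNeZero m h.ne', by
    simpa [Matrix.GLPos, Matrix.GeneralLinearGroup.mkOfDetNeZero] using h⟩

theorem posMat_denom (m : Matrix (Fin 2) (Fin 2) ℝ) (h : 0 < m.det) (z : ℂ) :
    UpperHalfPlane.denom (posMat m h : GL (Fin 2) ℝ) z = m 1 0 * z + m 1 1 := rfl

/-- The scaled rotation of `ℝ² = ℂ` given by multiplication by `z`. -/
def rotMat (z : ℂ) : Matrix (Fin 2) (Fin 2) ℝ := !![z.re, -z.im; z.im, z.re]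

theorem rotMat_det_pos {z : ℂ} (hz : z ≠ 0) : 0 < (rotMat z).det := by
  have := Complex.normSq_pos.2 hz
  rw [Complex.normSq_apply] at this
  simp [rotMat, Matrix.det_fin_two]
  linarith

theorem slit {a : ℂ} (ha : a ≠ 0) (w : ℍ) :
    ((a.im : ℂ) * w + a.re) / a ∈ Complex.slitPlane := by
  have hpos := Complex.normSq_pos.2 ha
  rw [Complex.mem_slitPlane_iff]
  by_cases him : a.im = 0
  · left
    have hre : a.re ≠ 0 := by
      intro h
      exact ha (Complex.ext h him)
    have h1 : ((a.im : ℂ) * w + a.re) = a := by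
      apply Complex.ext <;> simp [him]
    rw [h1, div_self ha]
    simp
  · by_contra hcon
    push Not at hcon
    obtain ⟨h1, h2⟩ := hcon
    -- the quotient is a real number `r ≤ 0`, while numerator and `a` lie in one open half plane
    set q := ((a.im : ℂ) * w + a.re) / a with hq
    have h3 : ((a.im : ℂ) * w + a.re) = q * a := by
      rw [hq, div_mul_cancel₀ _ ha]
    have h4 := congrArg Complex.im h3
    simp [h2] at h4
    have h5 : (w : ℍ).im = q.re := by
      have : a.im * (w.im - q.re) = 0 := by
        rw [mul_sub, h4]; ring
      rcases mul_eq_zero.1 this with h | h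
      · exact absurd h him
      · linarith
    have := w.im_pos
    linarith

/-- The homomorphism `δ : ℂˣ → GL̃⁺₂`, `δ(z) = (i(z²), ε_z)`, where `i(z²)` is multiplication by
`z²` and `ε_z(i) = z`. The value at `0` is irrelevant. -/
def delta (z : ℂ) : GLTilde := by
  classical
  exact if hz : z ≠ 0 then
    { mat := posMat (rotMat (z ^ 2)) (rotMat_det_pos (pow_ne_zero 2 hz))
      eps := fun w => z * ((((z ^ 2).im : ℂ) * w + (z ^ 2).re) / z ^ 2) ^ (1 / 2 : ℂ)
      holo := by
        rw [UpperHalfPlane.mdifferentiable_iff]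
        intro w hw
        have hs := slit (pow_ne_zero 2 hz) (⟨w, hw⟩ : ℍ)
        have h1 : DifferentiableWithinAt ℂ
            (fun w : ℂ => z * ((((z ^ 2).im : ℂ) * w + (z ^ 2).re) / z ^ 2) ^ (1 / 2 : ℂ))
            {z | 0 < z.im} w := by
          refine DifferentiableAt.differentiableWithinAt ?_
          refine DifferentiableAt.const_mul ?_ _
          refine DifferentiableAt.cpow ?_ (by fun_prop) hs
          fun_prop
        refine h1.congr (fun y hy => ?_) ?_
        · simp [UpperHalfPlane.ofComplex_apply_of_im_pos hy]
        · simp [UpperHalfPlane.ofComplex_apply_of_im_pos hw]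
      sq := fun w => by
        have hz2 : z ^ 2 ≠ 0 := pow_ne_zero 2 hz
        rw [posMat_denom, mul_pow, ← Complex.cpow_nat_mul]
        norm_num [rotMat]
        field_simp }
  else 1

theorem delta_mat {z : ℂ} (hz : z ≠ 0) :
    (((delta z).mat : GL (Fin 2) ℝ) : Matrix (Fin 2) (Fin 2) ℝ) = rotMat (z ^ 2) := by
  simp [delta, hz]; rfl

theorem delta_eps_I {z : ℂ} (hz : z ≠ 0) : (delta z).eps UpperHalfPlane.I = z := by
  have h : ((z ^ 2).im : ℂ) * (UpperHalfPlane.I : ℂ) + (z ^ 2).re = z ^ 2 := by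
    apply Complex.ext <;> simp
  simp only [delta, ne_eq, hz, not_false_eq_true, dif_pos, h]
  rw [div_self (pow_ne_zero 2 hz)]
  simp

/-- The element `((a b; 0 c), √c)`, `a, c > 0`, of the subgroup `T̃₂`. -/
def upper (a b c : ℝ) (ha : 0 < a) (hc : 0 < c) : GLTilde where
  mat := posMat !![a, b; 0, c] (by simpa [Matrix.det_fin_two] using mul_pos ha hc)
  eps := fun _ => (Real.sqrt c : ℂ)
  holo := mdifferentiable_const
  sq := fun z => by
    rw [posMat_denom]
    simp only [Matrix.of_apply, Matrix.cons_val', Matrix.cons_val_zero, Matrix.cons_val_one]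
    rw [← Complex.ofReal_pow, Real.sq_sqrt hc.le]
    simp

/-- The underlying matrix. -/
abbrev m (g : GLTilde) : Matrix (Fin 2) (Fin 2) ℝ := ((g.mat : GL (Fin 2) ℝ) : Matrix _ _ ℝ)

theorem m_det_pos (g : GLTilde) : 0 < g.m.det := g.mat.2

theorem col_pos (g : GLTilde) : 0 < Real.sqrt (g.m 0 0 ^ 2 + g.m 1 0 ^ 2) := by
  apply Real.sqrt_pos.2
  have h := g.m_det_pos
  rw [Matrix.det_fin_two] at h
  by_contra hcon
  have h0 : g.m 0 0 = 0 := by nlinarith [sq_nonneg (g.m 0 0), sq_nonneg (g.m 1 0)]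
  have h1 : g.m 1 0 = 0 := by nlinarith [sq_nonneg (g.m 0 0), sq_nonneg (g.m 1 0)]
  rw [h0, h1] at h
  simp at h

/-- The upper triangular part `R̃(g) ∈ T̃₂` of the `QR`-decomposition: the triangular factor with
positive diagonal in the `QR`-decomposition of the matrix of `g`, lifted to `T̃₂`. -/
def Rt (g : GLTilde) : GLTilde :=
  upper (Real.sqrt (g.m 0 0 ^ 2 + g.m 1 0 ^ 2))
    ((g.m 0 0 * g.m 0 1 + g.m 1 0 * g.m 1 1) / Real.sqrt (g.m 0 0 ^ 2 + g.m 1 0 ^ 2))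
    (g.m.det / Real.sqrt (g.m 0 0 ^ 2 + g.m 1 0 ^ 2))
    g.col_pos (div_pos g.m_det_pos g.col_pos)

/-- The rotation part `Q̃(g)`, defined by `g = Q̃(g) R̃(g)`. -/
def Qt (g : GLTilde) : GLTilde := g * (Rt g)⁻¹

/-- `δ(e^{iθ})`. -/
def deltaExp (θ : ℝ) : GLTilde := delta (Complex.exp (θ * Complex.I))

/-- The rotated rotation part `Q̃_α(g) = α̃ Q̃(α̃⁻¹ g α̃) α̃⁻¹` for `α = e^{2πi(k/3 + 5/12)}`, the
direction of the `k`-th edge of the standard triangle, with lift `α̃ = δ(e^{πi(k/3 + 5/12)})`. -/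
def Qtα (k : Fin 3) (g : GLTilde) : GLTilde :=
  let α := deltaExp (Real.pi * ((k : ℕ) / 3 + 5 / 12))
  α * Qt (α⁻¹ * g * α) * α⁻¹

end GLTilde

/-! ## Spin surfaces with parametrised boundary -/

/-- The two kinds of spin structure on `ℂˣ`, and so the two types of boundary components. -/
inductive SpinType
  | NS
  | R

/-- The frame `p^{NS/R}(z, 1)` of `ℂ` at `z`: the standard frame for `NS`, and the standard frame
multiplied by `z` for `R`. -/
def SpinType.frame : SpinType → ℂ → ℂ → ℂ
  | .NS, _, w => w
  | .R, z, w => z * w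

/-- The lift `s̃^ε` of `s(z) = 1/z` to `ℂ^{NS/R}` is `s̃^ε(z, g) = (1/z, δ(c) g)` with `c` as given
here. It is the lift with `s̃^ε(1, δ(1)) = (1, δ(-iε))` for `NS` and `(1, δ(iε))` for `R`. -/
def SpinType.inversionFactor : SpinType → ℤˣ → ℂ → ℂ
  | .NS, ε, z => -Complex.I * ((ε : ℤ) : ℂ) / z
  | .R, ε, _ => Complex.I * ((ε : ℤ) : ℂ)

/-- `s̃^ε` covers the derivative of `s`: `ds ∘ p = p ∘ s̃^ε` on the section `z ↦ (z, 1)`. -/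
theorem SpinType.inversionFactor_lift (t : SpinType) (ε : ℤˣ) {z : ℂ} (hz : z ≠ 0) (w : ℂ) :
    t.frame z⁻¹ ((t.inversionFactor ε z) ^ 2 * w) = -(z ^ 2)⁻¹ * t.frame z w := by
  have h : (((ε : ℤ) : ℂ)) ^ 2 = 1 := by
    rcases Int.units_eq_one_or ε with rfl | rfl <;> simp
  cases t
  · simp only [SpinType.frame, SpinType.inversionFactor]
    rw [div_pow, mul_pow, h, neg_sq, Complex.I_sq]
    field_simp
  · simp only [SpinType.frame, SpinType.inversionFactor]
    rw [mul_pow, h, Complex.I_sq]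
    field_simp

/-- A spin structure on a surface (two-dimensional manifold with boundary) `M`: a principal
`GL̃⁺₂`-bundle `proj : P → M` with right action `act`, and an equivariant continuous bundle map
`frame` from `P` to the frame bundle of `M`. A frame at `x` is a linear isomorphism `ℂ = ℝ² → T_xM`.
The frames in the image of `frame` are the oriented frames; this fixes the orientation of `M`. -/
structure SpinStructure (M : Type u) [TopologicalSpace M]
    [ChartedSpace (EuclideanHalfSpace 2) M] [IsManifold (𝓡∂ 2) ∞ M] where
  P : Type u
  [topP : TopologicalSpace P]
  proj : P → M
  continuous_proj : Continuous proj
  act : P → GLTilde → P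
  act_one : ∀ x, act x 1 = x
  act_mul : ∀ x g h, act x (g * h) = act (act x g) h
  continuous_act : Continuous fun y : P × GLTilde => act y.1 y.2
  locallyTrivial : ∀ x : M, ∃ (U : Set M) (Φ : U × GLTilde ≃ₜ proj ⁻¹' U), IsOpen U ∧ x ∈ U ∧
    ∀ y g, proj (Φ (y, g)) = y ∧ ∀ h, (Φ (y, g * h) : P) = act (Φ (y, g)) h
  frame : ∀ x : P, ℂ →L[ℝ] TangentSpace (𝓡∂ 2) (proj x)
  frame_bijective : ∀ x, Function.Bijective (frame x)
  frame_act : ∀ x g w, (⟨proj (act x g), frame (act x g) w⟩ : TangentBundle (𝓡∂ 2) M) =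
    ⟨proj x, frame x (g.toCLM w)⟩
  continuous_frame :
    ∀ w, Continuous fun x => (⟨proj x, frame x w⟩ : TangentBundle (𝓡∂ 2) M)

attribute [instance] SpinStructure.topP

namespace SpinStructure

variable {M : Type u} [TopologicalSpace M] [ChartedSpace (EuclideanHalfSpace 2) M]
  [IsManifold (𝓡∂ 2) ∞ M] (S : SpinStructure M)

/-- A spin map from the region `U ⊆ ℂ` with its spin structure of type `t` to `M`. By equivariance
a bundle map `f̃ : U × GL̃⁺₂ → P` is the same as the map `f : U → P`, `f(z) = f̃(z, 1)`, so that
`f̃(z, g) = f(z) g`; the map of surfaces is `proj ∘ f`. For `t = NS` the region `U` may contain `0`. -/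
def IsSpinMap (t : SpinType) (U : Set ℂ) (f : ℂ → S.P) : Prop :=
  ContinuousOn f U ∧ ContMDiffOn 𝓘(ℝ, ℂ) (𝓡∂ 2) ∞ (S.proj ∘ f) U ∧
  ∀ z ∈ U, ∀ w : ℂ,
    S.frame (f z) w = mfderivWithin 𝓘(ℝ, ℂ) (𝓡∂ 2) (S.proj ∘ f) U z (t.frame z w : ℂ)

/-- A spin map whose underlying map is a topological (and hence smooth) embedding. -/
def IsSpinEmbedding (t : SpinType) (U : Set ℂ) (f : ℂ → S.P) : Prop :=
  S.IsSpinMap t U f ∧ Topology.IsEmbedding (U.domRestrict (S.proj ∘ f))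

end SpinStructure

/-- A compact spin surface with `B` boundary components, parametrised by spin embeddings of collars
`{1 ≤ |z| < R}` of type `NS` or `R`. -/
structure SpinSurface (B : ℕ) where
  M : Type u
  [topM : TopologicalSpace M]
  [chartedM : ChartedSpace (EuclideanHalfSpace 2) M]
  [manifoldM : IsManifold (𝓡∂ 2) ∞ M]
  [t2M : T2Space M]
  [compactM : CompactSpace M]
  spin : SpinStructure M
  type : Fin B → SpinType
  radius : Fin B → ℝ
  one_lt_radius : ∀ i, 1 < radius i
  collar : Fin B → ℂ → spin.P
  collar_embedding : ∀ i, spin.IsSpinEmbedding (type i) {z | 1 ≤ ‖z‖ ∧ ‖z‖ < radius i} (collar i)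
  collar_disjoint : Pairwise fun i j =>
    Disjoint ((spin.proj ∘ collar i) '' {z | 1 ≤ ‖z‖ ∧ ‖z‖ < radius i})
      ((spin.proj ∘ collar j) '' {z | 1 ≤ ‖z‖ ∧ ‖z‖ < radius j})
  boundary_eq : ⋃ i, (spin.proj ∘ collar i) '' Metric.sphere 0 1 = (𝓡∂ 2).boundary M

attribute [instance] SpinSurface.topM SpinSurface.chartedM SpinSurface.manifoldM
  SpinSurface.t2M SpinSurface.compactM

/-! ## Marked combinatorial surfaces -/

/-- A (finite, oriented) marked combinatorial surface with `B` parametrised boundary components. -/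
structure MarkedCombSurface (B : ℕ) where
  /-- The vertices. -/
  V : Type u
  [fintypeV : Fintype V]
  /-- The triangles. -/
  T : Type u
  [fintypeT : Fintype T]
  /-- The vertices of a triangle `σ` in counterclockwise order, which encodes the orientation. The
  list starts so that the marked edge `d²₀(σ)` joins `tri σ 0` and `tri σ 1`; so `d²_k(σ)` joins
  `tri σ k` and `tri σ (k + 1)`. -/
  tri : T → Fin 3 → V
  tri_injective : ∀ σ, Function.Injective (tri σ)
  tri_ext : ∀ σ τ, Set.range (tri σ) = Set.range (tri τ) → σ = τ
  mem_tri : ∀ v, ∃ σ k, tri σ k = v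
  /-- Each edge lies in at most two triangles, and these induce opposite orientations on it. -/
  side_injective : ∀ σ k τ l, tri σ k = tri τ l → tri σ (k + 1) = tri τ (l + 1) → σ = τ ∧ k = l
  /-- The triangles around a vertex form a single fan. -/
  link_connected : ∀ v σ τ, v ∈ Set.range (tri σ) → v ∈ Set.range (tri τ) →
    Relation.ReflTransGen (fun a b => ∃ w ≠ v,
      {v, w} ⊆ Set.range (tri a) ∧ {v, w} ⊆ Set.range (tri b)) σ τ
  /-- The edges, with the orientation given by the marking: `(d¹₀(e), d¹₁(e))` for edges `e`. -/
  edges : Set (V × V)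
  edges_of_side : ∀ σ k,
    Xor ((tri σ k, tri σ (k + 1)) ∈ edges) ((tri σ (k + 1), tri σ k) ∈ edges)
  side_of_edges : ∀ a b, (a, b) ∈ edges → ∃ σ k,
    (tri σ k = a ∧ tri σ (k + 1) = b) ∨ (tri σ k = b ∧ tri σ (k + 1) = a)
  /-- The boundary parametrisations `f_i` on the vertices of the standard triangle. -/
  bdry : Fin B → Fin 3 → V
  bdry_injective : ∀ i k j l, bdry i k = bdry j l → i = j ∧ k = l
  /-- The `f_i` map to edges with precisely one adjacent triangle, reversing the orientation. -/
  side_of_bdry : ∀ i l, ∃ σ k, tri σ k = bdry i (l + 1) ∧ tri σ (k + 1) = bdry i l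
  not_side_of_bdry : ∀ i l σ k, ¬ (tri σ k = bdry i l ∧ tri σ (k + 1) = bdry i (l + 1))
  /-- All edges with precisely one adjacent triangle are in the image of some `f_i`. -/
  opposite : ∀ σ k, (∃ τ l, tri τ l = tri σ (k + 1) ∧ tri τ (l + 1) = tri σ k) ∨
    (∃ i l, bdry i l = tri σ (k + 1) ∧ bdry i (l + 1) = tri σ k)
  /-- The marking of boundary edges agrees with the boundary parametrisation. -/
  bdry_mem_edges : ∀ i l, (bdry i l, bdry i (l + 1)) ∈ edges

attribute [instance] MarkedCombSurface.fintypeV MarkedCombSurface.fintypeT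

namespace MarkedCombSurface

variable {B : ℕ} (K : MarkedCombSurface.{u} B)

/-- The type of edges. -/
abbrev E : Type u := K.edges

instance : Fintype K.E := Fintype.ofFinite _

/-- The `l`-th edge on the `i`-th boundary component. -/
def bdryEdge (i : Fin B) (l : Fin 3) : K.E := ⟨(K.bdry i l, K.bdry i (l + 1)), K.bdry_mem_edges i l⟩

/-- The places to which the ends of the edges dual to edges of the surface are attached: the three
sides of each triangle, and the three edges of each parametrised boundary. -/
abbrev Slot : Type u := (K.T × Fin 3) ⊕ (Fin B × Fin 3)

/-- The pair of vertices of a slot, in the order in which the triangle (the standard triangle at the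
boundary) runs through them. -/
def slotEnds : K.Slot → K.V × K.V
  | .inl (σ, k) => (K.tri σ k, K.tri σ (k + 1))
  | .inr (i, k) => (K.bdry i k, K.bdry i (k + 1))

theorem exists_left (e : K.E) : ∃ s : K.Slot, K.slotEnds s = e.1 := by
  obtain ⟨⟨a, b⟩, he⟩ := e
  obtain ⟨σ, k, h | h⟩ := K.side_of_edges a b he
  · exact ⟨.inl (σ, k), Prod.ext h.1 h.2⟩
  · rcases K.opposite σ k with ⟨τ, l, h1, h2⟩ | ⟨i, l, h1, h2⟩
    · exact ⟨.inl (τ, l), Prod.ext (h1.trans h.2) (h2.trans h.1)⟩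
    · exact ⟨.inr (i, l), Prod.ext (h1.trans h.2) (h2.trans h.1)⟩

theorem exists_right (e : K.E) : ∃ s : K.T × Fin 3, K.slotEnds (.inl s) = e.1.swap := by
  obtain ⟨⟨a, b⟩, he⟩ := e
  obtain ⟨σ, k, h | h⟩ := K.side_of_edges a b he
  · rcases K.opposite σ k with ⟨τ, l, h1, h2⟩ | ⟨i, l, h1, h2⟩
    · exact ⟨(τ, l), Prod.ext (h1.trans h.2) (h2.trans h.1)⟩
    · exfalso
      have h3 := K.bdry_mem_edges i l
      rw [h1, h2] at h3
      have h4 : (K.tri σ k, K.tri σ (k + 1)) ∈ K.edges := by rw [h.1, h.2]; exact he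
      rcases K.edges_of_side σ k with h5 | h5
      · exact h5.2 h3
      · exact h5.2 h4
  · exact ⟨(σ, k), Prod.ext h.1 h.2⟩

/-- The left side of an edge: the face `σ_L(e)` that induces the orientation of `e`, with
`k_L(e)`; for a boundary edge the boundary component and `k_L(e)`. -/
def left (e : K.E) : K.Slot := (K.exists_left e).choose

/-- The face `σ_R(e)` that induces the opposite orientation, with `k_R(e)`. -/
def right (e : K.E) : K.T × Fin 3 := (K.exists_right e).choose

theorem left_spec (e : K.E) : K.slotEnds (K.left e) = e.1 := (K.exists_left e).choose_spec

theorem right_spec (e : K.E) : K.slotEnds (.inl (K.right e)) = e.1.swap :=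
  (K.exists_right e).choose_spec

theorem slotEnds_injective : Function.Injective K.slotEnds := by
  rintro (⟨σ, k⟩ | ⟨i, k⟩) (⟨τ, l⟩ | ⟨j, l⟩) h
  · obtain ⟨h1, h2⟩ := K.side_injective σ k τ l (congrArg Prod.fst h) (congrArg Prod.snd h)
    rw [h1, h2]
  · exact absurd ⟨congrArg Prod.fst h, congrArg Prod.snd h⟩ (K.not_side_of_bdry j l σ k)
  · exact absurd ⟨(congrArg Prod.fst h).symm, (congrArg Prod.snd h).symm⟩
      (K.not_side_of_bdry i k τ l)
  · obtain ⟨h1, h2⟩ := K.bdry_injective i k j l (congrArg Prod.fst h)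
    rw [h1, h2]

theorem not_both {a b : K.V} (h1 : (a, b) ∈ K.edges) (h2 : (b, a) ∈ K.edges) : False := by
  obtain ⟨σ, k, h | h⟩ := K.side_of_edges a b h1 <;>
  · have := K.edges_of_side σ k
    rw [h.1, h.2] at this
    rcases this with h3 | h3
    · exact h3.2 ‹_›
    · exact h3.2 ‹_›

theorem slot_mem (s : K.Slot) : K.slotEnds s ∈ K.edges ∨ (K.slotEnds s).swap ∈ K.edges := by
  rcases s with ⟨σ, k⟩ | ⟨i, k⟩
  · rcases K.edges_of_side σ k with h | h
    · exact Or.inl h.1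
    · exact Or.inr h.1
  · exact Or.inl (K.bdry_mem_edges i k)

/-- Where the two ends of the edge dual to `e` are attached: end `0` to the left of `e`, and end `1`
to the right of `e`. -/
def ends : K.E × Fin 2 → K.Slot
  | (e, 0) => K.left e
  | (e, 1) => .inl (K.right e)

theorem ends_bijective : Function.Bijective K.ends := by
  constructor
  · rintro ⟨e, a⟩ ⟨f, b⟩ h
    have key : ∀ (e f : K.E), K.left e ≠ .inl (K.right f) := by
      intro e f h
      have h1 := K.left_spec e
      rw [h, K.right_spec] at h1
      exact K.not_both (a := f.1.1) (b := f.1.2) f.2 (by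
        have := e.2
        rw [← h1] at this
        exact this)
    fin_cases a <;> fin_cases b
    · have h' : K.left e = K.left f := h
      have := K.left_spec e
      rw [h', K.left_spec] at this
      rw [Subtype.ext this.symm]
    · exact absurd h (key e f)
    · exact absurd h.symm (key f e)
    · have h' : (Sum.inl (K.right e) : K.Slot) = .inl (K.right f) := h
      have := K.right_spec e
      rw [h', K.right_spec] at this
      rw [Subtype.ext (Prod.swap_injective this).symm]
  · intro s
    rcases K.slot_mem s with h | h
    · exact ⟨(⟨_, h⟩, 0), K.slotEnds_injective (K.left_spec ⟨_, h⟩)⟩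
    · exact ⟨(⟨_, h⟩, 1), K.slotEnds_injective (K.right_spec ⟨_, h⟩)⟩

/-- The connectivity of the dual graph, as a bijection. -/
def endsEquiv : K.E × Fin 2 ≃ K.Slot := Equiv.ofBijective K.ends K.ends_bijective

/-- The polytope `|K|`, in barycentric coordinates. -/
def realization : Set (K.V → ℝ) :=
  {x | x ∈ stdSimplex ℝ K.V ∧ ∃ σ, Function.support x ⊆ Set.range (K.tri σ)}

/-- The point `∑ k, x k • f k` of `|K|` for vertices `f 0`, `f 1`, `f 2`. -/
def point (f : Fin 3 → K.V) (x : Fin 3 → ℝ) : K.V → ℝ := by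
  classical
  exact ∑ k, x k • Pi.single (f k) (1 : ℝ)

end MarkedCombSurface

/-! ## Spin triangulated surfaces -/

/-- The vertex `e^{2πik/3}` of the standard triangle. Its `k`-th edge joins the vertices `k` and
`k + 1`. -/
def stdVertex (k : Fin 3) : ℂ := Complex.exp ((2 * Real.pi * ((k : ℕ) / 3) : ℝ) * Complex.I)

/-- The standard triangle. -/
def stdTriangle : Set ℂ := convexHull ℝ (Set.range stdVertex)

/-- The midpoint of the `k`-th edge of the standard triangle. -/
def stdMidpoint (k : Fin 3) : ℂ := midpoint ℝ (stdVertex k) (stdVertex (k + 1))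

/-- A spin triangulated surface with `B` parametrised boundary components. -/
structure SpinTriangulatedSurface (B : ℕ) extends MarkedCombSurface.{u} B, SpinSurface.{u} B where
  /-- The triangulation `|K| → M`. -/
  φ : (V → ℝ) → M
  φ_continuous : ContinuousOn φ toMarkedCombSurface.realization
  φ_bijective : Set.BijOn φ toMarkedCombSurface.realization Set.univ
  /-- The spin lifts `χ̃_σ` of the characteristic maps `χ_σ` of the triangles. -/
  χ : T → ℂ → spin.P
  χ_spin : ∀ σ, spin.IsSpinMap .NS stdTriangle (χ σ)
  /-- `χ̃_σ` covers the composition `χ_σ` of `φ` with the affine map from the standard triangle to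
  `σ` that maps the `k`-th vertex to `tri σ k`. -/
  χ_cover : ∀ σ, ∀ x ∈ stdSimplex ℝ (Fin 3),
    spin.proj (χ σ (∑ k, x k • stdVertex k)) = φ (toMarkedCombSurface.point (tri σ) x)
  /-- `φ ∘ f_i = φ_i ∘ φ_S` on the boundary of the standard triangle, with `φ_S(z) = z / |z|`. -/
  bdry_cover : ∀ i, ∀ x ∈ stdSimplex ℝ (Fin 3), (∃ k, x k = 0) →
    φ (toMarkedCombSurface.point (bdry i) x) =
      spin.proj (collar i ((∑ k, x k • stdVertex k) / (‖∑ k, x k • stdVertex k‖ : ℝ)))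

namespace SpinTriangulatedSurface

variable {B : ℕ} (Λ : SpinTriangulatedSurface.{u} B)

/-- The edge sign of an edge `e`. It is evaluated at the midpoint `p` of the `k_R`-th edge of the
standard triangle. The element `g` is `g_p(χ̃_L⁻¹ ∘ χ̃_R)` for an inner edge, and
`g_p(φ̃_i⁻¹ ∘ χ̃_R)` for a boundary edge: the value of the composition at `(p, 1)` is `(q, g)`,
where `q` is the point corresponding to `p`. -/
def edgeSign (e : Λ.E) : ℤˣ := by
  classical
  exact
    let σR := (Λ.right e).1
    let kR := (Λ.right e).2
    match Λ.left e with
    | .inl (σL, kL) =>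
      if ∃ g : GLTilde,
        Λ.χ σR (stdMidpoint kR) = Λ.spin.act (Λ.χ σL (stdMidpoint kL)) g ∧
        GLTilde.Qtα kR g *
          GLTilde.deltaExp (-(Real.pi * ((kL : ℕ) / 3 - (kR : ℕ) / 3 + 1 / 2))) = GLTilde.delta 1
      then 1 else -1
    | .inr (i, kL) =>
      if ∃ g : GLTilde,
        Λ.χ σR (stdMidpoint kR) = Λ.spin.act
          (Λ.collar i (Complex.exp ((2 * Real.pi * ((kL : ℕ) / 3 + 1 / 6) : ℝ) * Complex.I))) g ∧
        GLTilde.Qtα kR g *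
          (match Λ.type i with
          | .NS => GLTilde.deltaExp (-(Real.pi * ((kL : ℕ) / 3 - (kR : ℕ) / 3 + 1 / 2)))
          | .R => GLTilde.deltaExp (-(Real.pi * (-((kR : ℕ) / 3) - 1 / 6 + 1 / 2)))) =
          GLTilde.delta 1
      then 1 else -1

end SpinTriangulatedSurface

/-! ## Gluing -/

/-- The increasing enumeration of the boundary components other than `i` and `j`. -/
def remaining {n : ℕ} {i j : Fin (n + 2)} (h : i ≠ j) : Fin n ↪o Fin (n + 2) :=
  ({i, j}ᶜ : Finset (Fin (n + 2))).orderEmbOfFin (by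
    rw [Finset.card_compl, Finset.card_pair h, Fintype.card_fin]; rfl)

/-- `Λ'` is the spin triangulated surface obtained from `Λ` by gluing the boundary components `i`
and `j` with sign `ε`: as a simplicial complex, a marked combinatorial surface, a smooth surface and
a spin surface it is the quotient of `Λ`, with the induced triangulation, spin lifts and boundary
parametrisations. The quotient maps are part of the data. -/
structure Gluing {n : ℕ} (Λ : SpinTriangulatedSurface.{u} (n + 2)) {i j : Fin (n + 2)} (hij : i ≠ j)
    (ε : ℤˣ) (Λ' : SpinTriangulatedSurface.{u} n) where
  /-- The quotient map on vertices. -/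
  vert : Λ.V → Λ'.V
  vert_surjective : Function.Surjective vert
  /-- Vertices are identified along `f_i ∘ s_C ∘ f_j⁻¹`, where `s_C` is complex conjugation. -/
  vert_eq_iff : ∀ a b, vert a = vert b ↔
    a = b ∨ ∃ k, (a = Λ.bdry i (-k) ∧ b = Λ.bdry j k) ∨ (a = Λ.bdry j k ∧ b = Λ.bdry i (-k))
  /-- The triangles, with their orientations and marked edges, stay the same. -/
  triEquiv : Λ.T ≃ Λ'.T
  tri_eq : ∀ σ k, Λ'.tri (triEquiv σ) k = vert (Λ.tri σ k)
  /-- Edge orientations are kept, where glued edges get the one from the `j`-th boundary. -/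
  edges_eq : Λ'.edges =
    Prod.map vert vert '' {e | e ∈ Λ.edges ∧ ∀ k, e ≠ (Λ.bdry i k, Λ.bdry i (k + 1))}
  bdry_eq : ∀ k l, Λ'.bdry k l = vert (Λ.bdry (remaining hij k) l)
  /-- The quotient map of surfaces. -/
  q : Λ.M → Λ'.M
  q_quotient : Topology.IsQuotientMap q
  /-- Points are identified along `φ_i ∘ s ∘ φ_j⁻¹` on the `j`-th boundary, where `s(z) = 1/z`. -/
  q_eq_iff : ∀ x y, q x = q y ↔ x = y ∨ ∃ z : ℂ, ‖z‖ = 1 ∧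
    ((x = Λ.spin.proj (Λ.collar i z⁻¹) ∧ y = Λ.spin.proj (Λ.collar j z)) ∨
      (x = Λ.spin.proj (Λ.collar j z) ∧ y = Λ.spin.proj (Λ.collar i z⁻¹)))
  /-- The quotient map of spin bundles. -/
  Q : Λ.spin.P → Λ'.spin.P
  Q_continuous : Continuous Q
  Q_proj : ∀ x, Λ'.spin.proj (Q x) = q (Λ.spin.proj x)
  Q_act : ∀ x g, Q (Λ.spin.act x g) = Λ'.spin.act (Q x) g
  /-- The bundle is identified along `φ̃_i ∘ s̃^ε ∘ φ̃_j⁻¹` on the `j`-th boundary. -/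
  Q_collar : ∀ z : ℂ, ‖z‖ = 1 → Q (Λ.collar j z) =
    Q (Λ.spin.act (Λ.collar i z⁻¹) (GLTilde.delta ((Λ.type i).inversionFactor ε z)))
  /-- Away from the glued boundaries the smooth structure is that of `Λ` ... -/
  q_smooth : ContMDiffOn (𝓡∂ 2) (𝓡∂ 2) ∞ q
    {x | ∀ z : ℂ, ‖z‖ = 1 → x ≠ Λ.spin.proj (Λ.collar i z) ∧ x ≠ Λ.spin.proj (Λ.collar j z)}
  /-- ... and the projection to the frame bundle is that of `Λ`. -/
  Q_frame : ∀ x : Λ.spin.P, (∀ z : ℂ, ‖z‖ = 1 → Λ.spin.proj x ≠ Λ.spin.proj (Λ.collar i z) ∧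
      Λ.spin.proj x ≠ Λ.spin.proj (Λ.collar j z)) → ∀ w : ℂ,
    (⟨Λ'.spin.proj (Q x), Λ'.spin.frame (Q x) w⟩ : TangentBundle (𝓡∂ 2) Λ'.M) =
      tangentMap (𝓡∂ 2) (𝓡∂ 2) q ⟨Λ.spin.proj x, Λ.spin.frame x w⟩
  /-- Near the glued boundaries the smooth and the spin structure are given by `φ̃_i` on `|z| ≥ 1` and
  by `φ̃_j ∘ (s̃^ε)⁻¹` on `|z| < 1`, where `(s̃^ε)⁻¹ = s̃^{-ε}`. -/
  seam : ∃ R : ℝ, 1 < R ∧ R ≤ Λ.radius i ∧ R ≤ Λ.radius j ∧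
    Λ'.spin.IsSpinEmbedding (Λ.type i) {z | R⁻¹ < ‖z‖ ∧ ‖z‖ < R} fun z =>
      open Classical in
      if 1 ≤ ‖z‖ then Q (Λ.collar i z)
      else Q (Λ.spin.act (Λ.collar j z⁻¹) (GLTilde.delta ((Λ.type i).inversionFactor (-ε) z)))
  type_eq : ∀ k, Λ'.type k = Λ.type (remaining hij k)
  radius_eq : ∀ k, Λ'.radius k = Λ.radius (remaining hij k)
  collar_eq : ∀ k, Set.EqOn (Λ'.collar k) (Q ∘ Λ.collar (remaining hij k))
    {z | 1 ≤ ‖z‖ ∧ ‖z‖ < Λ'.radius k}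
  /-- The triangulation is the quotient of the triangulation of `Λ`. -/
  φ_eq : ∀ σ, ∀ x ∈ stdSimplex ℝ (Fin 3),
    Λ'.φ (Λ'.point (vert ∘ Λ.tri σ) x) = q (Λ.φ (Λ.point (Λ.tri σ) x))
  χ_eq : ∀ σ, Set.EqOn (Λ'.χ (triEquiv σ)) (Q ∘ Λ.χ σ) stdTriangle

/-! ## Tensor powers in a symmetric monoidal category -/

section Category

variable {C : Type u₁} [Category.{v₁} C] [MonoidalCategory C]

/-- The tensor power `A ⊗ (A ⊗ (⋯ ⊗ 𝟙))`. -/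
def tpow (A : C) : ℕ → C
  | 0 => 𝟙_ C
  | n + 1 => A ⊗ tpow A n

/-- Tensoring from the left with `c 0 ⊗ ⋯ ⊗ c (m - 1)`, for copairings `c k : 𝟙 ⟶ A ⊗ A`. -/
def copairs (A : C) {n : ℕ} : {m : ℕ} → (Fin m → (𝟙_ C ⟶ A ⊗ A)) →
    (tpow A n ⟶ tpow A (n + 2 * m))
  | 0, _ => 𝟙 _
  | m + 1, c =>
    copairs A (fun k => c k.succ) ≫ (λ_ (tpow A (n + 2 * m))).inv ≫
      (c 0 ▷ tpow A (n + 2 * m)) ≫ (α_ A A (tpow A (n + 2 * m))).hom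

/-- Applying `t : A ⊗ A ⊗ A ⟶ 𝟙` to each of the first `m` triples of factors. -/
def triples (A : C) (t : (A ⊗ A) ⊗ A ⟶ 𝟙_ C) {n : ℕ} : (m : ℕ) →
    (tpow A (n + 3 * m) ⟶ tpow A n)
  | 0 => 𝟙 _
  | m + 1 =>
    (α_ A A (A ⊗ tpow A (n + 3 * m))).inv ≫ (α_ (A ⊗ A) A (tpow A (n + 3 * m))).inv ≫
      (t ▷ tpow A (n + 3 * m)) ≫ (λ_ (tpow A (n + 3 * m))).hom ≫ triples A t m

variable [SymmetricCategory C]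

/-- Moving the first factor to position `i` by means of the symmetric braiding. -/
def moveFirst (A : C) : (n : ℕ) → Fin (n + 1) → (A ⊗ tpow A n ⟶ tpow A (n + 1))
  | 0, _ => 𝟙 _
  | n + 1, i => Fin.cases (𝟙 _)
      (fun i' => (α_ A A (tpow A n)).inv ≫ ((β_ A A).hom ▷ tpow A n) ≫ (α_ A A (tpow A n)).hom ≫
        (A ◁ moveFirst A n i')) i

/-- The permutation morphism that connects the `k`-th input to the `σ k`-th output. -/
def perm (A : C) : (m n : ℕ) → (Fin m ≃ Fin n) → (tpow A m ⟶ tpow A n)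
  | 0, 0, _ => 𝟙 _
  | 0, _ + 1, σ => (σ.symm 0).elim0
  | _ + 1, 0, σ => (σ 0).elim0
  | m + 1, n + 1, σ =>
    (A ◁ perm A m n (Equiv.removeNone
      ((finSuccEquiv' 0).symm.trans (σ.trans (finSuccEquiv' (σ 0)))))) ≫ moveFirst A n (σ 0)

/-- The morphism `b^{⊗n} ∘ τ`, where the permutation `τ` pairs the `k`-th factor of the first copy of
the tensor power with the `k`-th factor of the second copy. -/
def pairing (A : C) (b : A ⊗ A ⟶ 𝟙_ C) : (n : ℕ) → (tpow A n ⊗ tpow A n ⟶ 𝟙_ C)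
  | 0 => (λ_ (𝟙_ C)).hom
  | n + 1 => tensorμ A (tpow A n) A (tpow A n) ≫ (b ⊗ₘ pairing A b n) ≫ (λ_ (𝟙_ C)).hom

end Category

/-- `(k, l) ↦ r k + l`. -/
def prodIndex (m r : ℕ) : Fin m × Fin r ≃ Fin (r * m) :=
  finProdFinEquiv.trans (finCongr (Nat.mul_comm m r))

/-- The numbering of `m` blocks of `r` factors, followed by `n` further factors. -/
def blockIndex (n m r : ℕ) : (Fin m × Fin r) ⊕ Fin n ≃ Fin (n + r * m) :=
  (Equiv.sumCongr (prodIndex m r) (Equiv.refl _)).trans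
    (finSumFinEquiv.trans (finCongr (Nat.add_comm _ _)))

/-! ## Frobenius algebras and the state sum -/

section Frobenius

variable {C : Type u₁} [Category.{v₁} C] [MonoidalCategory C] (A : C) [MonObj A] [ComonObj A]

/-- An algebra and coalgebra `A` is a Frobenius algebra if the coproduct is a bimodule map. -/
structure IsFrobenius : Prop where
  left : (A ◁ ComonObj.comul) ≫ (α_ A A A).inv ≫ (MonObj.mul ▷ A) =
    (MonObj.mul : A ⊗ A ⟶ A) ≫ ComonObj.comul
  right : (ComonObj.comul ▷ A) ≫ (α_ A A A).hom ≫ (A ◁ MonObj.mul) =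
    (MonObj.mul : A ⊗ A ⟶ A) ≫ ComonObj.comul

/-- `Δ`-separability: the product is left inverse to the coproduct. -/
def IsDeltaSeparable : Prop := (ComonObj.comul : A ⟶ A ⊗ A) ≫ MonObj.mul = 𝟙 A

/-- The pairing `b`: product followed by counit. -/
def frobPairing : A ⊗ A ⟶ 𝟙_ C := MonObj.mul ≫ ComonObj.counit

/-- The trilinear map `t`: twofold product followed by counit. -/
def frobTriple : (A ⊗ A) ⊗ A ⟶ 𝟙_ C := (MonObj.mul ▷ A) ≫ MonObj.mul ≫ ComonObj.counit

variable [SymmetricCategory C]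

/-- The copairings: `c_{-1}` is unit followed by coproduct, and `c_1 = σ_{A,A} ∘ c_{-1}`. -/
def frobCopairing (s : ℤˣ) : 𝟙_ C ⟶ A ⊗ A :=
  if s = 1 then (MonObj.one ≫ ComonObj.comul) ≫ (β_ A A).hom else MonObj.one ≫ ComonObj.comul

/-- The Nakayama automorphism `N = (b ⊗ id) ∘ (id ⊗ σ_{A,A}) ∘ (id ⊗ c_{-1})`. -/
def nakayama : A ⟶ A :=
  (ρ_ A).inv ≫ (A ◁ frobCopairing A (-1)) ≫ (A ◁ (β_ A A).hom) ≫ (α_ A A A).inv ≫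
    (frobPairing A ▷ A) ≫ (λ_ A).hom

variable {B : ℕ} (Λ : SpinTriangulatedSurface.{u} B)

/-- The permutation given by the connectivity of edges and triangles, for the chosen numberings of
the edges and of the triangles (the state sum does not depend on this choice). The output for the
`k`-th edge of the `i`-th boundary has number `3 i + k`. -/
def connectivity : Fin (0 + 2 * Fintype.card Λ.E) ≃ Fin (3 * B + 3 * Fintype.card Λ.T) :=
  (blockIndex 0 (Fintype.card Λ.E) 2).symm.trans <|
    (Equiv.sumEmpty _ _).trans <|
    (Equiv.prodCongr (Fintype.equivFin Λ.E).symm (Equiv.refl _)).trans <|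
    Λ.endsEquiv.trans <|
    (Equiv.sumCongr (Equiv.prodCongr (Fintype.equivFin Λ.T) (Equiv.refl _)) (prodIndex B 3)).trans
      (blockIndex (3 * B) (Fintype.card Λ.T) 3)

/-- `T_triang(Λ) : 𝟙 ⟶ A^{⊗3B}`: a copairing `c_{s(e)}` for each edge `e`, whose first factor is
connected to the left and whose second factor is connected to the right of `e`, and a copy of `t`
for each triangle. -/
def Ttriang : 𝟙_ C ⟶ tpow A (3 * B) :=
  copairs A (n := 0) (fun k => frobCopairing A (Λ.edgeSign ((Fintype.equivFin Λ.E).symm k))) ≫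
    perm A _ _ (connectivity Λ) ≫ triples A (frobTriple A) (Fintype.card Λ.T)

/-- `T_A(Λ) : A^{⊗3B} ⟶ 𝟙`. -/
def TA : tpow A (3 * B) ⟶ 𝟙_ C :=
  (ρ_ _).inv ≫ (tpow A (3 * B) ◁ Ttriang A Λ) ≫ pairing A (frobPairing A) (3 * B)

/-- The pairs (boundary component, edge number) to which the factors of
`c_ε ⊗ c_ε ⊗ c_ε ⊗ id` are connected. -/
def gluingSlot {n : ℕ} {i j : Fin (n + 2)} (hij : i ≠ j) :
    (Fin 3 × Fin 2) ⊕ (Fin n × Fin 3) → Fin (n + 2) × Fin 3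
  | .inl (k, 0) => (i, k)
  | .inl (k, 1) => (j, k.rev)
  | .inr (m, l) => (remaining hij m, l)

theorem remaining_range {n : ℕ} {i j : Fin (n + 2)} (hij : i ≠ j) (k : Fin (n + 2)) :
    (∃ m, remaining hij m = k) ↔ k ≠ i ∧ k ≠ j := by
  have h := Finset.range_orderEmbOfFin ({i, j}ᶜ : Finset (Fin (n + 2))) (k := n) (by
    rw [Finset.card_compl, Finset.card_pair hij, Fintype.card_fin]; rfl)
  have h2 : k ∈ Set.range (remaining hij) ↔ k ∈ ({i, j}ᶜ : Finset (Fin (n + 2))) := by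
    unfold remaining
    rw [h, Finset.mem_coe]
  rw [← Set.mem_range, h2]
  simp only [Finset.mem_compl, Finset.mem_insert, Finset.mem_singleton, not_or]

theorem gluingSlot_bijective {n : ℕ} {i j : Fin (n + 2)} (hij : i ≠ j) :
    Function.Bijective (gluingSlot hij) := by
  have hr := fun m => (remaining_range hij (remaining hij m)).1 ⟨m, rfl⟩
  have hsurj : Function.Surjective (gluingSlot hij) := by
    rintro ⟨k, l⟩
    by_cases h1 : k = i
    · exact ⟨.inl (l, 0), by rw [h1]; rfl⟩
    by_cases h2 : k = j
    · exact ⟨.inl (l.rev, 1), by rw [h2]; simp [gluingSlot]⟩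
    obtain ⟨m, hm⟩ := (remaining_range hij k).2 ⟨h1, h2⟩
    exact ⟨.inr (m, l), by rw [← hm]; rfl⟩
  refine (Fintype.bijective_iff_surjective_and_card _).2 ⟨hsurj, ?_⟩
  simp
  ring

/-- The morphism `Γ_{i,j,ε} = τ ∘ (c_ε^{⊗3} ⊗ id) : A^{⊗3(B-2)} ⟶ A^{⊗3B}`, for `B = n + 2`. -/
def gluingMorphism {n : ℕ} {i j : Fin (n + 2)} (hij : i ≠ j) (ε : ℤˣ) :
    tpow A (3 * n) ⟶ tpow A (3 * (n + 2)) :=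
  copairs A (m := 3) (fun _ => frobCopairing A ε) ≫
    perm A _ _ ((blockIndex (3 * n) 3 2).symm.trans <|
      (Equiv.sumCongr (Equiv.refl _) (prodIndex n 3).symm).trans <|
      (Equiv.ofBijective _ (gluingSlot_bijective hij)).trans (prodIndex (n + 2) 3))

end Frobenius

end

/-! The state sum is a network of copairings `c_{s(e)}` and trilinear maps `t`. The network of the
glued surface, cut open at the three glued edges, is the network of `Λ`. So two local facts are
needed: how edge signs multiply under gluing, and that joining `c_s` and `c_{s'}` by the form
induced by `c_ε` gives `c_{ε s s'}`. The rest is bookkeeping in a symmetric monoidal category.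

Signs. At the midpoint of a boundary edge, triangle and collar agree along the edge, so the
transition `g` maps the edge direction to a positive multiple of the tangent of the circle. Hence `g
= δ(s u) α̃ T α̃⁻¹` with `T` triangular, `u` the reference rotation and `s` the edge sign
(`exists_bdry_transition`). The two triangles at a glued edge are related by `g_i⁻¹ δ(c) g_j`, with
`c` the factor of the lifted inversion. The identity `c u_j α_j = iε u_i α_i`
(`inversionFactor_edgeNormal`) and centrality of `δ(±i)` turn this into `δ(iε s_i s_j α_i / α_j)`
times a rotated triangular element. Here `i α_i / α_j` is the reference rotation of an inner edge,
which leaves the sign `ε s_i s_j`.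

Algebra. The Frobenius property yields zigzag identities for `b` and `c_{-1}`. They straighten every
joint of two copairings by `b`, except one in which an inverse Nakayama twist appears; `N ∘ N = id`
removes it (`joinsTo_frobCopairing`). Replacing `b` by `b ∘ σ` flips the result, which accounts for
`ε`.

Bookkeeping. `perm` is functorial (`perm_comp`), so a state sum depends on its graph only, not on
numberings (`diagram_reindex`). Pairs of cut ends can then be joined one after the other
(`diagram_join`). Finally `T(Σ) ∘ Γ` is the pairing with `T_triang(Σ)` precomposed by `Γ`. Moving
`Γ` across the pairing replaces it by its adjoint, which undoes the permutation and evaluates three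
pairs of legs (`IsAdjointTo`); this is precisely the joining of the cut edges (`TA_glue`). -/

noncomputable section

/-! ## Functoriality of the permutation morphisms -/

section Permutations

/-- The bijection obtained from `σ` by removing `i` and `σ i`. -/
def Equiv.removeFin {m n : ℕ} (σ : Fin (m + 1) ≃ Fin (n + 1)) (i : Fin (m + 1)) : Fin m ≃ Fin n :=
  Equiv.removeNone ((finSuccEquiv' i).symm.trans (σ.trans (finSuccEquiv' (σ i))))

theorem Equiv.succAbove_removeFin {m n : ℕ} (σ : Fin (m + 1) ≃ Fin (n + 1)) (i : Fin (m + 1))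
    (x : Fin m) : (σ i).succAbove (σ.removeFin i x) = σ (i.succAbove x) := by
  have hne : σ i ≠ σ (i.succAbove x) := fun h => Fin.succAbove_ne i x (σ.injective h).symm
  have h : some (σ.removeFin i x) = finSuccEquiv' (σ i) (σ (i.succAbove x)) := by
    obtain ⟨y, hy⟩ := Fin.exists_succAbove_eq hne.symm
    have := Equiv.removeNone_some ((finSuccEquiv' i).symm.trans (σ.trans (finSuccEquiv' (σ i))))
      (x := x) ⟨y, by simp [← hy]⟩
    simpa [Equiv.removeFin] using this
  rw [← Equiv.symm_apply_eq] at h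
  rw [← h, finSuccEquiv'_symm_some]

theorem Equiv.removeFin_eq {m n : ℕ} (σ : Fin (m + 1) ≃ Fin (n + 1)) (i : Fin (m + 1))
    (τ : Fin m ≃ Fin n) (h : ∀ x, (σ i).succAbove (τ x) = σ (i.succAbove x)) :
    σ.removeFin i = τ := by
  ext x : 1
  exact Fin.succAbove_right_injective ((σ.succAbove_removeFin i x).trans (h x).symm)

theorem Fin.val_succAbove {n : ℕ} (p : Fin (n + 1)) (x : Fin n) :
    (p.succAbove x : ℕ) = if (x : ℕ) < p then (x : ℕ) else x + 1 := by
  simp only [Fin.succAbove, Fin.lt_def, Fin.val_castSucc]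
  split_ifs <;> simp

/-- Both sides enumerate the complement of `{p, p'}` in increasing order, so it does not matter
which of the two points is removed first. -/
theorem Fin.succAbove_succAbove_of_eq {n : ℕ} {p p' : Fin (n + 2)} {q q' : Fin (n + 1)}
    (h : p' = p.succAbove q) (h' : p = p'.succAbove q') (z : Fin n) :
    p.succAbove (q.succAbove z) = p'.succAbove (q'.succAbove z) := by
  have h1 := congrArg Fin.val h
  have h2 := congrArg Fin.val h'
  apply Fin.ext
  simp only [Fin.val_succAbove] at *
  generalize (p : ℕ) = a at *
  generalize (p' : ℕ) = b at *
  generalize (q : ℕ) = c at *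
  generalize (q' : ℕ) = d at *
  generalize (z : ℕ) = e at *
  clear h h'
  subst h1
  split_ifs at * <;> omega

variable {C : Type u₁} [Category.{v₁} C] [MonoidalCategory C] (A : C)

/-- `id ⊗ f` between tensor powers. -/
def tcons {A : C} {m n : ℕ} (f : tpow A m ⟶ tpow A n) : tpow A (m + 1) ⟶ tpow A (n + 1) := A ◁ f

variable {A} in
theorem tcons_comp {m n p : ℕ} (f : tpow A m ⟶ tpow A n) (g : tpow A n ⟶ tpow A p) :
    tcons (f ≫ g) = tcons f ≫ tcons g :=
  MonoidalCategory.whiskerLeft_comp A f g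

theorem tcons_comp_assoc {m n p : ℕ} (f : tpow A m ⟶ tpow A n) (g : tpow A n ⟶ tpow A p)
    {Z : C} (k : tpow A (p + 1) ⟶ Z) : tcons (f ≫ g) ≫ k = tcons f ≫ tcons g ≫ k := by
  rw [tcons_comp, Category.assoc]

theorem tcons_id (n : ℕ) : tcons (𝟙 (tpow A n)) = 𝟙 (tpow A (n + 1)) :=
  MonoidalCategory.whiskerLeft_id A (tpow A n)

variable [SymmetricCategory C]

/-- Exchanging the first two factors. -/
def tswap (n : ℕ) : tpow A (n + 2) ⟶ tpow A (n + 2) :=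
  (α_ A A (tpow A n)).inv ≫ ((β_ A A).hom ▷ tpow A n) ≫ (α_ A A (tpow A n)).hom

/-- Moving the first factor to position `i`. -/
def tmove (n : ℕ) (i : Fin (n + 1)) : tpow A (n + 1) ⟶ tpow A (n + 1) := moveFirst A n i

theorem tswap_tswap (n : ℕ) : tswap A n ≫ tswap A n = 𝟙 _ := by
  have h : ((α_ A A (tpow A n)).inv ≫ ((β_ A A).hom ▷ tpow A n) ≫ (α_ A A (tpow A n)).hom) ≫
      (α_ A A (tpow A n)).inv ≫ ((β_ A A).hom ▷ tpow A n) ≫ (α_ A A (tpow A n)).hom = 𝟙 _ := by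
    simp [← comp_whiskerRight_assoc]
  exact h

theorem tswap_tswap_assoc (n : ℕ) {Z : C} (k : tpow A (n + 2) ⟶ Z) :
    tswap A n ≫ tswap A n ≫ k = k := by
  rw [← Category.assoc, tswap_tswap, Category.id_comp]

variable {A} in
theorem tswap_naturality {m n : ℕ} (f : tpow A m ⟶ tpow A n) :
    tswap A m ≫ tcons (tcons f) = tcons (tcons f) ≫ tswap A n := by
  -- The computation is done for arbitrary objects, because `A ⊗ tpow A n` and `tpow A (n + 1)`
  -- agree by definition but not syntactically. The same device recurs below.
  have h : ∀ (X Y : C) (f : X ⟶ Y),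
      ((α_ A A X).inv ≫ ((β_ A A).hom ▷ X) ≫ (α_ A A X).hom) ≫ (A ◁ A ◁ f) =
        (A ◁ A ◁ f) ≫ (α_ A A Y).inv ≫ ((β_ A A).hom ▷ Y) ≫ (α_ A A Y).hom := by
    intro X Y f
    simp only [Category.assoc]
    rw [associator_inv_naturality_right_assoc, whisker_exchange_assoc,
      associator_naturality_right]
  exact h _ _ f

theorem tswap_naturality_assoc {m n : ℕ} (f : tpow A m ⟶ tpow A n) {Z : C}
    (k : tpow A (n + 2) ⟶ Z) :
    tswap A m ≫ tcons (tcons f) ≫ k = tcons (tcons f) ≫ tswap A n ≫ k := by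
  rw [← Category.assoc, tswap_naturality, Category.assoc]

/-- The Yang–Baxter equation for the braiding, with the remaining factors as spectators. -/
theorem tswap_braid (n : ℕ) :
    tswap A (n + 1) ≫ tcons (tswap A n) ≫ tswap A (n + 1) =
      tcons (tswap A n) ≫ tswap A (n + 1) ≫ tcons (tswap A n) := by
  have h := fun X => congrArg (fun f : (A ⊗ A) ⊗ A ⟶ (A ⊗ A) ⊗ A => (α_ A A (A ⊗ X)).inv ≫ (α_ (A ⊗ A) A X).inv ≫ (f ▷ X) ≫
    (α_ (A ⊗ A) A X).hom ≫ (α_ A A (A ⊗ X)).hom) (BraidedCategory.yang_baxter' A A A)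
  have h' : ∀ X, ((α_ A A (A ⊗ X)).inv ≫ ((β_ A A).hom ▷ (A ⊗ X)) ≫ (α_ A A (A ⊗ X)).hom) ≫
      (A ◁ ((α_ A A X).inv ≫ ((β_ A A).hom ▷ X) ≫ (α_ A A X).hom)) ≫
      (α_ A A (A ⊗ X)).inv ≫ ((β_ A A).hom ▷ (A ⊗ X)) ≫ (α_ A A (A ⊗ X)).hom =
      (A ◁ ((α_ A A X).inv ≫ ((β_ A A).hom ▷ X) ≫ (α_ A A X).hom)) ≫
      ((α_ A A (A ⊗ X)).inv ≫ ((β_ A A).hom ▷ (A ⊗ X)) ≫ (α_ A A (A ⊗ X)).hom) ≫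
      (A ◁ ((α_ A A X).inv ≫ ((β_ A A).hom ▷ X) ≫ (α_ A A X).hom)) := by
    intro X
    calc _ = _ := by monoidal
      _ = _ := h X
      _ = _ := by monoidal
  exact h' (tpow A n)

theorem tswap_braid_assoc (n : ℕ) {Z : C} (k : tpow A (n + 3) ⟶ Z) :
    tswap A (n + 1) ≫ tcons (tswap A n) ≫ tswap A (n + 1) ≫ k =
      tcons (tswap A n) ≫ tswap A (n + 1) ≫ tcons (tswap A n) ≫ k := by
  have h := congrArg (fun f => f ≫ k) (tswap_braid A n)
  simpa only [Category.assoc] using h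

theorem tmove_zero (n : ℕ) : tmove A n 0 = 𝟙 _ := by
  cases n <;> rfl

theorem tmove_succ (n : ℕ) (i : Fin (n + 1)) :
    tmove A (n + 1) i.succ = tswap A n ≫ tcons (tmove A n i) := by
  have h : ∀ (X Y : C) (f : A ⊗ X ⟶ Y), (α_ A A X).inv ≫ ((β_ A A).hom ▷ X) ≫ (α_ A A X).hom ≫
      (A ◁ f) = ((α_ A A X).inv ≫ ((β_ A A).hom ▷ X) ≫ (α_ A A X).hom) ≫ (A ◁ f) := by simp
  exact h _ _ _

theorem perm_succ {m n : ℕ} (σ : Fin (m + 1) ≃ Fin (n + 1)) :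
    perm A (m + 1) (n + 1) σ = tcons (perm A m n (σ.removeFin 0)) ≫ tmove A n (σ 0) := rfl

/-- Both sides send the first factor to place `d`, the second to place `b`, and keep the order of
the others; they differ in which of the two is inserted first. If neither place is an end case, the
braid relation passes both factors over a third one and reduces to smaller places. -/
theorem tmove_tmove : ∀ (n : ℕ) (a : Fin (n + 1)) (b d : Fin (n + 2)) (c : Fin (n + 1)),
    d = b.succAbove a → d.succAbove c = b →
    tswap A n ≫ tcons (tmove A n a) ≫ tmove A (n + 1) b =
      tcons (tmove A n c) ≫ tmove A (n + 1) d
  | n, a, b, d, c, hd, hb => by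
    induction b using Fin.cases with
    | zero =>
      rw [Fin.succAbove_zero] at hd
      subst hd
      obtain rfl : c = 0 := by
        by_contra h
        rw [Fin.succAbove_eq_zero_iff (Fin.succ_ne_zero a)] at hb
        exact h hb
      rw [tmove_zero, tmove_zero, tmove_succ, tcons_id, Category.comp_id, Category.id_comp]
    | succ b =>
      induction a using Fin.cases with
      | zero =>
        rw [Fin.succ_succAbove_zero] at hd
        subst hd
        rw [Fin.succAbove_zero] at hb
        obtain rfl := Fin.succ_injective _ hb
        rw [tmove_zero, tmove_zero, tmove_succ, tcons_id, Category.id_comp, tswap_tswap_assoc,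
          Category.comp_id]
      | succ a =>
        cases n with
        | zero => exact a.elim0
        | succ n =>
        rw [Fin.succ_succAbove_succ] at hd
        subst hd
        induction c using Fin.cases with
        | zero => rw [Fin.succ_succAbove_zero] at hb; exact absurd hb.symm (Fin.succ_ne_zero b)
        | succ c =>
        rw [Fin.succ_succAbove_succ] at hb
        have ih := tmove_tmove n a b _ c rfl (Fin.succ_injective _ hb)
        rw [tmove_succ, tmove_succ, tmove_succ, tmove_succ, tcons_comp, tcons_comp,
          Category.assoc, Category.assoc, ← tswap_naturality_assoc, tswap_braid_assoc,
          ← tswap_naturality_assoc, ← tcons_comp, ← tcons_comp, ← tcons_comp, ih]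

/-- The recursion of `perm` splits off input `0`, but in a composite the image `σ 0` is an arbitrary
input of the second permutation. Hence any input has to be split off; the induction exchanges inputs
`0` and `i` by `tmove_tmove`. -/
theorem tmove_perm : ∀ (m n : ℕ) (i : Fin (m + 1)) (τ : Fin (m + 1) ≃ Fin (n + 1)),
    tmove A m i ≫ perm A (m + 1) (n + 1) τ =
      tcons (perm A m n (τ.removeFin i)) ≫ tmove A n (τ i)
  | m, n, i, τ => by
    induction i using Fin.cases with
    | zero => rw [tmove_zero, perm_succ, Category.id_comp]
    | succ i =>
      cases m with
      | zero => exact i.elim0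
      | succ m =>
        cases n with
        | zero =>
          have := Fin.equiv_iff_eq.1 ⟨τ⟩
          omega
        | succ n =>
          have ih := tmove_perm m n i (τ.removeFin 0)
          have e1 : τ 0 = (τ i.succ).succAbove (τ.removeFin i.succ 0) := by
            rw [Equiv.succAbove_removeFin]; simp
          have e2 : τ i.succ = (τ 0).succAbove (τ.removeFin 0 i) := by
            rw [Equiv.succAbove_removeFin]; simp
          have e3 : (τ.removeFin 0).removeFin i = (τ.removeFin i.succ).removeFin 0 := by
            apply Equiv.removeFin_eq
            intro x
            apply Fin.succAbove_right_injective (p := τ 0)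
            rw [Fin.succAbove_succAbove_of_eq e2 e1, Equiv.succAbove_removeFin, Equiv.succAbove_removeFin,
              Equiv.succAbove_removeFin, Fin.succAbove_zero, Fin.succAbove_zero,
              Fin.succ_succAbove_succ]
          have key := tmove_tmove A n (τ.removeFin 0 i) (τ 0) (τ i.succ)
            (τ.removeFin i.succ 0) e2 e1.symm
          rw [perm_succ A τ, tmove_succ, perm_succ A (τ.removeFin i.succ), tcons_comp,
            Category.assoc, Category.assoc, ← key, ← e3, ← tswap_naturality_assoc,
            ← tcons_comp_assoc, ih, tcons_comp_assoc]

theorem perm_refl : ∀ n, perm A n n (Equiv.refl _) = 𝟙 _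
  | 0 => rfl
  | n + 1 => by
    have h : (Equiv.refl (Fin (n + 1))).removeFin 0 = Equiv.refl _ :=
      Equiv.removeFin_eq _ _ _ fun x => by simp
    rw [perm_succ, h, perm_refl n, Equiv.refl_apply, tmove_zero, tcons_id, Category.comp_id]

/-- The first input arrives at `σ 0`, and `tmove_perm` lets `τ` take it on from there. What remains
are the two permutations with these points removed. -/
theorem perm_comp : ∀ (m n p : ℕ) (σ : Fin m ≃ Fin n) (τ : Fin n ≃ Fin p),
    perm A m n σ ≫ perm A n p τ = perm A m p (σ.trans τ)
  | 0, n, p, σ, τ => by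
    obtain rfl := Fin.equiv_iff_eq.1 ⟨σ⟩
    obtain rfl := Fin.equiv_iff_eq.1 ⟨τ⟩
    exact Category.id_comp _
  | m + 1, n, p, σ, τ => by
    obtain rfl := Fin.equiv_iff_eq.1 ⟨σ⟩
    obtain rfl := Fin.equiv_iff_eq.1 ⟨τ⟩
    have h : (σ.trans τ).removeFin 0 = (σ.removeFin 0).trans (τ.removeFin (σ 0)) :=
      Equiv.removeFin_eq _ _ _ fun x => by
        simp [Equiv.succAbove_removeFin]
    rw [perm_succ A σ, perm_succ A (σ.trans τ), Category.assoc, tmove_perm, h,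
      ← perm_comp m m m, tcons_comp_assoc]
    rfl

theorem perm_comp_assoc (m n p : ℕ) (σ : Fin m ≃ Fin n) (τ : Fin n ≃ Fin p) {Z : C}
    (k : tpow A p ⟶ Z) :
    perm A m n σ ≫ perm A n p τ ≫ k = perm A m p (σ.trans τ) ≫ k := by
  rw [← Category.assoc, perm_comp]

/-- The bijection that extends `σ` by fixing an additional first element. -/
def Equiv.consFin {m n : ℕ} (σ : Fin m ≃ Fin n) : Fin (m + 1) ≃ Fin (n + 1) :=
  (finSuccEquiv m).trans ((Equiv.optionCongr σ).trans (finSuccEquiv n).symm)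

@[simp]
theorem Equiv.consFin_zero {m n : ℕ} (σ : Fin m ≃ Fin n) : σ.consFin 0 = 0 := by
  simp [Equiv.consFin]

@[simp]
theorem Equiv.consFin_succ {m n : ℕ} (σ : Fin m ≃ Fin n) (x : Fin m) :
    σ.consFin x.succ = (σ x).succ := by
  simp [Equiv.consFin]

theorem perm_consFin {m n : ℕ} (σ : Fin m ≃ Fin n) :
    perm A (m + 1) (n + 1) σ.consFin = tcons (perm A m n σ) := by
  have h : σ.consFin.removeFin 0 = σ := Equiv.removeFin_eq _ _ _ fun x => by simp
  rw [perm_succ, h, Equiv.consFin_zero, tmove_zero, Category.comp_id]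

theorem perm_swap_zero_one (n : ℕ) :
    perm A (n + 2) (n + 2) (Equiv.swap 0 1) = tswap A n := by
  have h : (Equiv.swap (0 : Fin (n + 2)) 1).removeFin 0 = Equiv.refl _ := by
    refine Equiv.removeFin_eq _ _ _ fun x => ?_
    simp only [Equiv.swap_apply_left, Equiv.refl_apply, Fin.succAbove_zero]
    induction x using Fin.cases with
    | zero => simp
    | succ x =>
      rw [Equiv.swap_apply_of_ne_of_ne (by simp) (by simp [Fin.ext_iff])]
      exact Fin.succAbove_of_le_castSucc _ _ (by simp [Fin.le_def])
  rw [perm_succ, h, perm_refl, Equiv.swap_apply_left, ← Fin.succ_zero_eq_one, tmove_succ,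
    tmove_zero, tcons_id, Category.id_comp, Category.comp_id]

end Permutations

/-! ## Morphisms applied to the first factors of a tensor power -/

section Front

/-- Moving the first element behind the `a` following ones. -/
def Equiv.rotFin (n : ℕ) : (a : ℕ) → (Fin (n + a + 1) ≃ Fin (n + 1 + a))
  | 0 => Equiv.refl _
  | a + 1 => (Equiv.swap (0 : Fin (n + a + 2)) 1).trans (Equiv.rotFin n a).consFin

/-- Formulas for the values in `ℕ` allow permutations to be compared by case distinction and
`omega`, even if their index types agree only up to arithmetic. -/
theorem Equiv.val_consFin {m n : ℕ} (σ : Fin m ≃ Fin n) (f : ℕ → ℕ) (hf : ∀ x, (σ x : ℕ) = f x)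
    (x : Fin (m + 1)) : (σ.consFin x : ℕ) = if (x : ℕ) = 0 then 0 else f (x - 1) + 1 := by
  induction x using Fin.cases with
  | zero => simp
  | succ x => simp [hf]

theorem Equiv.val_swap_zero_one {n : ℕ} (x : Fin (n + 2)) :
    (Equiv.swap (0 : Fin (n + 2)) 1 x : ℕ) =
      (if (x : ℕ) = 0 then 1 else if (x : ℕ) = 1 then 0 else (x : ℕ) : ℕ) := by
  simp only [Equiv.swap_apply_def, Fin.ext_iff, apply_ite Fin.val, Fin.val_zero, Fin.val_one]

theorem Equiv.val_rotFin (n : ℕ) : ∀ (a : ℕ) (x : Fin (n + a + 1)),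
    (Equiv.rotFin n a x : ℕ) =
      if (x : ℕ) = 0 then a else if (x : ℕ) ≤ a then (x : ℕ) - 1 else (x : ℕ)
  | 0, x => by
    simp only [Equiv.rotFin, Equiv.refl_apply]
    split_ifs <;> omega
  | a + 1, x => by
    obtain ⟨t, ht⟩ := x
    have h := Equiv.val_consFin (Equiv.rotFin n a)
      (fun y => if y = 0 then a else if y ≤ a then y - 1 else y) (Equiv.val_rotFin n a)
      (Equiv.swap (0 : Fin (n + a + 2)) 1 ⟨t, ht⟩)
    refine h.trans ?_
    have h' : (Equiv.swap (0 : Fin (n + a + 2)) 1 ⟨t, ht⟩ : ℕ) =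
      if t = 0 then 1 else if t = 1 then 0 else t := Equiv.val_swap_zero_one _
    generalize (Equiv.swap (0 : Fin (n + a + 2)) 1 ⟨t, ht⟩ : ℕ) = s at h' ⊢
    have h2 : (t = 0 ∧ s = 1) ∨ (t = 1 ∧ s = 0) ∨ (2 ≤ t ∧ s = t) := by
      clear h
      split_ifs at h' <;> omega
    clear h h'
    simp only
    split_ifs <;> omega

/-- Moving the first `k` elements behind the `a` following ones. -/
def Equiv.rotsFin (n a : ℕ) : (k : ℕ) → (Fin (n + a + k) ≃ Fin (n + k + a))
  | 0 => Equiv.refl _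
  | k + 1 => (Equiv.rotsFin n a k).consFin.trans (Equiv.rotFin (n + k) a)

theorem Equiv.val_rotsFin (n a : ℕ) : ∀ (k : ℕ) (x : Fin (n + a + k)),
    (Equiv.rotsFin n a k x : ℕ) =
      if (x : ℕ) < k then (x : ℕ) + a else if (x : ℕ) < k + a then (x : ℕ) - k else (x : ℕ)
  | 0, x => by
    simp only [Equiv.rotsFin, Equiv.refl_apply]
    split_ifs <;> omega
  | k + 1, x => by
    have h := Equiv.val_consFin (Equiv.rotsFin n a k)
      (fun x => if x < k then x + a else if x < k + a then x - k else x)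
      (Equiv.val_rotsFin n a k) x
    refine (Equiv.val_rotFin (n + k) a ((Equiv.rotsFin n a k).consFin x)).trans ?_
    generalize ((Equiv.rotsFin n a k).consFin x : ℕ) = s at h ⊢
    generalize (x : ℕ) = t at h ⊢
    have h2 : (t = 0 ∧ s = 0) ∨ (1 ≤ t ∧ t ≤ k ∧ s = t + a) ∨
        (k < t ∧ t ≤ k + a ∧ s = t - k) ∨ (k + a < t ∧ s = t) := by
      split_ifs at h <;> omega
    clear h
    split_ifs <;> omega

/-- Fixing `k` additional first elements. -/
def Equiv.shiftFin {m n : ℕ} (σ : Fin m ≃ Fin n) : (k : ℕ) → (Fin (m + k) ≃ Fin (n + k))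
  | 0 => σ
  | k + 1 => (σ.shiftFin k).consFin

theorem Equiv.val_shiftFin {m n : ℕ} (σ : Fin m ≃ Fin n) (f : ℕ → ℕ)
    (hf : ∀ x, (σ x : ℕ) = f x) : ∀ (k : ℕ) (x : Fin (m + k)),
    (σ.shiftFin k x : ℕ) = if (x : ℕ) < k then (x : ℕ) else f (x - k) + k
  | 0, x => by simp [Equiv.shiftFin, hf]
  | k + 1, x => by
    refine (Equiv.val_consFin (σ.shiftFin k) (fun x => if x < k then x else f (x - k) + k)
      (Equiv.val_shiftFin σ f hf k) x).trans ?_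
    have : (x : ℕ) - 1 - k = x - (k + 1) := by omega
    rw [this]
    split_ifs <;> omega

variable {C : Type u₁} [Category.{v₁} C] [MonoidalCategory C] {A : C}

variable (A) in
/-- The identification of `A^{⊗a} ⊗ A^{⊗n}` with a tensor power. -/
def tmul : (a n : ℕ) → (tpow A a ⊗ tpow A n ≅ tpow A (n + a))
  | 0, n => λ_ (tpow A n)
  | a + 1, n => α_ A (tpow A a) (tpow A n) ≪≫ whiskerLeftIso A (tmul a n)

/-- A morphism applied to the first `a` factors. -/
def tfront {a b : ℕ} (f : tpow A a ⟶ tpow A b) (n : ℕ) : tpow A (n + a) ⟶ tpow A (n + b) :=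
  (tmul A a n).inv ≫ (f ▷ tpow A n) ≫ (tmul A b n).hom

/-- A morphism applied to the factors behind the first `k`. -/
def tshift {m n : ℕ} (f : tpow A m ⟶ tpow A n) : (k : ℕ) → (tpow A (m + k) ⟶ tpow A (n + k))
  | 0 => f
  | k + 1 => tcons (tshift f k)

theorem tmul_naturality_right {m n : ℕ} (f : tpow A m ⟶ tpow A n) : ∀ k,
    (tpow A k ◁ f) ≫ (tmul A k n).hom = (tmul A k m).hom ≫ tshift f k
  | 0 => leftUnitor_naturality f
  | k + 1 => by
    have ih := tmul_naturality_right f k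
    have h : ∀ {X Y Y' Z Z' : C} (u : Y ⟶ Y') (v : X ⊗ Y' ⟶ Z') (v' : X ⊗ Y ⟶ Z) (w : Z ⟶ Z'),
        (X ◁ u) ≫ v = v' ≫ w → ((A ⊗ X) ◁ u) ≫ (α_ A X Y').hom ≫ (A ◁ v) =
          ((α_ A X Y).hom ≫ (A ◁ v')) ≫ (A ◁ w) := by
      intro X Y Y' Z Z' u v v' w h
      rw [associator_naturality_right_assoc, ← MonoidalCategory.whiskerLeft_comp, h]
      simp
    exact h f _ _ _ ih

theorem tmul_naturality_right_assoc {m n : ℕ} (f : tpow A m ⟶ tpow A n) (k : ℕ) {Z : C}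
    (h : tpow A (n + k) ⟶ Z) :
    (tpow A k ◁ f) ≫ (tmul A k n).hom ≫ h = (tmul A k m).hom ≫ tshift f k ≫ h := by
  rw [← Category.assoc, tmul_naturality_right, Category.assoc]

/-- The interchange law for morphisms on disjoint factors. As `f` changes the number of leading
factors from `a` to `b`, the shift of `h` changes with it. -/
theorem tfront_tshift {a b m n : ℕ} (f : tpow A a ⟶ tpow A b) (h : tpow A m ⟶ tpow A n) :
    tfront f m ≫ tshift h b = tshift h a ≫ tfront f n := by
  have h2 : (tmul A a m).inv ≫ (tpow A a ◁ h) = tshift h a ≫ (tmul A a n).inv := by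
    rw [Iso.inv_comp_eq, ← tmul_naturality_right_assoc]
    simp
  simp only [tfront, Category.assoc]
  rw [← tmul_naturality_right, ← whisker_exchange_assoc, reassoc_of% h2]

theorem tfront_tshift_assoc {a b m n : ℕ} (f : tpow A a ⟶ tpow A b) (h : tpow A m ⟶ tpow A n)
    {Z : C} (k : tpow A (n + b) ⟶ Z) :
    tfront f m ≫ tshift h b ≫ k = tshift h a ≫ tfront f n ≫ k := by
  rw [← Category.assoc, tfront_tshift, Category.assoc]

theorem tshift_zero {m n : ℕ} (f : tpow A m ⟶ tpow A n) :
    tshift f 0 = f := rfl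

variable [SymmetricCategory C]

theorem perm_congr {m n : ℕ} {σ τ : Fin m ≃ Fin n} (h : ∀ x, (σ x : ℕ) = τ x) :
    perm A m n σ = perm A m n τ := by
  rw [Equiv.ext fun x => Fin.ext (h x)]

theorem perm_eq_id {n : ℕ} {σ : Fin n ≃ Fin n} (h : ∀ x, (σ x : ℕ) = x) :
    perm A n n σ = 𝟙 _ := by
  rw [← perm_refl]
  exact perm_congr h

theorem tshift_perm {m n : ℕ} (σ : Fin m ≃ Fin n) : ∀ k,
    tshift (perm A m n σ) k = perm A (m + k) (n + k) (σ.shiftFin k)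
  | 0 => rfl
  | k + 1 => by
    rw [tshift, tshift_perm σ k]
    exact (perm_consFin A _).symm

/-- By the hexagon identity, moving a factor step by step behind a block is the braiding with the
whole block. Naturality of this braiding then lets a factor pass any morphism on the block. -/
theorem tmul_rotFin (n : ℕ) : ∀ a, (A ◁ (tmul A a n).hom) ≫ perm A (n + a + 1) (n + 1 + a)
    (Equiv.rotFin n a) = (α_ A (tpow A a) (tpow A n)).inv ≫ ((β_ A (tpow A a)).hom ▷ tpow A n) ≫
      (α_ (tpow A a) A (tpow A n)).hom ≫ (tmul A a (n + 1)).hom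
  | 0 => by
    have h : ∀ X : C, (A ◁ (λ_ X).hom) ≫ 𝟙 _ = (α_ A (𝟙_ C) X).inv ≫ ((β_ A (𝟙_ C)).hom ▷ X) ≫
        (α_ (𝟙_ C) A X).hom ≫ (λ_ (A ⊗ X)).hom := by
      intro X
      rw [braiding_tensorUnit_right]
      monoidal
    refine Eq.trans ?_ (h (tpow A n))
    exact congrArg (fun f => (A ◁ (λ_ (tpow A n)).hom) ≫ f) (perm_refl A (n + 1))
  | a + 1 => by
    have ih := tmul_rotFin n a
    have e : perm A (n + a + 2) (n + 1 + a + 1) (Equiv.rotFin n (a + 1)) =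
        tswap A (n + a) ≫ tcons (perm A (n + a + 1) (n + 1 + a) (Equiv.rotFin n a)) := by
      rw [← perm_consFin, ← perm_swap_zero_one, perm_comp]
      rfl
    have h : ∀ {X Y Z W : C} (v : X ⊗ Y ⟶ Z) (p : A ⊗ Z ⟶ W) (w : X ⊗ (A ⊗ Y) ⟶ W),
        (A ◁ v) ≫ p = (α_ A X Y).inv ≫ ((β_ A X).hom ▷ Y) ≫ (α_ X A Y).hom ≫ w →
        (A ◁ ((α_ A X Y).hom ≫ (A ◁ v))) ≫ ((α_ A A Z).inv ≫ ((β_ A A).hom ▷ Z) ≫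
          (α_ A A Z).hom) ≫ (A ◁ p) =
        (α_ A (A ⊗ X) Y).inv ≫ ((β_ A (A ⊗ X)).hom ▷ Y) ≫ (α_ (A ⊗ X) A Y).hom ≫
          (α_ A X (A ⊗ Y)).hom ≫ (A ◁ w) := by
      intro X Y Z W v p w h
      have e1 : (A ◁ A ◁ v) ≫ (α_ A A Z).inv ≫ ((β_ A A).hom ▷ Z) ≫ (α_ A A Z).hom =
          (α_ A A (X ⊗ Y)).inv ≫ ((β_ A A).hom ▷ (X ⊗ Y)) ≫ (α_ A A (X ⊗ Y)).hom ≫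
            (A ◁ A ◁ v) := by
        rw [associator_inv_naturality_right_assoc, whisker_exchange_assoc,
          associator_naturality_right]
      simp only [MonoidalCategory.whiskerLeft_comp, Category.assoc]
      rw [reassoc_of% e1, ← MonoidalCategory.whiskerLeft_comp, h,
        BraidedCategory.braiding_tensor_right_hom]
      simp only [MonoidalCategory.whiskerLeft_comp, comp_whiskerRight, Category.assoc]
      monoidal
    refine Eq.trans (congrArg (fun f => (A ◁ (tmul A (a + 1) n).hom) ≫ f) e) ?_
    exact h _ _ _ ih

/-- A morphism on the first factors, with one factor in front of them. -/
theorem tcons_tfront {a b : ℕ} (f : tpow A a ⟶ tpow A b) (n : ℕ) :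
    tcons (tfront f n) ≫ perm A (n + b + 1) (n + 1 + b) (Equiv.rotFin n b) =
      perm A (n + a + 1) (n + 1 + a) (Equiv.rotFin n a) ≫ tfront f (n + 1) := by
  have ha := tmul_rotFin (A := A) n a
  have hb := tmul_rotFin (A := A) n b
  have h : ∀ {X X' Y Z Z' W W' : C} (u : X ⟶ X') (v : X ⊗ Y ≅ Z) (v' : X' ⊗ Y ≅ Z')
      (p : A ⊗ Z ⟶ W) (p' : A ⊗ Z' ⟶ W') (w : X ⊗ (A ⊗ Y) ≅ W) (w' : X' ⊗ (A ⊗ Y) ≅ W'),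
      (A ◁ v.hom) ≫ p = (α_ A X Y).inv ≫ ((β_ A X).hom ▷ Y) ≫ (α_ X A Y).hom ≫ w.hom →
      (A ◁ v'.hom) ≫ p' = (α_ A X' Y).inv ≫ ((β_ A X').hom ▷ Y) ≫ (α_ X' A Y).hom ≫ w'.hom →
      (A ◁ (v.inv ≫ (u ▷ Y) ≫ v'.hom)) ≫ p' = p ≫ w.inv ≫ (u ▷ (A ⊗ Y)) ≫ w'.hom := by
    intro X X' Y Z Z' W W' u v v' p p' w w' h h'
    rw [← cancel_epi (A ◁ v.hom), reassoc_of% h]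
    simp only [MonoidalCategory.whiskerLeft_comp, Category.assoc, whiskerLeft_hom_inv_assoc,
      Iso.hom_inv_id_assoc]
    rw [h', ← associator_naturality_left_assoc, associator_inv_naturality_middle_assoc,
      ← comp_whiskerRight_assoc, BraidedCategory.braiding_naturality_right,
      comp_whiskerRight_assoc]
  exact h f _ _ _ _ _ _ ha hb

/-- A morphism on the first factors, with `k` factors in front of them. -/
theorem tshift_tfront {a b : ℕ} (f : tpow A a ⟶ tpow A b) (n : ℕ) : ∀ k,
    tshift (tfront f n) k ≫ perm A (n + b + k) (n + k + b) (Equiv.rotsFin n b k) =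
      perm A (n + a + k) (n + k + a) (Equiv.rotsFin n a k) ≫ tfront f (n + k)
  | 0 => by
    have ha := perm_refl A (n + a)
    have hb := perm_refl A (n + b)
    exact ((congrArg (fun g => tfront f n ≫ g) hb).trans (Category.comp_id _)).trans
      ((congrArg (fun g => g ≫ tfront f n) ha).trans (Category.id_comp _)).symm
  | k + 1 => by
    have h := tcons_tfront f (n + k)
    have ih := congrArg tcons (tshift_tfront f n k)
    rw [tcons_comp, tcons_comp, ← perm_consFin, ← perm_consFin] at ih
    have ea := perm_comp A _ _ _ (Equiv.rotsFin n a k).consFin (Equiv.rotFin (n + k) a)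
    have eb := perm_comp A _ _ _ (Equiv.rotsFin n b k).consFin (Equiv.rotFin (n + k) b)
    change tcons (tshift (tfront f n) k) ≫ perm A (n + b + k + 1) (n + k + 1 + b) _ =
      perm A (n + a + k + 1) (n + k + 1 + a) _ ≫ tfront f (n + k + 1)
    change _ = perm A (n + a + k + 1) (n + k + 1 + a) _ at ea
    change _ = perm A (n + b + k + 1) (n + k + 1 + b) _ at eb
    have ea' : perm A (n + a + k + 1) (n + k + 1 + a) (Equiv.rotsFin n a (k + 1)) = _ := ea.symm
    have eb' : perm A (n + b + k + 1) (n + k + 1 + b) (Equiv.rotsFin n b (k + 1)) = _ := eb.symm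
    rw [ea', eb', reassoc_of% ih, Category.assoc, h]

end Front

/-! ## Reindexing of copairings and of trilinear maps -/

section Reindexing

theorem val_blockIndex_inl (n m r : ℕ) (k : Fin m) (a : Fin r) :
    (blockIndex n m r (.inl (k, a)) : ℕ) = a + r * k := by
  simp [blockIndex, prodIndex]

theorem val_blockIndex_inr (n m r : ℕ) (x : Fin n) :
    (blockIndex n m r (.inr x) : ℕ) = r * m + x := by
  simp [blockIndex, Nat.add_comm]

/-- The permutation of blocks of `r` factors. -/
def blockPerm (n r : ℕ) {m : ℕ} (π : Equiv.Perm (Fin m)) : Equiv.Perm (Fin (n + r * m)) :=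
  (blockIndex n m r).symm.trans
    ((Equiv.sumCongr (Equiv.prodCongr π (Equiv.refl _)) (Equiv.refl _)).trans (blockIndex n m r))

theorem blockPerm_inl (n r : ℕ) {m : ℕ} (π : Equiv.Perm (Fin m)) (k : Fin m) (a : Fin r) :
    blockPerm n r π (blockIndex n m r (.inl (k, a))) = blockIndex n m r (.inl (π k, a)) := by
  simp [blockPerm]

theorem blockPerm_inr (n r : ℕ) {m : ℕ} (π : Equiv.Perm (Fin m)) (x : Fin n) :
    blockPerm n r π (blockIndex n m r (.inr x)) = blockIndex n m r (.inr x) := by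
  simp [blockPerm]

theorem blockPerm_mul (n r : ℕ) {m : ℕ} (π ρ : Equiv.Perm (Fin m)) :
    blockPerm n r (π * ρ) = (blockPerm n r ρ).trans (blockPerm n r π) := by
  ext x : 1
  obtain ⟨⟨k, a⟩ | y, rfl⟩ := (blockIndex n m r).surjective x
  · simp [blockPerm_inl]
  · simp [blockPerm_inr]

theorem blockPerm_one (n r : ℕ) {m : ℕ} :
    blockPerm n r (1 : Equiv.Perm (Fin m)) = Equiv.refl _ := by
  ext x : 1
  obtain ⟨⟨k, a⟩ | y, rfl⟩ := (blockIndex n m r).surjective x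
  · simp [blockPerm_inl]
  · simp [blockPerm_inr]

/-- Exchanging the first two blocks is a rotation of `r` factors past `r` others, while a later
exchange leaves the first block alone. These are the two cases of the inductions over adjacent
transpositions. -/
theorem val_blockPerm_swap_zero (n r m : ℕ) (x : Fin (n + r * (m + 2))) :
    (blockPerm n r (Equiv.swap (0 : Fin (m + 2)) 1) x : ℕ) =
      Equiv.rotsFin (n + r * m) r r (Fin.cast (by ring) x) := by
  have h := Equiv.val_rotsFin (n + r * m) r r (Fin.cast (by ring) x)
  rw [Fin.val_cast] at h
  refine Eq.trans ?_ h.symm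
  obtain ⟨⟨k, a⟩ | y, rfl⟩ := (blockIndex n (m + 2) r).surjective x
  · rw [blockPerm_inl, val_blockIndex_inl, val_blockIndex_inl]
    have := a.isLt
    induction k using Fin.cases with
    | zero => simp
    | succ k =>
      induction k using Fin.cases with
      | zero => simp
      | succ k =>
        have h2 : r * (k.succ.succ : ℕ) = r * (k : ℕ) + r + r := by simp [mul_add]
        rw [Equiv.swap_apply_of_ne_of_ne (by simp) (by simp [Fin.ext_iff]), h2]
        split_ifs <;> omega
  · rw [blockPerm_inr, val_blockIndex_inr]
    have h2 : r * (m + 2) = r * m + r + r := by ring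
    rw [h2]
    split_ifs <;> omega

theorem val_blockPerm_swap_succ (n r m : ℕ) (i : Fin m) (x : Fin (n + r * (m + 2))) :
    (blockPerm n r (Equiv.swap i.succ.castSucc i.succ.succ) x : ℕ) =
      (blockPerm n r (Equiv.swap i.castSucc i.succ)).shiftFin r (Fin.cast (by ring) x) := by
  have h := Equiv.val_shiftFin (blockPerm n r (Equiv.swap i.castSucc i.succ))
    (fun y => if h : y < n + r * (m + 1) then
      (blockPerm n r (Equiv.swap i.castSucc i.succ) ⟨y, h⟩ : ℕ) else 0)
    (fun y => by rw [dif_pos y.isLt]) r (Fin.cast (by ring) x)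
  rw [Fin.val_cast] at h
  refine Eq.trans ?_ h.symm
  obtain ⟨⟨k, a⟩ | y, rfl⟩ := (blockIndex n (m + 2) r).surjective x
  · rw [blockPerm_inl, val_blockIndex_inl, val_blockIndex_inl]
    have := a.isLt
    induction k using Fin.cases with
    | zero =>
      rw [Equiv.swap_apply_of_ne_of_ne (by simp [Fin.ext_iff]) (by simp [Fin.ext_iff])]
      simp
    | succ k =>
      have h2 : ((a : ℕ) + r * (k.succ : ℕ)) - r = a + r * k := by
        simp only [Fin.val_succ, mul_add]
        omega
      have h3 : ¬ ((a : ℕ) + r * (k.succ : ℕ) < r) := by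
        simp only [Fin.val_succ, mul_add]
        omega
      have h4 : (⟨a + r * k, by rw [← val_blockIndex_inl n (m + 1) r k a]; exact Fin.isLt _⟩ :
          Fin (n + r * (m + 1))) = blockIndex n (m + 1) r (.inl (k, a)) :=
        Fin.ext (val_blockIndex_inl _ _ _ _ _).symm
      have h5 : (a : ℕ) + r * k < n + r * (m + 1) := by
        rw [← val_blockIndex_inl n (m + 1) r k a]; exact Fin.isLt _
      rw [if_neg h3, h2, dif_pos h5, h4, blockPerm_inl, val_blockIndex_inl, Fin.castSucc_succ]
      have h6 : Equiv.swap i.castSucc.succ i.succ.succ k.succ =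
          (Equiv.swap i.castSucc i.succ k).succ := by
        simp only [Equiv.swap_apply_def, Fin.succ_inj]
        split_ifs <;> rfl
      rw [h6, Fin.val_succ, mul_add]
      omega
  · rw [blockPerm_inr, val_blockIndex_inr]
    have h2 : r * (m + 2) = r * (m + 1) + r := by ring
    have h4 : (⟨r * (m + 1) + y, by rw [← val_blockIndex_inr n (m + 1) r y]; exact Fin.isLt _⟩ :
        Fin (n + r * (m + 1))) = blockIndex n (m + 1) r (.inr y) :=
      Fin.ext (val_blockIndex_inr _ _ _ _).symm
    have h5 : r * (m + 1) + y < n + r * (m + 1) := by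
      rw [← val_blockIndex_inr n (m + 1) r y]; exact Fin.isLt _
    have h3 : r * (m + 2) + y - r = r * (m + 1) + y := by
      rw [h2]
      omega
    have h6 : ¬ (r * (m + 2) + y < r) := by
      rw [h2]
      omega
    rw [if_neg h6, h3, dif_pos h5, h4, blockPerm_inr, val_blockIndex_inr, h2]
    omega

/-- Permutations are generated by adjacent transpositions. -/
theorem perm_fin_induction {k : ℕ} (P : Equiv.Perm (Fin (k + 1)) → Prop) (h1 : P 1)
    (hmul : ∀ π ρ, P π → P ρ → P (π * ρ))
    (hswap : ∀ i : Fin k, P (Equiv.swap i.castSucc i.succ)) (π : Equiv.Perm (Fin (k + 1))) :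
    P π := by
  have h : π ∈ Submonoid.closure (Set.range fun i : Fin k => Equiv.swap i.castSucc i.succ) := by
    rw [Equiv.Perm.mclosure_swap_castSucc_succ]
    trivial
  induction h using Submonoid.closure_induction with
  | mem x hx =>
    obtain ⟨i, rfl⟩ := hx
    exact hswap i
  | one => exact h1
  | mul x y _ _ hx hy => exact hmul x y hx hy

variable {C : Type u₁} [Category.{v₁} C] [MonoidalCategory C] {A : C}

/-- A copairing as a morphism between tensor powers. -/
def toTwo (c : 𝟙_ C ⟶ A ⊗ A) : tpow A 0 ⟶ tpow A 2 := c ≫ A ◁ (ρ_ A).inv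

/-- A pairing as a morphism between tensor powers. -/
def fromTwo (b : A ⊗ A ⟶ 𝟙_ C) : tpow A 2 ⟶ tpow A 0 :=
  show A ⊗ (A ⊗ 𝟙_ C) ⟶ 𝟙_ C from (A ◁ (ρ_ A).hom) ≫ b

/-- A trilinear map as a morphism between tensor powers. -/
def fromThree (t : (A ⊗ A) ⊗ A ⟶ 𝟙_ C) : tpow A 3 ⟶ tpow A 0 :=
  show A ⊗ (A ⊗ (A ⊗ 𝟙_ C)) ⟶ 𝟙_ C from (A ◁ (A ◁ (ρ_ A).hom)) ≫ (α_ A A A).inv ≫ t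

theorem tfront_toTwo (c : 𝟙_ C ⟶ A ⊗ A) (n : ℕ) : tfront (toTwo c) n =
    (λ_ (tpow A n)).inv ≫ (c ▷ tpow A n) ≫ (α_ A A (tpow A n)).hom := by
  have h : ∀ X : C, (λ_ X).inv ≫ ((c ≫ A ◁ (ρ_ A).inv) ▷ X) ≫ ((α_ A (A ⊗ 𝟙_ C) X).hom ≫
      A ◁ ((α_ A (𝟙_ C) X).hom ≫ A ◁ (λ_ X).hom)) =
      (λ_ X).inv ≫ (c ▷ X) ≫ (α_ A A X).hom := by
    intro X
    monoidal
  exact h (tpow A n)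

theorem tfront_fromTwo (b : A ⊗ A ⟶ 𝟙_ C) (n : ℕ) : tfront (fromTwo b) n =
    (α_ A A (tpow A n)).inv ≫ (b ▷ tpow A n) ≫ (λ_ (tpow A n)).hom := by
  have h : ∀ X : C, ((A ◁ ((A ◁ (λ_ X).inv) ≫ (α_ A (𝟙_ C) X).inv)) ≫ (α_ A (A ⊗ 𝟙_ C) X).inv) ≫
      (((A ◁ (ρ_ A).hom) ≫ b) ▷ X) ≫ (λ_ X).hom =
      (α_ A A X).inv ≫ (b ▷ X) ≫ (λ_ X).hom := by
    intro X
    monoidal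
  exact h (tpow A n)

theorem tfront_fromThree (t : (A ⊗ A) ⊗ A ⟶ 𝟙_ C) (n : ℕ) : tfront (fromThree t) n =
    (α_ A A (A ⊗ tpow A n)).inv ≫ (α_ (A ⊗ A) A (tpow A n)).inv ≫
      (t ▷ tpow A n) ≫ (λ_ (tpow A n)).hom := by
  have h : ∀ X : C, ((A ◁ ((A ◁ ((A ◁ (λ_ X).inv) ≫ (α_ A (𝟙_ C) X).inv)) ≫
      (α_ A (A ⊗ 𝟙_ C) X).inv)) ≫ (α_ A (A ⊗ A ⊗ 𝟙_ C) X).inv) ≫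
      (((A ◁ (A ◁ (ρ_ A).hom)) ≫ (α_ A A A).inv ≫ t) ▷ X) ≫ (λ_ X).hom =
      (α_ A A (A ⊗ X)).inv ≫ (α_ (A ⊗ A) A X).inv ≫ (t ▷ X) ≫ (λ_ X).hom := by
    intro X
    monoidal
  exact h (tpow A n)

theorem copairs_succ {n m : ℕ} (c : Fin (m + 1) → (𝟙_ C ⟶ A ⊗ A)) :
    copairs A (n := n) c =
      copairs A (fun k => c k.succ) ≫ tfront (toTwo (c 0)) (n + 2 * m) := by
  rw [tfront_toTwo]
  rfl

theorem triples_succ (t : (A ⊗ A) ⊗ A ⟶ 𝟙_ C) (n m : ℕ) :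
    triples A t (n := n) (m + 1) = tfront (fromThree t) (n + 3 * m) ≫ triples A t m := by
  rw [tfront_fromThree]
  have h : ∀ {X Y Z W V : C} (f : X ⟶ Y) (g : Y ⟶ Z) (h : Z ⟶ W) (k : W ⟶ V) {U : C} (l : V ⟶ U),
      f ≫ g ≫ h ≫ k ≫ l = (f ≫ g ≫ h ≫ k) ≫ l := by simp
  exact h _ _ _ _ _

/-- The trilinear maps act on the front factors and `h` on the legs behind them, so the interchange
law applies to each of them. -/
theorem triples_naturality (t : (A ⊗ A) ⊗ A ⟶ 𝟙_ C) {n n' : ℕ} (h : tpow A n ⟶ tpow A n') :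
    ∀ m, triples A t m ≫ h = tshift h (3 * m) ≫ triples A t m
  | 0 => (Category.id_comp h).trans (Category.comp_id h).symm
  | m + 1 => by
    have e : tshift h (3 * (m + 1)) ≫ triples A t (m + 1) =
      tshift (tshift h (3 * m)) 3 ≫ triples A t (m + 1) := rfl
    rw [e, triples_succ, triples_succ, Category.assoc, triples_naturality t h m,
      ← tfront_tshift_assoc, tshift_zero]

variable [SymmetricCategory C]

theorem perm_rotsFin_zero (n k : ℕ) :
    perm A (n + 0 + k) (n + k + 0) (Equiv.rotsFin n 0 k) = 𝟙 (tpow A (n + k)) :=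
  perm_eq_id fun x => by
    refine (Equiv.val_rotsFin n 0 k x).trans ?_
    split_ifs <;> omega

/-- Two insertions commute. -/
theorem tfront_insert_comm {a b : ℕ} (f : tpow A 0 ⟶ tpow A a) (g : tpow A 0 ⟶ tpow A b) (n : ℕ) :
    tfront f n ≫ tfront g (n + a) ≫ perm A (n + a + b) (n + b + a) (Equiv.rotsFin n a b) =
      tfront g n ≫ tfront f (n + b) := by
  -- Interchange makes `f` act behind the output of `g`; the rotation then brings the output of `f`
  -- to the front.
  have h1 := tfront_tshift g (tfront f n)
  have h2 := tshift_tfront f n b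
  rw [perm_rotsFin_zero] at h2
  replace h2 := h2.trans (Category.id_comp (tfront f (n + b)))
  rw [tshift_zero] at h1
  replace h1 : tfront g n ≫ tshift (tfront f n) b = tfront f n ≫ tfront g (n + a) := h1
  rw [← h2, reassoc_of% h1]

/-- Two evaluations commute. -/
theorem tfront_eval_comm {a b : ℕ} (f : tpow A a ⟶ tpow A 0) (g : tpow A b ⟶ tpow A 0) (n : ℕ) :
    perm A (n + a + b) (n + b + a) (Equiv.rotsFin n a b) ≫ tfront f (n + b) ≫ tfront g n =
      tfront g (n + a) ≫ tfront f n := by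
  have h1 := tfront_tshift g (tfront f n)
  have h2 := tshift_tfront f n b
  rw [perm_rotsFin_zero] at h2
  replace h2 := (Category.comp_id (tshift (tfront f n) b)).symm.trans h2
  rw [tshift_zero] at h1
  rw [← reassoc_of% h2, h1]
  rfl

/-- The two outermost insertions commute up to a rotation. Any other exchange takes place behind the
copairing that is inserted last, and slides past it by the interchange law. -/
theorem copairs_swap {n : ℕ} : ∀ (m : ℕ) (i : Fin m) (c : Fin (m + 1) → (𝟙_ C ⟶ A ⊗ A)),
    copairs A (n := n) (c ∘ Equiv.swap i.castSucc i.succ) ≫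
      perm A _ _ (blockPerm n 2 (Equiv.swap i.castSucc i.succ)) = copairs A c
  | m + 1, i, c => by
    induction i using Fin.cases with
    | zero =>
      have h := tfront_insert_comm (toTwo (c 0)) (toTwo (c 1)) (n + 2 * m)
      have e : perm A (n + 2 * (m + 2)) (n + 2 * (m + 2))
          (blockPerm n 2 (Equiv.swap (Fin.castSucc 0) (Fin.succ 0))) =
          perm A (n + 2 * m + 2 + 2) (n + 2 * m + 2 + 2) (Equiv.rotsFin (n + 2 * m) 2 2) :=
        perm_congr (m := n + 2 * (m + 2)) (n := n + 2 * (m + 2)) (val_blockPerm_swap_zero n 2 m)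
      have e2 : ∀ k : Fin m, Equiv.swap (0 : Fin (m + 2)) 1 k.succ.succ = k.succ.succ := fun k =>
        Equiv.swap_apply_of_ne_of_ne (by simp) (by simp [Fin.ext_iff])
      rw [copairs_succ, copairs_succ, copairs_succ c, copairs_succ (fun k => c k.succ)]
      simp only [Function.comp_apply, Fin.castSucc_zero, Fin.succ_zero_eq_one,
        Equiv.swap_apply_left, Equiv.swap_apply_right, e2, Category.assoc] at e ⊢
      refine congrArg (fun f => copairs A (fun k => c k.succ.succ) ≫ f) ?_
      refine Eq.trans ?_ h
      exact congrArg (fun f => tfront (toTwo (c 0)) (n + 2 * m) ≫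
        tfront (toTwo (c 1)) (n + 2 * m + 2) ≫ f) e
    | succ i =>
      have ih := copairs_swap (n := n) m i (fun k => c k.succ)
      have e : perm A (n + 2 * (m + 2)) (n + 2 * (m + 2))
          (blockPerm n 2 (Equiv.swap i.succ.castSucc i.succ.succ)) =
          tshift (perm A (n + 2 * (m + 1)) (n + 2 * (m + 1))
            (blockPerm n 2 (Equiv.swap i.castSucc i.succ))) 2 := by
        rw [tshift_perm]
        exact perm_congr (val_blockPerm_swap_succ n 2 m i)
      have e0 : Equiv.swap i.succ.castSucc i.succ.succ 0 = 0 :=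
        Equiv.swap_apply_of_ne_of_ne (by simp [Fin.ext_iff]) (by simp [Fin.ext_iff])
      have e2 : ∀ k : Fin (m + 1), Equiv.swap i.succ.castSucc i.succ.succ k.succ =
          (Equiv.swap i.castSucc i.succ k).succ := fun k => by
        rw [Fin.castSucc_succ]
        simp only [Equiv.swap_apply_def, Fin.succ_inj]
        split_ifs <;> rfl
      rw [copairs_succ, copairs_succ c]
      simp only [Function.comp_apply, e0, e2, Category.assoc]
      have h := tfront_tshift (toTwo (c 0)) (perm A (n + 2 * (m + 1)) (n + 2 * (m + 1))
            (blockPerm n 2 (Equiv.swap i.castSucc i.succ)))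
      rw [tshift_zero] at h
      refine (congrArg (fun f => copairs A (fun k => c (Equiv.swap i.castSucc i.succ k).succ) ≫
        tfront (toTwo (c 0)) (n + 2 * (m + 1)) ≫ f) e).trans ?_
      refine (congrArg (fun f => copairs A (fun k => c (Equiv.swap i.castSucc i.succ k).succ) ≫
        f) h).trans ?_
      rw [← Category.assoc]
      exact congrArg (fun f => f ≫ tfront (toTwo (c 0)) (n + 2 * (m + 1))) ih

/-- Adjacent transpositions generate, so `copairs_swap` suffices. Together with `triples_reindex`
this makes state sums independent of the numbering of edges and triangles. -/
theorem copairs_reindex {n m : ℕ} (π : Equiv.Perm (Fin m)) (c : Fin m → (𝟙_ C ⟶ A ⊗ A)) :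
    copairs A (n := n) (c ∘ π) ≫ perm A _ _ (blockPerm n 2 π) = copairs A c := by
  have h1 : ∀ c, copairs A (n := n) (c ∘ (1 : Equiv.Perm (Fin m))) ≫
      perm A _ _ (blockPerm n 2 (1 : Equiv.Perm (Fin m))) = copairs A c := by
    intro c
    rw [blockPerm_one, perm_refl, Category.comp_id]
    rfl
  cases m with
  | zero => rw [Subsingleton.elim π 1, h1]
  | succ k =>
    induction π using perm_fin_induction generalizing c with
    | h1 => exact h1 c
    | hmul π ρ hπ hρ =>
      rw [blockPerm_mul, ← perm_comp, Equiv.Perm.coe_mul, ← Function.comp_assoc,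
        reassoc_of% (hρ _), hπ]
    | hswap i => exact copairs_swap k i c

theorem triples_swap (t : (A ⊗ A) ⊗ A ⟶ 𝟙_ C) {n : ℕ} : ∀ (m : ℕ) (i : Fin m),
    perm A _ _ (blockPerm n 3 (Equiv.swap i.castSucc i.succ)) ≫ triples A t (n := n) (m + 1) =
      triples A t (m + 1)
  | m + 1, i => by
    induction i using Fin.cases with
    | zero =>
      have h := tfront_eval_comm (fromThree t) (fromThree t) (n + 3 * m)
      have e : perm A (n + 3 * (m + 2)) (n + 3 * (m + 2))
          (blockPerm n 3 (Equiv.swap (Fin.castSucc 0) (Fin.succ 0))) =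
          perm A (n + 3 * m + 3 + 3) (n + 3 * m + 3 + 3) (Equiv.rotsFin (n + 3 * m) 3 3) :=
        perm_congr (m := n + 3 * (m + 2)) (n := n + 3 * (m + 2)) (val_blockPerm_swap_zero n 3 m)
      rw [triples_succ, triples_succ]
      refine (congrArg (fun f => f ≫ tfront (fromThree t) (n + 3 * m + 3) ≫
        tfront (fromThree t) (n + 3 * m) ≫ triples A t m) e).trans ?_
      have h' := congrArg (fun f => f ≫ triples A t m) h
      simp only [Category.assoc] at h'
      exact h'
    | succ i =>
      have ih := triples_swap t (n := n) m i
      have e : perm A (n + 3 * (m + 2)) (n + 3 * (m + 2))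
          (blockPerm n 3 (Equiv.swap i.succ.castSucc i.succ.succ)) =
          tshift (perm A (n + 3 * (m + 1)) (n + 3 * (m + 1))
            (blockPerm n 3 (Equiv.swap i.castSucc i.succ))) 3 := by
        rw [tshift_perm]
        exact perm_congr (val_blockPerm_swap_succ n 3 m i)
      have h := tfront_tshift (fromThree t) (perm A (n + 3 * (m + 1)) (n + 3 * (m + 1))
            (blockPerm n 3 (Equiv.swap i.castSucc i.succ)))
      rw [tshift_zero] at h
      rw [triples_succ]
      refine (congrArg (fun f => f ≫ tfront (fromThree t) (n + 3 * (m + 1)) ≫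
        triples A t (m + 1)) e).trans ?_
      have h' := congrArg (fun f => f ≫ triples A t (m + 1)) h
      simp only [Category.assoc] at h'
      refine h'.symm.trans ?_
      exact congrArg (fun f => tfront (fromThree t) (n + 3 * (m + 1)) ≫ f) ih

theorem triples_reindex (t : (A ⊗ A) ⊗ A ⟶ 𝟙_ C) {n m : ℕ} (π : Equiv.Perm (Fin m)) :
    perm A _ _ (blockPerm n 3 π) ≫ triples A t (n := n) m = triples A t m := by
  have h1 : perm A _ _ (blockPerm n 3 (1 : Equiv.Perm (Fin m))) ≫ triples A t (n := n) m =
      triples A t m := by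
    rw [blockPerm_one, perm_refl, Category.id_comp]
  cases m with
  | zero => rw [Subsingleton.elim π 1, h1]
  | succ k =>
    induction π using perm_fin_induction with
    | h1 => exact h1
    | hmul π ρ hπ hρ => rw [blockPerm_mul, ← perm_comp, Category.assoc, hπ, hρ]
    | hswap i => exact triples_swap t k i

end Reindexing

/-! ## State sums of abstract dual graphs -/

section Diagram

variable {C : Type u₁} [Category.{v₁} C] [MonoidalCategory C] [SymmetricCategory C] {A : C}

/-! ### Connectivity of graphs and cutting of edges -/

section Equivs

variable {E T : Type*} {m p N : ℕ}

/-- The permutation given by the connectivity `σ` of a graph with edges `E`, trivalent vertices `T`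
and `N` outgoing legs. -/
def diagEquiv (eE : E ≃ Fin m) (eT : T ≃ Fin p) (σ : E × Fin 2 ≃ (T × Fin 3) ⊕ Fin N) :
    Fin (0 + 2 * m) ≃ Fin (N + 3 * p) :=
  (blockIndex 0 m 2).symm.trans <| (Equiv.sumEmpty _ _).trans <|
    (Equiv.prodCongr eE.symm (Equiv.refl _)).trans <| σ.trans <|
      (Equiv.sumCongr (Equiv.prodCongr eT (Equiv.refl _)) (Equiv.refl _)).trans (blockIndex N p 3)

theorem diagEquiv_apply (eE : E ≃ Fin m) (eT : T ≃ Fin p) (σ : E × Fin 2 ≃ (T × Fin 3) ⊕ Fin N)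
    (e : E) (a : Fin 2) : diagEquiv eE eT σ (blockIndex 0 m 2 (.inl (eE e, a))) =
      blockIndex N p 3 (Sum.map (Prod.map eT id) id (σ (e, a))) := by
  simp [diagEquiv]

theorem diagEquiv_surj (eE : E ≃ Fin m) (x : Fin (0 + 2 * m)) :
    ∃ e a, blockIndex 0 m 2 (.inl (eE e, a)) = x := by
  obtain ⟨⟨k, a⟩ | y, rfl⟩ := (blockIndex 0 m 2).surjective x
  · exact ⟨eE.symm k, a, by simp⟩
  · exact y.elim0

/-- Separating the edges of `K` further pairs of edges. -/
def splitSource (K : ℕ) (R : Type*) :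
    ((Fin K × Fin 2) ⊕ R) × Fin 2 ≃ (Fin K × Fin 2) ⊕ ((Fin K ⊕ R) × Fin 2) where
  toFun
    | (.inl (k, a), 0) => .inl (k, a)
    | (.inl (k, a), 1) => .inr (.inl k, a)
    | (.inr r, a) => .inr (.inr r, a)
  invFun
    | .inl (k, a) => (.inl (k, a), 0)
    | .inr (.inl k, a) => (.inl (k, a), 1)
    | .inr (.inr r, a) => (.inr r, a)
  left_inv := by
    rintro ⟨⟨k, a⟩ | r, b⟩
    · fin_cases b <;> rfl
    · rfl
  right_inv := by
    rintro (⟨k, a⟩ | ⟨k | r, a⟩) <;> rfl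

/-- The connectivity of the graph in which each of the first `K` edges is cut into two edges, which
have their first ends at `2 K` additional legs. -/
def splitEdges {K : ℕ} {R : Type*} (σ : (Fin K ⊕ R) × Fin 2 ≃ (T × Fin 3) ⊕ Fin N) :
    ((Fin K × Fin 2) ⊕ R) × Fin 2 ≃ (T × Fin 3) ⊕ Fin (N + 2 * K) :=
  (splitSource K R).trans <| (Equiv.sumCongr (Equiv.refl _) σ).trans <|
    (Equiv.sumAssoc _ _ _).symm.trans <| (Equiv.sumCongr (Equiv.sumComm _ _) (Equiv.refl _)).trans <|
      (Equiv.sumAssoc _ _ _).trans (Equiv.sumCongr (Equiv.refl _) (blockIndex N K 2))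

theorem Equiv.val_shiftFin_of_lt {m n : ℕ} (σ : Fin m ≃ Fin n) (k : ℕ) (x : Fin (m + k))
    (h : (x : ℕ) < k) : (σ.shiftFin k x : ℕ) = x := by
  rw [Equiv.val_shiftFin σ (fun y => if h : y < m then σ ⟨y, h⟩ else 0)
    (fun y => by rw [dif_pos y.isLt]) k x, if_pos h]

theorem Equiv.val_shiftFin_add {m n : ℕ} (σ : Fin m ≃ Fin n) (k : ℕ) (x : Fin (m + k)) (y : Fin m)
    (h : (x : ℕ) = y + k) : (σ.shiftFin k x : ℕ) = σ y + k := by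
  rw [Equiv.val_shiftFin σ (fun y => if h : y < m then σ ⟨y, h⟩ else 0)
    (fun y => by rw [dif_pos y.isLt]) k x, if_neg (by omega)]
  simp [h]

theorem Equiv.val_swap_one_two {n : ℕ} (x : Fin (n + 3)) :
    (Equiv.swap (1 : Fin (n + 3)) 2 x : ℕ) =
      if (x : ℕ) = 1 then 2 else if (x : ℕ) = 2 then 1 else (x : ℕ) := by
  simp only [Equiv.swap_apply_def, Fin.ext_iff, apply_ite Fin.val]
  rfl

variable {K : ℕ} {R : Type*} (σ : (Fin K ⊕ R) × Fin 2 ≃ (T × Fin 3) ⊕ Fin N)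

/-- The inclusion of the slots when `2 K` legs are added. -/
def addLegs (T : Type*) (N K : ℕ) : (T × Fin 3) ⊕ Fin N → (T × Fin 3) ⊕ Fin (N + 2 * K) :=
  Sum.map id fun x => blockIndex N K 2 (.inr x)

theorem Equiv.val_rotsFin_of_val {n a k : ℕ} {x : Fin (n + a + k)} {v : ℕ} (h : (x : ℕ) = v) :
    (Equiv.rotsFin n a k x : ℕ) = if v < k then v + a else if v < k + a then v - k else v := by
  subst h
  exact Equiv.val_rotsFin n a k x

/-- The two new legs come right behind the `3 * p` inputs of triangles. The rotation takes them to
the front, which shifts all other slots by two. -/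
theorem val_rotsFin_addLegs (eT : T ≃ Fin p) (s : (T × Fin 3) ⊕ Fin N) :
    (Equiv.rotsFin N 2 (3 * p)
      (blockIndex (N + 2) p 3 (Sum.map (Prod.map eT id) id (addLegs T N 1 s))) : ℕ) =
      blockIndex N p 3 (Sum.map (Prod.map eT id) id s) + 2 := by
  rcases s with ⟨x, b⟩ | x
  · have h1 := val_blockIndex_inl (N + 2) p 3 (eT x) b
    have h2 := val_blockIndex_inl N p 3 (eT x) b
    have h3 : (b : ℕ) + 3 * (eT x : ℕ) < 3 * p := by
      have := b.isLt
      have := (eT x).isLt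
      omega
    refine (Equiv.val_rotsFin_of_val h1).trans ?_
    rw [if_pos h3]
    exact congrArg (· + 2) h2.symm
  · have h1 := val_blockIndex_inr (N + 2) p 3 (blockIndex N 1 2 (.inr x))
    have h2 := val_blockIndex_inr N 1 2 x
    have h3 := val_blockIndex_inr N p 3 x
    refine (Equiv.val_rotsFin_of_val h1).trans ?_
    refine Eq.trans ?_ (congrArg (· + 2) h3.symm)
    rw [h2]
    split_ifs <;> omega

theorem splitEdges_inl_zero (k : Fin K) (a : Fin 2) :
    splitEdges σ (.inl (k, a), 0) = .inr (blockIndex N K 2 (.inl (k, a))) := rfl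

theorem splitEdges_inl_one (k : Fin K) (a : Fin 2) :
    splitEdges σ (.inl (k, a), 1) = addLegs T N K (σ (.inl k, a)) := by
  have : splitEdges σ (.inl (k, a), 1) = (Equiv.sumCongr (Equiv.refl _) (blockIndex N K 2))
    ((Equiv.sumAssoc _ _ _) ((Equiv.sumCongr (Equiv.sumComm _ _) (Equiv.refl _))
      ((Equiv.sumAssoc _ _ _).symm (.inr (σ (.inl k, a)))))) := rfl
  rw [this]
  rcases σ (.inl k, a) with x | x <;> rfl

theorem splitEdges_inr (r : R) (a : Fin 2) :
    splitEdges σ (.inr r, a) = addLegs T N K (σ (.inr r, a)) := by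
  have : splitEdges σ (.inr r, a) = (Equiv.sumCongr (Equiv.refl _) (blockIndex N K 2))
    ((Equiv.sumAssoc _ _ _) ((Equiv.sumCongr (Equiv.sumComm _ _) (Equiv.refl _))
      ((Equiv.sumAssoc _ _ _).symm (.inr (σ (.inr r, a)))))) := rfl
  rw [this]
  rcases σ (.inr r, a) with x | x <;> rfl

end Equivs

variable {E T E' T' : Type*} {m p m' p' N : ℕ}

/-- The state sum of a graph with edges `E`, trivalent vertices `T` and `N` outgoing legs. -/
def diagram (t : (A ⊗ A) ⊗ A ⟶ 𝟙_ C) (eE : E ≃ Fin m) (eT : T ≃ Fin p)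
    (c : E → (𝟙_ C ⟶ A ⊗ A)) (σ : E × Fin 2 ≃ (T × Fin 3) ⊕ Fin N) : tpow A 0 ⟶ tpow A N :=
  copairs A (n := 0) (fun k => c (eE.symm k)) ≫ perm A _ _ (diagEquiv eE eT σ) ≫ triples A t p

/-- An isomorphism of graphs changes the numberings by block permutations of the copairings and of
the trilinear maps, and each of these is absorbed on its own side of the connectivity. -/
theorem diagram_reindex (t : (A ⊗ A) ⊗ A ⟶ 𝟙_ C) (eE : E ≃ Fin m) (eT : T ≃ Fin p)
    (eE' : E' ≃ Fin m') (eT' : T' ≃ Fin p') (c : E → (𝟙_ C ⟶ A ⊗ A)) (c' : E' → (𝟙_ C ⟶ A ⊗ A))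
    (σ : E × Fin 2 ≃ (T × Fin 3) ⊕ Fin N) (σ' : E' × Fin 2 ≃ (T' × Fin 3) ⊕ Fin N)
    (f : E ≃ E') (g : T ≃ T') (hc : ∀ e, c' (f e) = c e)
    (hσ : ∀ e a, σ' (f e, a) = Sum.map (Prod.map g id) id (σ (e, a))) :
    diagram t eE eT c σ = diagram t eE' eT' c' σ' := by
  obtain rfl : m = m' := Fin.equiv_iff_eq.1 ⟨eE.symm.trans (f.trans eE')⟩
  obtain rfl : p = p' := Fin.equiv_iff_eq.1 ⟨eT.symm.trans (g.trans eT')⟩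
  set π : Equiv.Perm (Fin m) := eE.symm.trans (f.trans eE')
  set ρ : Equiv.Perm (Fin p) := eT.symm.trans (g.trans eT')
  have h1 := copairs_reindex (A := A) (n := 0) π (fun k => c' (eE'.symm k))
  have h2 := triples_reindex t (n := N) ρ
  have h3 : (fun k => c' (eE'.symm k)) ∘ π = fun k => c (eE.symm k) := by
    funext k
    simp [π, hc]
  have h4 : (blockPerm 0 2 π).trans (diagEquiv eE' eT' σ') =
      (diagEquiv eE eT σ).trans (blockPerm N 3 ρ) := by
    ext x : 1
    obtain ⟨e, a, rfl⟩ := diagEquiv_surj eE x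
    have h5 : π (eE e) = eE' (f e) := by simp [π]
    rw [Equiv.trans_apply, Equiv.trans_apply, blockPerm_inl, h5, diagEquiv_apply, diagEquiv_apply,
      hσ]
    rcases σ (e, a) with ⟨x, b⟩ | x
    · simp [blockPerm_inl, ρ]
    · simp [blockPerm_inr]
  unfold diagram
  rw [← h1, ← h2, h3, Category.assoc, perm_comp_assoc, perm_comp_assoc, h2, h4]

theorem diagram_perm (t : (A ⊗ A) ⊗ A ⟶ 𝟙_ C) (eE : E ≃ Fin m) (eT : T ≃ Fin p)
    (c : E → (𝟙_ C ⟶ A ⊗ A)) (σ : E × Fin 2 ≃ (T × Fin 3) ⊕ Fin N) {N' : ℕ} (ρ : Fin N ≃ Fin N') :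
    diagram t eE eT c σ ≫ perm A N N' ρ =
      diagram t eE eT c (σ.trans (Equiv.sumCongr (Equiv.refl _) ρ)) := by
  unfold diagram
  rw [Category.assoc, Category.assoc, triples_naturality, tshift_perm]
  have h := perm_comp_assoc A _ _ _ (diagEquiv eE eT σ) (ρ.shiftFin (3 * p)) (triples A t p)
  rw [h]
  congr 2
  refine perm_congr fun x => ?_
  obtain ⟨e, a, rfl⟩ := diagEquiv_surj eE x
  rw [Equiv.trans_apply, diagEquiv_apply, diagEquiv_apply]
  refine (Equiv.val_shiftFin ρ (fun y => if h : y < N then ρ ⟨y, h⟩ else 0)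
    (fun y => by rw [dif_pos y.isLt]) (3 * p) _).trans ?_
  rw [Equiv.trans_apply]
  rcases σ (e, a) with ⟨x, b⟩ | x
  · have h1 := val_blockIndex_inl N p 3 (eT x) b
    have h2 := val_blockIndex_inl N' p 3 (eT x) b
    have h3 : (b : ℕ) + 3 * (eT x : ℕ) < 3 * p := by
      have := b.isLt
      have := (eT x).isLt
      omega
    simp [h1, h2, h3]
  · simp [val_blockIndex_inr, Nat.add_comm]

/-- The pairs of factors evaluated by `κ`. -/
def doubles (κ : A ⊗ A ⟶ 𝟙_ C) {n : ℕ} : (m : ℕ) → (tpow A (n + 2 * m) ⟶ tpow A n)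
  | 0 => 𝟙 _
  | m + 1 => tfront (fromTwo κ) (n + 2 * m) ≫ doubles κ m

/-- The copairing `c` arises by joining the first ends of `c₀` and `c₁` by `κ`. -/
def JoinsTo (κ : A ⊗ A ⟶ 𝟙_ C) (c₀ c₁ c : 𝟙_ C ⟶ A ⊗ A) : Prop :=
  ∀ n, tfront (toTwo c₁) n ≫ tfront (toTwo c₀) (n + 2) ≫
    perm A (n + 4) (n + 4) (Equiv.swap 1 2) ≫ tfront (fromTwo κ) (n + 2) = tfront (toTwo c) n

/-- The evaluation of the first two legs slides back through the trilinear maps and the connectivity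
until it meets the two copairings that were inserted last; there the hypothesis on `κ` replaces them
by one. -/
theorem diagram_join_one (t : (A ⊗ A) ⊗ A ⟶ 𝟙_ C) (κ : A ⊗ A ⟶ 𝟙_ C)
    (c : (Fin 1 × Fin 2) ⊕ Fin m → (𝟙_ C ⟶ A ⊗ A)) (c' : Fin 1 ⊕ Fin m → (𝟙_ C ⟶ A ⊗ A))
    (eT : T ≃ Fin p) (σ : (Fin 1 ⊕ Fin m) × Fin 2 ≃ (T × Fin 3) ⊕ Fin N)
    (hc : JoinsTo κ (c (.inl (0, 0))) (c (.inl (0, 1))) (c' (.inl 0)))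
    (hc' : ∀ r, c (.inr r) = c' (.inr r)) :
    diagram t (blockIndex m 1 2 : _ ≃ Fin (m + 2)) eT c (splitEdges σ) ≫
        tfront (fromTwo κ) N =
      diagram t (finSumFinEquiv.trans (finCongr (Nat.add_comm 1 m))) eT c' σ := by
  set n2 : (Fin 1 × Fin 2) ⊕ Fin m ≃ Fin (m + 2) := blockIndex m 1 2
  set n1 : Fin 1 ⊕ Fin m ≃ Fin (m + 1) := finSumFinEquiv.trans (finCongr (Nat.add_comm 1 m))
  have v2l : ∀ a : Fin 2, (n2 (.inl (0, a)) : ℕ) = a := fun a => by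
    simpa using val_blockIndex_inl m 1 2 0 a
  have v2r : ∀ k, (n2 (.inr k) : ℕ) = k + 2 := fun k => by
    have := val_blockIndex_inr m 1 2 k
    exact this.trans (by omega)
  have v1l : (n1 (.inl 0) : ℕ) = 0 := by simp [n1]
  have v1r : ∀ k, (n1 (.inr k) : ℕ) = k + 1 := fun k => by simp [n1]
  have s20 : n2.symm 0 = .inl (0, 0) := by
    rw [Equiv.symm_apply_eq]; exact Fin.ext (v2l 0).symm
  have s21 : n2.symm (Fin.succ 0) = .inl (0, 1) := by
    rw [Equiv.symm_apply_eq]; exact Fin.ext (v2l 1).symm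
  have s2 : ∀ k : Fin m, n2.symm k.succ.succ = .inr k := fun k => by
    rw [Equiv.symm_apply_eq]; exact Fin.ext (v2r k).symm
  have s10 : n1.symm 0 = .inl 0 := by
    rw [Equiv.symm_apply_eq]; exact Fin.ext v1l.symm
  have s1 : ∀ k : Fin m, n1.symm k.succ = .inr k := fun k => by
    rw [Equiv.symm_apply_eq]; exact Fin.ext (v1r k).symm
  have hl : copairs A (n := 0) (fun k => c (n2.symm k)) =
      copairs A (n := 0) (fun k => c' (.inr k)) ≫ tfront (toTwo (c (.inl (0, 1)))) (0 + 2 * m) ≫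
        tfront (toTwo (c (.inl (0, 0)))) (0 + 2 * (m + 1)) := by
    rw [copairs_succ, copairs_succ, s20, s21, Category.assoc]
    simp only [s2, hc']
  have hr : copairs A (n := 0) (fun k => c' (n1.symm k)) =
      copairs A (n := 0) (fun k => c' (.inr k)) ≫ tfront (toTwo (c' (.inl 0))) (0 + 2 * m) := by
    rw [copairs_succ, s10]
    simp only [s1]
  -- The ends of the two halves come in the order first, second, first, second. Exchanging positions
  -- `1` and `2` gathers the two first ends, which are the new legs; behind them everything is
  -- connected as before the cut.
  have hperm : (diagEquiv n2 eT (splitEdges σ)).trans (Equiv.rotsFin N 2 (3 * p)) =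
      (Equiv.swap (1 : Fin (0 + 2 * m + 4)) 2).trans ((diagEquiv n1 eT σ).shiftFin 2) := by
    ext x
    obtain ⟨e, a, rfl⟩ := diagEquiv_surj n2 x
    rw [Equiv.trans_apply, Equiv.trans_apply, diagEquiv_apply]
    have hx := val_blockIndex_inl 0 (m + 2) 2 (n2 e) a
    have hsw := Equiv.val_swap_one_two (n := 0 + 2 * m + 1) (blockIndex 0 (m + 2) 2 (.inl (n2 e, a)))
    rw [hx] at hsw
    have ha := a.isLt
    rcases e with ⟨k, b⟩ | r
    · obtain rfl : k = 0 := Subsingleton.elim _ _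
      rw [v2l] at hsw
      have hb := b.isLt
      have ha' : a = 0 ∨ a = 1 := by omega
      rcases ha' with rfl | rfl
      · rw [splitEdges_inl_zero]
        have h1 : ((Equiv.swap (1 : Fin (0 + 2 * m + 1 + 3)) 2)
            (blockIndex 0 (m + 2) 2 (.inl (n2 (.inl (0, b)), 0))) : ℕ) = b := by
          rw [hsw]
          simp only [Fin.val_zero]
          split_ifs <;> omega
        refine Eq.trans ?_ (Equiv.val_shiftFin_of_lt (diagEquiv n1 eT σ) 2 _
          (lt_of_eq_of_lt h1 hb)).symm
        refine Eq.trans ?_ h1.symm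
        have h2 := val_blockIndex_inl N 1 2 0 b
        have h3 := val_blockIndex_inr (N + 2) p 3 (blockIndex N 1 2 (.inl (0, b)))
        refine (Equiv.val_rotsFin_of_val h3).trans ?_
        rw [h2]
        simp only [Fin.val_zero, mul_zero, add_zero]
        split_ifs <;> omega
      · rw [splitEdges_inl_one]
        refine (val_rotsFin_addLegs eT _).trans ?_
        rw [← diagEquiv_apply n1]
        refine (Equiv.val_shiftFin_add (diagEquiv n1 eT σ) 2 _ _ ?_).symm
        refine hsw.trans ?_
        rw [val_blockIndex_inl, v1l]
        simp only [Fin.val_one]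
        split_ifs <;> omega
    · rw [splitEdges_inr]
      refine (val_rotsFin_addLegs eT _).trans ?_
      rw [← diagEquiv_apply n1]
      refine (Equiv.val_shiftFin_add (diagEquiv n1 eT σ) 2 _ _ ?_).symm
      refine hsw.trans ?_
      rw [v2r, val_blockIndex_inl, v1r]
      split_ifs <;> omega
  have h1 := triples_naturality t (tfront (fromTwo κ) N) p
  have h2 := tshift_tfront (fromTwo κ) N (3 * p)
  rw [perm_rotsFin_zero] at h2
  replace h2 := (Category.comp_id (tshift (tfront (fromTwo κ) N) (3 * p))).symm.trans h2
  have h3 := congrArg (fun σ => perm A (0 + 2 * m + 4) (N + 3 * p + 2) σ) hperm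
  have h4 := perm_comp A (0 + 2 * m + 4) (N + 2 + 3 * p) (N + 3 * p + 2)
    (diagEquiv n2 eT (splitEdges σ)) (Equiv.rotsFin N 2 (3 * p))
  have h5 := perm_comp A (0 + 2 * m + 4) (0 + 2 * m + 4) (N + 3 * p + 2)
    (Equiv.swap 1 2) ((diagEquiv n1 eT σ).shiftFin 2)
  have h6 := tfront_tshift (fromTwo κ) (perm A _ _ (diagEquiv n1 eT σ))
  rw [tshift_zero, tshift_perm] at h6
  have h7 := hc (0 + 2 * m)
  unfold diagram
  rw [hl, hr]
  simp only [Category.assoc]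
  refine congrArg (fun f => copairs A (n := 0) (fun k => c' (.inr k)) ≫ f) ?_
  rw [h1, ← reassoc_of% h7]
  refine congrArg (fun f => tfront (toTwo (c (.inl (0, 1)))) (0 + 2 * m) ≫
    tfront (toTwo (c (.inl (0, 0)))) (0 + 2 * m + 2) ≫ f) ?_
  rw [h2]
  have h8 : perm A (0 + 2 * m + 4) (N + 2 + 3 * p) (diagEquiv n2 eT (splitEdges σ)) ≫
      perm A (N + 2 + 3 * p) (N + 3 * p + 2) (Equiv.rotsFin N 2 (3 * p)) =
      perm A (0 + 2 * m + 4) (0 + 2 * m + 4) (Equiv.swap 1 2) ≫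
        perm A (0 + 2 * m + 4) (N + 3 * p + 2) ((diagEquiv n1 eT σ).shiftFin 2) :=
    h4.trans (h3.trans h5.symm)
  have h9 : perm A (0 + 2 * m + 2 + 2) (N + 3 * p + 2) ((diagEquiv n1 eT σ).shiftFin 2) ≫
      tfront (fromTwo κ) (N + 3 * p) = tfront (fromTwo κ) (0 + 2 * m + 2) ≫
        perm A (0 + 2 * m + 2) (N + 3 * p) (diagEquiv n1 eT σ) := h6.symm
  have h10 := congrArg (fun f => f ≫ tfront (fromTwo κ) (N + 3 * p) ≫ triples A t p) h8
  simp only [Category.assoc] at h10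
  refine Eq.trans ?_ (h10.trans ?_)
  · simp only [Category.assoc]
    rfl
  · exact congrArg (fun f => perm A (0 + 2 * m + 4) (0 + 2 * m + 4) (Equiv.swap 1 2) ≫ f)
      (by rw [reassoc_of% h9]; rfl)

section JoinEquivs

variable (K : ℕ) (R : Type*)

/-- Separating the first pair of edges. -/
def headPair : (Fin (K + 1) × Fin 2) ⊕ R ≃ (Fin 1 × Fin 2) ⊕ ((Fin K × Fin 2) ⊕ R) where
  toFun
    | .inl (k, a) => Fin.cases (.inl (0, a)) (fun k => .inr (.inl (k, a))) k
    | .inr r => .inr (.inr r)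
  invFun
    | .inl (_, a) => .inl (0, a)
    | .inr (.inl (k, a)) => .inl (k.succ, a)
    | .inr (.inr r) => .inr r
  left_inv := by
    rintro (⟨k, a⟩ | r)
    · induction k using Fin.cases <;> rfl
    · rfl
  right_inv := by
    rintro (⟨k, a⟩ | ⟨k, a⟩ | r)
    · rw [Subsingleton.elim k 0]
      rfl
    · rfl
    · rfl

/-- Moving the first edge to the remaining ones. -/
def headEdge (X : Type*) : Fin 1 ⊕ (X ⊕ R) ≃ X ⊕ (Fin 1 ⊕ R) where
  toFun
    | .inl k => .inr (.inl k)
    | .inr (.inl x) => .inl x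
    | .inr (.inr r) => .inr (.inr r)
  invFun
    | .inr (.inl k) => .inl k
    | .inl x => .inr (.inl x)
    | .inr (.inr r) => .inr (.inr r)
  left_inv := by rintro (k | x | r) <;> rfl
  right_inv := by rintro (x | k | r) <;> rfl

/-- Making one of the remaining edges the first edge. -/
def consEdge : Fin K ⊕ (Fin 1 ⊕ R) ≃ Fin (K + 1) ⊕ R where
  toFun
    | .inl k => .inl k.succ
    | .inr (.inl _) => .inl 0
    | .inr (.inr r) => .inr r
  invFun
    | .inl k => Fin.cases (.inr (.inl 0)) (fun k => .inl k) k
    | .inr r => .inr (.inr r)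
  left_inv := by
    rintro (k | k | r)
    · rfl
    · rw [Subsingleton.elim k 0]
      rfl
    · rfl
  right_inv := by
    rintro (k | r)
    · induction k using Fin.cases <;> rfl
    · rfl

end JoinEquivs

theorem addLegs_addLegs (T : Type*) (N K : ℕ) (s : (T × Fin 3) ⊕ Fin N) :
    addLegs T (N + 2 * K) 1 (addLegs T N K s) = addLegs T N (K + 1) s := by
  rcases s with x | x
  · rfl
  · refine congrArg Sum.inr (Fin.ext ?_)
    refine (val_blockIndex_inr (N + 2 * K) 1 2 _).trans ?_
    refine Eq.trans ?_ (val_blockIndex_inr N (K + 1) 2 x).symm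
    refine (congrArg (2 * 1 + ·) (val_blockIndex_inr N K 2 x)).trans ?_
    ring

/-- Induction on the number of cut edges. A pair that has been joined becomes an ordinary edge and
is from then on counted among the remaining ones, as an element of `Fin 1 ⊕ R`; therefore `R` has to
vary in the induction. -/
theorem diagram_join (t : (A ⊗ A) ⊗ A ⟶ 𝟙_ C) (κ : A ⊗ A ⟶ 𝟙_ C) : ∀ (K : ℕ) {R : Type*}
    {m m' : ℕ} (c : (Fin K × Fin 2) ⊕ R → (𝟙_ C ⟶ A ⊗ A)) (c' : Fin K ⊕ R → (𝟙_ C ⟶ A ⊗ A))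
    (eE : (Fin K × Fin 2) ⊕ R ≃ Fin m) (eE' : Fin K ⊕ R ≃ Fin m') (eT : T ≃ Fin p)
    (σ : (Fin K ⊕ R) × Fin 2 ≃ (T × Fin 3) ⊕ Fin N)
    (_ : ∀ k, JoinsTo κ (c (.inl (k, 0))) (c (.inl (k, 1))) (c' (.inl k)))
    (_ : ∀ r, c (.inr r) = c' (.inr r)),
    diagram t eE eT c (splitEdges σ) ≫ doubles κ K = diagram t eE' eT c' σ
  | 0, R, m, m', c, c', eE, eE', eT, σ, hc, hc' => by
    refine (Category.comp_id _).trans ?_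
    refine diagram_reindex t eE eT eE' eT c c' (N := N) (splitEdges σ) σ
      (Equiv.sumCongr (Equiv.equivOfIsEmpty _ _) (Equiv.refl R)) (Equiv.refl T) ?_ ?_
    · rintro (⟨k, _⟩ | r)
      · exact k.elim0
      · exact (hc' r).symm
    · rintro (⟨k, _⟩ | r) a
      · exact k.elim0
      · rw [splitEdges_inr]
        rcases h : σ (.inr r, a) with x | x
        · exact h
        · refine h.trans ?_
          refine congrArg Sum.inr (Fin.ext ?_)
          refine Eq.trans ?_ (val_blockIndex_inr N 0 2 x).symm
          omega
  | K + 1, R, m, m', c, c', eE, eE', eT, σ, hc, hc' => by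
    have hfin : Finite ((Fin (K + 1) × Fin 2) ⊕ R) := Finite.of_equiv _ eE.symm
    have hfin' : Finite R := Finite.of_injective
      (Sum.inr : R → (Fin (K + 1) × Fin 2) ⊕ R) Sum.inr_injective
    -- Arbitrary numberings of the intermediate edge sets; by `diagram_reindex` the choice does not
    -- matter.
    obtain ⟨q, ⟨e1⟩⟩ := Finite.exists_equiv_fin ((Fin K × Fin 2) ⊕ R)
    obtain ⟨q2, ⟨e2⟩⟩ := Finite.exists_equiv_fin ((Fin K × Fin 2) ⊕ (Fin 1 ⊕ R))
    obtain ⟨q3, ⟨e3⟩⟩ := Finite.exists_equiv_fin (Fin K ⊕ (Fin 1 ⊕ R))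
    let τ' : (Fin K ⊕ (Fin 1 ⊕ R)) × Fin 2 ≃ (T × Fin 3) ⊕ Fin N :=
      (Equiv.prodCongr (consEdge K R) (Equiv.refl _)).trans σ
    let f1 : Fin 1 ⊕ Fin q ≃ (Fin K × Fin 2) ⊕ (Fin 1 ⊕ R) :=
      (Equiv.sumCongr (Equiv.refl _) e1.symm).trans (headEdge R _)
    let τ : (Fin 1 ⊕ Fin q) × Fin 2 ≃ (T × Fin 3) ⊕ Fin (N + 2 * K) :=
      (Equiv.prodCongr f1 (Equiv.refl _)).trans (splitEdges τ')
    let f : (Fin (K + 1) × Fin 2) ⊕ R ≃ (Fin 1 × Fin 2) ⊕ Fin q :=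
      (headPair K R).trans (Equiv.sumCongr (Equiv.refl _) e1)
    -- The intermediate graph, in which the first pair is already joined and the other pairs are
    -- still cut.
    let c2 : (Fin K × Fin 2) ⊕ (Fin 1 ⊕ R) → (𝟙_ C ⟶ A ⊗ A) :=
      Sum.elim (fun x => c (.inl (x.1.succ, x.2)))
        (Sum.elim (fun _ => c' (.inl 0)) fun r => c' (.inr r))
    have h1 : diagram t eE eT c (splitEdges σ) =
        diagram t (blockIndex q 1 2 : _ ≃ Fin (q + 2)) eT (c ∘ f.symm) (splitEdges τ) := by
      refine diagram_reindex t eE eT _ eT c (c ∘ f.symm) (N := N + 2 * K + 2) (splitEdges σ)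
        (splitEdges τ) f (Equiv.refl T) (fun e => by simp) ?_
      have hid : ∀ s : (T × Fin 3) ⊕ Fin (N + 2 * (K + 1)),
          Sum.map (Prod.map (Equiv.refl T) id) id s = s := by
        rintro (x | x) <;> rfl
      intro e a
      refine Eq.trans ?_ (hid _).symm
      have ha : a = 0 ∨ a = 1 := by omega
      rcases e with ⟨k, b⟩ | r
      · induction k using Fin.cases with
        | zero =>
          have hf : f (.inl (0, b)) = .inl (0, b) := rfl
          have hτ : τ (.inl 0, b) = addLegs T N K (σ (.inl 0, b)) :=
            splitEdges_inr τ' (.inl 0) b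
          rw [hf]
          rcases ha with rfl | rfl
          · rw [splitEdges_inl_zero, splitEdges_inl_zero]
            refine congrArg Sum.inr (Fin.ext ?_)
            refine (val_blockIndex_inl (N + 2 * K) 1 2 0 b).trans ?_
            exact (val_blockIndex_inl N (K + 1) 2 0 b).symm
          · rw [splitEdges_inl_one, splitEdges_inl_one, hτ, addLegs_addLegs]
        | succ k =>
          have hf : f (.inl (k.succ, b)) = .inr (e1 (.inl (k, b))) := rfl
          have hf1 : f1 (.inr (e1 (.inl (k, b)))) = .inl (k, b) := by
            simp [f1, headEdge]
          have hτ : τ (.inr (e1 (.inl (k, b))), a) = splitEdges τ' (.inl (k, b), a) := by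
            rw [← hf1]
            rfl
          rw [hf, splitEdges_inr, hτ]
          rcases ha with rfl | rfl
          · rw [splitEdges_inl_zero, splitEdges_inl_zero]
            refine congrArg Sum.inr (Fin.ext ?_)
            refine (val_blockIndex_inr (N + 2 * K) 1 2 _).trans ?_
            refine Eq.trans ?_ (val_blockIndex_inl N (K + 1) 2 k.succ b).symm
            refine (congrArg (2 * 1 + ·) (val_blockIndex_inl N K 2 k b)).trans ?_
            rw [Fin.val_succ]
            ring
          · rw [splitEdges_inl_one, splitEdges_inl_one, addLegs_addLegs]
            rfl
      · have hf : f (.inr r) = .inr (e1 (.inr r)) := rfl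
        have hf1 : f1 (.inr (e1 (.inr r))) = .inr (.inr r) := by
          simp [f1, headEdge]
        have hτ : τ (.inr (e1 (.inr r)), a) = splitEdges τ' (.inr (.inr r), a) := by
          rw [← hf1]
          rfl
        rw [hf, splitEdges_inr, hτ, splitEdges_inr, splitEdges_inr, addLegs_addLegs]
        rfl
    have h2 := diagram_join_one t κ (c ∘ f.symm) (c2 ∘ f1) eT τ (by
      have e0 : f.symm (.inl (0, 0)) = .inl (0, 0) := rfl
      have e1' : f.symm (.inl (0, 1)) = .inl (0, 1) := rfl
      simp only [Function.comp_apply, e0, e1']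
      exact hc 0) (by
      intro x
      obtain ⟨y, rfl⟩ := e1.surjective x
      rcases y with ⟨k, b⟩ | r
      · simp [f, f1, headPair, headEdge, c2]
      · simp [f, f1, headPair, headEdge, c2, hc'])
    have h3 : diagram t (finSumFinEquiv.trans (finCongr (Nat.add_comm 1 q))) eT (c2 ∘ f1) τ =
        diagram t e2 eT c2 (splitEdges τ') := by
      refine diagram_reindex t _ eT e2 eT (c2 ∘ f1) c2 τ (splitEdges τ') f1 (Equiv.refl T)
        (fun e => rfl) ?_
      intro e a
      refine Eq.trans (b := τ (e, a)) rfl ?_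
      rcases τ (e, a) with x | x <;> rfl
    have h4 := diagram_join t κ K c2 (c' ∘ consEdge K R) e2 e3 eT τ'
      (fun k => hc k.succ) (by rintro (k | r) <;> rfl)
    have h5 : diagram t e3 eT (c' ∘ consEdge K R) τ' = diagram t eE' eT c' σ := by
      refine diagram_reindex t e3 eT eE' eT _ c' τ' σ (consEdge K R) (Equiv.refl T)
        (fun e => rfl) ?_
      intro e a
      refine Eq.trans (b := τ' (e, a)) rfl ?_
      rcases τ' (e, a) with x | x <;> rfl
    rw [← h5, ← h4, ← h3, ← h2]
    refine (congrArg (fun f => f ≫ doubles κ (n := N) (K + 1)) h1).trans ?_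
    exact (Category.assoc _ _ _).symm

end Diagram

/-! ## Joining copairings of a Frobenius algebra -/

section Joining

theorem Equiv.val_swap {n : ℕ} (a b x : Fin n) :
    (Equiv.swap a b x : ℕ) =
      (if (x : ℕ) = a then (b : ℕ) else if (x : ℕ) = b then (a : ℕ) else (x : ℕ) : ℕ) := by
  simp only [Equiv.swap_apply_def, Fin.ext_iff, apply_ite Fin.val]

/-- Moving the first element behind the two following ones. -/
def rotOne (n : ℕ) : Equiv.Perm (Fin (n + 3)) := Equiv.rotsFin n 2 1

/-- Moving the first two elements behind the following one. -/
def rotTwo (n : ℕ) : Equiv.Perm (Fin (n + 3)) := Equiv.rotsFin n 1 2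

/-- Exchanging the first two elements with the following two. -/
def rotPairs (n : ℕ) : Equiv.Perm (Fin (n + 4)) := Equiv.rotsFin n 2 2

/-- Exchanging the second and the third element. -/
def swapMid (n : ℕ) : Equiv.Perm (Fin (n + 3)) := Equiv.swap 1 2

/-- Fixing two additional first elements. -/
def Equiv.shiftTwo {n : ℕ} (σ : Equiv.Perm (Fin n)) : Equiv.Perm (Fin (n + 2)) := σ.shiftFin 2

theorem val_rotOne (n : ℕ) (x : Fin (n + 3)) : (rotOne n x : ℕ) =
    if (x : ℕ) = 0 then 2 else if (x : ℕ) = 1 then 0 else if (x : ℕ) = 2 then 1 else (x : ℕ) := by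
  refine (Equiv.val_rotsFin n 2 1 x).trans ?_
  split_ifs <;> omega

theorem val_rotTwo (n : ℕ) (x : Fin (n + 3)) : (rotTwo n x : ℕ) =
    if (x : ℕ) = 0 then 1 else if (x : ℕ) = 1 then 2 else if (x : ℕ) = 2 then 0 else (x : ℕ) := by
  refine (Equiv.val_rotsFin n 1 2 x).trans ?_
  split_ifs <;> omega

theorem val_rotPairs (n : ℕ) (x : Fin (n + 4)) : (rotPairs n x : ℕ) =
    if (x : ℕ) = 0 then 2 else if (x : ℕ) = 1 then 3 else if (x : ℕ) = 2 then 0 else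
      if (x : ℕ) = 3 then 1 else (x : ℕ) := by
  refine (Equiv.val_rotsFin n 2 2 x).trans ?_
  split_ifs <;> omega

theorem val_swapMid (n : ℕ) (x : Fin (n + 3)) : (swapMid n x : ℕ) =
    if (x : ℕ) = 1 then 2 else if (x : ℕ) = 2 then 1 else (x : ℕ) :=
  Equiv.val_swap 1 2 x

theorem Equiv.val_shiftTwo {n : ℕ} (σ : Equiv.Perm (Fin n)) (f : ℕ → ℕ)
    (hf : ∀ x, (σ x : ℕ) = f x) (x : Fin (n + 2)) :
    (σ.shiftTwo x : ℕ) =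
      if (x : ℕ) = 0 then 0 else if (x : ℕ) = 1 then 1 else f (x - 2) + 2 := by
  refine (Equiv.val_shiftFin σ f hf 2 x).trans ?_
  split_ifs <;> omega

theorem val_shiftTwo_swapMid (n : ℕ) (x : Fin (n + 5)) : ((swapMid n).shiftTwo x : ℕ) =
    if (x : ℕ) = 3 then 4 else if (x : ℕ) = 4 then 3 else (x : ℕ) := by
  refine (Equiv.val_shiftTwo (swapMid n) (fun x => if x = 1 then 2 else if x = 2 then 1 else x)
    (val_swapMid n) x).trans ?_
  split_ifs <;> omega

theorem val_shiftTwo_rotTwo (n : ℕ) (x : Fin (n + 5)) : ((rotTwo n).shiftTwo x : ℕ) =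
    if (x : ℕ) = 2 then 3 else if (x : ℕ) = 3 then 4 else if (x : ℕ) = 4 then 2 else (x : ℕ) := by
  refine (Equiv.val_shiftTwo (rotTwo n)
    (fun x => if x = 0 then 1 else if x = 1 then 2 else if x = 2 then 0 else x)
    (val_rotTwo n) x).trans ?_
  split_ifs <;> omega

theorem val_shiftTwo_swap (n : ℕ) (x : Fin (n + 4)) :
    ((Equiv.swap (0 : Fin (n + 2)) 1).shiftTwo x : ℕ) =
      if (x : ℕ) = 2 then 3 else if (x : ℕ) = 3 then 2 else (x : ℕ) := by
  refine (Equiv.val_shiftTwo (Equiv.swap (0 : Fin (n + 2)) 1)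
    (fun x => if x = 0 then 1 else if x = 1 then 0 else x) Equiv.val_swap_zero_one x).trans ?_
  split_ifs <;> omega

variable {C : Type u₁} [Category.{v₁} C] [MonoidalCategory C] {A : C}

/-- Tensoring a tensor power from the left with a copairing. -/
def tins (c : 𝟙_ C ⟶ A ⊗ A) (n : ℕ) : tpow A n ⟶ tpow A (n + 2) := tfront (toTwo c) n

/-- A pairing applied to the first two factors of a tensor power. -/
def tev (b : A ⊗ A ⟶ 𝟙_ C) (n : ℕ) : tpow A (n + 2) ⟶ tpow A n := tfront (fromTwo b) n

variable [SymmetricCategory C]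

variable (A) in
/-- The action of a permutation. -/
def tperm (n : ℕ) (σ : Equiv.Perm (Fin n)) : tpow A n ⟶ tpow A n := perm A n n σ

theorem tperm_tperm (n : ℕ) (σ τ : Equiv.Perm (Fin n)) :
    tperm A n σ ≫ tperm A n τ = tperm A n (σ.trans τ) := perm_comp A n n n σ τ

theorem tperm_tperm_assoc (n : ℕ) (σ τ : Equiv.Perm (Fin n)) {Z : C} (k : tpow A n ⟶ Z) :
    tperm A n σ ≫ tperm A n τ ≫ k = tperm A n (σ.trans τ) ≫ k := by
  rw [← Category.assoc, tperm_tperm]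

theorem tperm_congr {n : ℕ} {σ τ : Equiv.Perm (Fin n)} (h : ∀ x, (σ x : ℕ) = τ x) :
    tperm A n σ = tperm A n τ := perm_congr h

variable (c d : 𝟙_ C ⟶ A ⊗ A) (b : A ⊗ A ⟶ 𝟙_ C)

theorem tins_tins_comm (n : ℕ) :
    tins c n ≫ tins d (n + 2) ≫ tperm A (n + 4) (rotPairs n) = tins d n ≫ tins c (n + 2) :=
  tfront_insert_comm (toTwo c) (toTwo d) n

theorem tev_tev_comm (b' : A ⊗ A ⟶ 𝟙_ C) (n : ℕ) :
    tperm A (n + 4) (rotPairs n) ≫ tev b (n + 2) ≫ tev b' n = tev b' (n + 2) ≫ tev b n :=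
  tfront_eval_comm (fromTwo b) (fromTwo b') n

/-- Rules of this kind bring all insertions and evaluations to the front at the cost of a
permutation, so that identities of string diagrams reduce to identities of permutations. -/
theorem tcons_tins (n : ℕ) :
    tcons (tins c n) = tins c (n + 1) ≫ tperm A (n + 3) (rotTwo n) := by
  have h : tcons (tins c n) ≫ tperm A (n + 3) (rotOne n) = tins c (n + 1) := by
    have h1 := tshift_tfront (toTwo c) n 1
    rw [perm_rotsFin_zero] at h1
    exact h1.trans (Category.id_comp (tfront (toTwo c) (n + 1)))
  rw [← h, Category.assoc, tperm_tperm]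
  have h2 : tperm A (n + 3) ((rotOne n).trans (rotTwo n)) = 𝟙 _ := by
    refine perm_eq_id fun x => ?_
    rw [Equiv.trans_apply, val_rotTwo, val_rotOne]
    obtain ⟨_ | _ | _ | x, hx⟩ := x <;> simp
  rw [h2]
  exact (Category.comp_id _).symm

theorem tcons_tev (n : ℕ) :
    tcons (tev b n) = tperm A (n + 3) (rotOne n) ≫ tev b (n + 1) := by
  have h1 := tshift_tfront (fromTwo b) n 1
  rw [perm_rotsFin_zero] at h1
  exact (Category.comp_id _).symm.trans h1

theorem tcons_tcons_tev (n : ℕ) :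
    tcons (tcons (tev b n)) = tperm A (n + 4) (rotPairs n) ≫ tev b (n + 2) := by
  have h1 := tshift_tfront (fromTwo b) n 2
  rw [perm_rotsFin_zero] at h1
  exact (Category.comp_id _).symm.trans h1

theorem tcons_tcons_tins (n : ℕ) :
    tcons (tcons (tins c n)) = tins c (n + 2) ≫ tperm A (n + 4) (rotPairs n) := by
  have h : tcons (tcons (tins c n)) ≫ tperm A (n + 4) (rotPairs n) = tins c (n + 2) := by
    have h1 := tshift_tfront (toTwo c) n 2
    rw [perm_rotsFin_zero] at h1
    exact h1.trans (Category.id_comp (tfront (toTwo c) (n + 2)))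
  rw [← h, Category.assoc, tperm_tperm]
  have h2 : tperm A (n + 4) ((rotPairs n).trans (rotPairs n)) = 𝟙 _ := by
    refine perm_eq_id fun x => ?_
    rw [Equiv.trans_apply, val_rotPairs, val_rotPairs]
    obtain ⟨_ | _ | _ | _ | x, hx⟩ := x <;> simp
  rw [h2]
  exact (Category.comp_id _).symm

theorem tperm_tins (n : ℕ) (σ : Equiv.Perm (Fin n)) :
    tperm A n σ ≫ tins c n = tins c n ≫ tperm A (n + 2) σ.shiftTwo := by
  have h := tfront_tshift (toTwo c) (perm A n n σ)
  rw [tshift_perm] at h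
  exact h.symm

theorem tperm_tins_assoc (n : ℕ) (σ : Equiv.Perm (Fin n)) {Z : C} (k : tpow A (n + 2) ⟶ Z) :
    tperm A n σ ≫ tins c n ≫ k = tins c n ≫ tperm A (n + 2) σ.shiftTwo ≫ k := by
  rw [← Category.assoc, tperm_tins, Category.assoc]

theorem tev_tperm (n : ℕ) (σ : Equiv.Perm (Fin n)) :
    tev b n ≫ tperm A n σ = tperm A (n + 2) σ.shiftTwo ≫ tev b n := by
  have h := tfront_tshift (fromTwo b) (perm A n n σ)
  rw [tshift_perm _ 2] at h
  exact h

theorem tev_tperm_assoc (n : ℕ) (σ : Equiv.Perm (Fin n)) {Z : C} (k : tpow A n ⟶ Z) :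
    tev b n ≫ tperm A n σ ≫ k = tperm A (n + 2) σ.shiftTwo ≫ tev b n ≫ k := by
  rw [← Category.assoc, tev_tperm, Category.assoc]

theorem tev_tins (n : ℕ) :
    tev b n ≫ tins c n =
      tins c (n + 2) ≫ tperm A (n + 4) (rotPairs n) ≫ tev b (n + 2) := by
  rw [← tcons_tcons_tev]
  exact (tfront_tshift (toTwo c) (tev b n)).symm

theorem tev_tins_assoc (n : ℕ) {Z : C} (k : tpow A (n + 2) ⟶ Z) :
    tev b n ≫ tins c n ≫ k =
      tins c (n + 2) ≫ tperm A (n + 4) (rotPairs n) ≫ tev b (n + 2) ≫ k := by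
  have h := congrArg (fun f => f ≫ k) (tev_tins c b n)
  simpa only [Category.assoc] using h

theorem tins_braiding (n : ℕ) : tins (c ≫ (β_ A A).hom) n =
    tins c n ≫ tperm A (n + 2) (Equiv.swap 0 1) := by
  have h : ∀ X : C, (λ_ X).inv ≫ ((c ≫ (β_ A A).hom) ▷ X) ≫ (α_ A A X).hom =
      ((λ_ X).inv ≫ (c ▷ X) ≫ (α_ A A X).hom) ≫ (α_ A A X).inv ≫ ((β_ A A).hom ▷ X) ≫
        (α_ A A X).hom := by intro X; simp
  have e := perm_swap_zero_one A n
  unfold tins tperm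
  rw [tfront_toTwo, tfront_toTwo]
  refine (h _).trans ?_
  exact congrArg (fun f => ((λ_ (tpow A n)).inv ≫ (c ▷ tpow A n) ≫ (α_ A A (tpow A n)).hom) ≫ f) e.symm

theorem tev_braiding (n : ℕ) : tev ((β_ A A).hom ≫ b) n =
    tperm A (n + 2) (Equiv.swap 0 1) ≫ tev b n := by
  have h : ∀ X : C, (α_ A A X).inv ≫ (((β_ A A).hom ≫ b) ▷ X) ≫ (λ_ X).hom =
      ((α_ A A X).inv ≫ ((β_ A A).hom ▷ X) ≫ (α_ A A X).hom) ≫ (α_ A A X).inv ≫ (b ▷ X) ≫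
        (λ_ X).hom := by intro X; simp
  have e := perm_swap_zero_one A n
  unfold tev tperm
  rw [tfront_fromTwo, tfront_fromTwo]
  refine (h _).trans ?_
  exact congrArg (fun f => f ≫ (α_ A A (tpow A n)).inv ≫ (b ▷ tpow A n) ≫ (λ_ (tpow A n)).hom) e.symm

theorem joinsTo_iff (e : 𝟙_ C ⟶ A ⊗ A) : JoinsTo b c d e ↔ ∀ n,
    tins d n ≫ tins c (n + 2) ≫ tperm A (n + 4) (swapMid (n + 1)) ≫ tev b (n + 2) =
      tins e n := Iff.rfl

/-- The same joint seen from the other side: the two copairings change places, and the pairing and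
the resulting copairing are flipped. -/
theorem JoinsTo.braiding {b : A ⊗ A ⟶ 𝟙_ C} {c d e : 𝟙_ C ⟶ A ⊗ A} (h : JoinsTo b c d e) :
    JoinsTo ((β_ A A).hom ≫ b) d c (e ≫ (β_ A A).hom) := by
  rw [joinsTo_iff] at *
  intro n
  have h2 := tins_tins_comm d c n
  have h3 := congrArg (fun f => f ≫ tperm A (n + 4) (swapMid (n + 1)) ≫
    tperm A (n + 4) (Equiv.swap 0 1) ≫ tev b (n + 2)) h2
  simp only [Category.assoc] at h3
  rw [tins_braiding, ← h n, tev_braiding, Category.assoc, Category.assoc, Category.assoc,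
    tev_tperm]
  refine h3.symm.trans ?_
  refine congrArg (fun f => tins d n ≫ tins c (n + 2) ≫ f) ?_
  rw [tperm_tperm_assoc, tperm_tperm_assoc]
  refine Eq.trans ?_ (tperm_tperm_assoc (A := A) (n + 4) (swapMid (n + 1))
    (Equiv.swap (0 : Fin (n + 2)) 1).shiftTwo (tev b (n + 2))).symm
  refine congrArg (fun f => f ≫ tev b (n + 2)) (tperm_congr ?_)
  intro x
  simp only [Equiv.trans_apply]
  rw [val_shiftTwo_swap, val_swapMid, Equiv.val_swap_zero_one, val_swapMid, val_rotPairs]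
  obtain ⟨_ | _ | _ | _ | x, hx⟩ := x <;> simp

/-- The zigzag identities of a copairing and a pairing, for tensor powers. -/
structure IsZigzag (c : 𝟙_ C ⟶ A ⊗ A) (b : A ⊗ A ⟶ 𝟙_ C) : Prop where
  left : ∀ n, tcons (tins c n) ≫ tev b (n + 1) = 𝟙 _
  right : ∀ n, tins c (n + 1) ≫ tcons (tev b n) = 𝟙 _

namespace IsZigzag

variable {c b} (h : IsZigzag c b)
include h

/-- Write `c` symbolically as `x ⊗ y`. The flip puts `y` in front, and `x b(y, v) = v` for the first
factor `v` of `d` is the right zigzag. -/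
theorem joinsTo_right (d : 𝟙_ C ⟶ A ⊗ A) : JoinsTo b (c ≫ (β_ A A).hom) d d := by
  rw [joinsTo_iff]
  intro n
  have h1 := h.right (n + 1)
  rw [tcons_tev] at h1
  rw [tins_braiding, Category.assoc, tperm_tperm_assoc]
  have e : tperm A (n + 4) ((Equiv.swap 0 1).trans (swapMid (n + 1))) =
      tperm A (n + 1 + 3) (rotOne (n + 1)) := by
    refine tperm_congr fun x => ?_
    rw [Equiv.trans_apply, val_swapMid, Equiv.val_swap_zero_one, val_rotOne]
    obtain ⟨_ | _ | _ | _ | x, hx⟩ := x <;> simp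
  rw [e]
  exact (congrArg (fun f => tins d n ≫ f) h1).trans (Category.comp_id _)

/-- For two copies `x ⊗ y` and `x' ⊗ y'` of `c`, the left zigzag gives `b(x, x') y' = x`; what is
left is `y ⊗ x`. -/
theorem joinsTo_left : JoinsTo b c c (c ≫ (β_ A A).hom) := by
  rw [joinsTo_iff]
  intro n
  have h1 := h.left (n + 1)
  rw [tcons_tins] at h1
  have h2 := tins_tins_comm c c n
  have h3 := congrArg (fun f => f ≫ tperm A (n + 4) (swapMid (n + 1)) ≫ tev b (n + 2)) h2
  simp only [Category.assoc] at h3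
  rw [← h3, tins_braiding, tperm_tperm_assoc]
  have e : tperm A (n + 4) ((rotPairs n).trans (swapMid (n + 1))) =
      tperm A (n + 4) ((rotTwo (n + 1)).trans (Equiv.swap (0 : Fin (n + 2)) 1).shiftTwo) := by
    refine tperm_congr fun x => ?_
    rw [Equiv.trans_apply, Equiv.trans_apply, val_swapMid, val_rotPairs, val_shiftTwo_swap,
      val_rotTwo]
    obtain ⟨_ | _ | _ | _ | x, hx⟩ := x <;> simp
  rw [e, ← tperm_tperm, Category.assoc, ← tev_tperm]
  refine congrArg (fun f => tins c n ≫ f) ?_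
  replace h1 : tins c (n + 2) ≫ tperm A (n + 4) (rotTwo (n + 1)) ≫ tev b (n + 2) =
    𝟙 (tpow A (n + 2)) := (Category.assoc _ _ _).symm.trans h1
  rw [reassoc_of% h1]

/-- Inserting a copairing in front and pairing its first factor with the following factor. -/
def turnRight (c : 𝟙_ C ⟶ A ⊗ A) (b : A ⊗ A ⟶ 𝟙_ C) (n : ℕ) : tpow A (n + 1) ⟶ tpow A (n + 1) :=
  tins c (n + 1) ≫ tperm A (n + 3) (swapMid n) ≫ tev b (n + 1)

/-- Inserting a copairing behind the first factor and pairing this factor with its second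
factor. -/
def turnLeft (c : 𝟙_ C ⟶ A ⊗ A) (b : A ⊗ A ⟶ 𝟙_ C) (n : ℕ) : tpow A (n + 1) ⟶ tpow A (n + 1) :=
  tcons (tins c n) ≫ tperm A (n + 3) (swapMid n) ≫ tev b (n + 1)

/-- With copies `x ⊗ y` and `x' ⊗ y'` of `c`, the composite maps `v` to `b(v, y) b(x', x) y'`. The
left zigzag is used twice: `b(x', x) y = x'` and then `b(v, x') y' = v`. -/
theorem turnLeft_turnRight (n : ℕ) : turnLeft c b n ≫ turnRight c b n = 𝟙 _ := by
  have h1 := congrArg tcons (h.left (n + 1))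
  rw [tcons_comp, tcons_id, tcons_tcons_tins, tcons_tev] at h1
  have h2 := h.left n
  rw [tcons_tins] at h2
  have hc := tins_tins_comm c c (n + 1)
  have he := tev_tev_comm b b (n + 1)
  have hp : ∀ f : tpow A (n + 5) ⟶ tpow A (n + 1),
      tperm A (n + 3) (rotTwo n) ≫ tins c (n + 3) ≫ f =
        tins c (n + 3) ≫ tperm A (n + 5) (rotTwo n).shiftTwo ≫ f :=
    fun f => tperm_tins_assoc c (n + 3) (rotTwo n) f
  replace h1 : tins c (n + 3) ≫ tperm A (n + 5) (rotPairs (n + 1)) ≫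
    tperm A (n + 5) (rotOne (n + 2)) ≫ tev b (n + 3) = 𝟙 (tpow A (n + 3)) := by
    simpa only [Category.assoc] using h1
  -- The two zigzags in normal form, with all insertions before all evaluations. It remains to bring
  -- the composite into the same form and to compare permutations of the first five factors.
  have key : tins c (n + 1) ≫ tins c (n + 3) ≫ tperm A (n + 5)
      ((rotTwo n).shiftTwo.trans ((rotPairs (n + 1)).trans (rotOne (n + 2)))) ≫
        tev b (n + 3) ≫ tev b (n + 1) = 𝟙 _ := by
    rw [← tperm_tperm, ← tperm_tperm]
    simp only [Category.assoc]
    refine Eq.trans (congrArg (fun f => tins c (n + 1) ≫ f) (hp _).symm) ?_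
    rw [reassoc_of% h1]
    simpa only [Category.assoc] using h2
  rw [turnLeft, turnRight, tcons_tins]
  simp only [Category.assoc]
  have e1 := tev_tins_assoc c b (n + 1) (tperm A (n + 3) (swapMid n) ≫ tev b (n + 1))
  rw [e1, tev_tperm_assoc]
  have e2 : ∀ f : tpow A (n + 5) ⟶ tpow A (n + 1), tins c (n + 1) ≫ tins c (n + 3) ≫
      tperm A (n + 5) (rotPairs (n + 1)) ≫ f = tins c (n + 1) ≫ tins c (n + 3) ≫ f := fun f => by
    have := congrArg (fun g => g ≫ f) hc
    simpa only [Category.assoc] using this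
  rw [← e2, ← he] at key
  rw [← key]
  refine congrArg (fun f => tins c (n + 1) ≫ f) ?_
  have e3 := tperm_tins_assoc c (n + 3) (swapMid n) (tperm A (n + 5) (rotPairs (n + 1)) ≫
    tperm A (n + 5) (swapMid n).shiftTwo ≫ tev b (n + 3) ≫ tev b (n + 1))
  refine (congrArg (fun f => tperm A (n + 3) (rotTwo n) ≫ f) e3).trans ?_
  refine (hp _).trans ?_
  refine congrArg (fun f => tins c (n + 3) ≫ f) ?_
  simp only [← Category.assoc]
  refine congrArg (fun f => f ≫ tev b (n + 1)) (congrArg (fun f => f ≫ tev b (n + 3)) ?_)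
  have e4 : ∀ s₁ s₂ s₃ s₄ s₅ s₆ s₇ : Equiv.Perm (Fin (n + 5)),
      ((s₁.trans s₂).trans s₃).trans s₄ = (s₅.trans s₆).trans s₇ →
      ((tperm A (n + 5) s₁ ≫ tperm A (n + 5) s₂) ≫ tperm A (n + 5) s₃) ≫ tperm A (n + 5) s₄ =
        (tperm A (n + 5) s₅ ≫ tperm A (n + 5) s₆) ≫ tperm A (n + 5) s₇ := by
    intro s₁ s₂ s₃ s₄ s₅ s₆ s₇ hs
    rw [tperm_tperm, tperm_tperm, tperm_tperm, tperm_tperm, tperm_tperm, hs]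
  refine e4 _ _ _ _ _ _ _ (Equiv.ext fun x => Fin.ext ?_)
  simp only [Equiv.trans_apply]
  rw [val_shiftTwo_swapMid, val_rotPairs, val_shiftTwo_swapMid, val_shiftTwo_rotTwo, val_rotPairs,
    val_rotOne, val_rotPairs, val_shiftTwo_rotTwo, val_rotPairs]
  obtain ⟨_ | _ | _ | _ | _ | x, hx⟩ := x <;> simp

/-- Here the pairing meets the unflipped copairing on the wrong side, which produces `turnRight`.
Replacing it by `turnLeft` moves the pairing to the side where the right zigzag applies. -/
theorem joinsTo_braiding (hM : ∀ n, turnRight c b n = turnLeft c b n) :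
    JoinsTo b c (c ≫ (β_ A A).hom) c := by
  rw [joinsTo_iff]
  intro n
  have h1 := congrArg tcons (h.right n)
  rw [tcons_comp, tcons_id, tcons_tcons_tev, tcons_tins] at h1
  have h2 := tins_tins_comm c c n
  have h3 := hM (n + 1)
  rw [turnRight, turnLeft, tcons_tins] at h3
  replace h1 : tins c (n + 2) ≫ tperm A (n + 4) (rotTwo (n + 1)) ≫
      tperm A (n + 4) (rotPairs n) ≫ tev b (n + 2) = 𝟙 (tpow A (n + 2)) := by
    simpa only [Category.assoc] using h1
  rw [tins_braiding, Category.assoc]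
  refine (congrArg (fun f => tins c n ≫ tperm A (n + 2) (Equiv.swap 0 1) ≫ f) h3).trans ?_
  have h4 := tperm_tins_assoc c (n + 2) (Equiv.swap 0 1)
    (tperm A (n + 4) (rotTwo (n + 1)) ≫ tperm A (n + 4) (swapMid (n + 1)) ≫ tev b (n + 2))
  simp only [Category.assoc]
  refine (congrArg (fun f => tins c n ≫ f) h4).trans ?_
  have h5 := congrArg (fun f => f ≫ tperm A (n + 4) (Equiv.swap (0 : Fin (n + 2)) 1).shiftTwo ≫
    tperm A (n + 4) (rotTwo (n + 1)) ≫ tperm A (n + 4) (swapMid (n + 1)) ≫ tev b (n + 2)) h2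
  simp only [Category.assoc] at h5
  refine h5.symm.trans ?_
  refine Eq.trans ?_ (Category.comp_id (tins c n))
  refine congrArg (fun f => tins c n ≫ f) (Eq.trans ?_ h1)
  refine congrArg (fun f => tins c (n + 2) ≫ f) ?_
  have e4 : ∀ s₁ s₂ s₃ s₄ s₅ s₆ : Equiv.Perm (Fin (n + 4)),
      s₁.trans (s₂.trans (s₃.trans s₄)) = s₅.trans s₆ →
      tperm A (n + 4) s₁ ≫ tperm A (n + 4) s₂ ≫ tperm A (n + 4) s₃ ≫ tperm A (n + 4) s₄ ≫
        tev b (n + 2) =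
        tperm A (n + 4) s₅ ≫ tperm A (n + 4) s₆ ≫ tev b (n + 2) := by
    intro s₁ s₂ s₃ s₄ s₅ s₆ hs
    simp only [tperm_tperm_assoc, hs]
  refine e4 _ _ _ _ _ _ (Equiv.ext fun x => Fin.ext ?_)
  simp only [Equiv.trans_apply]
  rw [val_swapMid, val_rotTwo, val_shiftTwo_swap, val_rotPairs, val_rotPairs, val_rotTwo]
  obtain ⟨_ | _ | _ | _ | x, hx⟩ := x <;> simp

end IsZigzag

end Joining

/-! ### Zigzag identities of a Frobenius algebra and the sign rule for joints -/

section Frobenius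

variable {C : Type u₁} [Category.{v₁} C] [MonoidalCategory C] {A : C}

variable [SymmetricCategory C] [MonObj A] [ComonObj A]

/-- Since the coproduct is a bimodule map, `x · Δ(1) = Δ(x) = Δ(1) · x`; the counit on the factor
next to `x` then leaves `x`. -/
theorem IsFrobenius.isZigzag (hF : IsFrobenius A) :
    IsZigzag (frobCopairing A (-1)) (frobPairing A) := by
  have hc : frobCopairing A (-1) = (MonObj.one ≫ ComonObj.comul : 𝟙_ C ⟶ A ⊗ A) := by
    simp [frobCopairing]
  have hl : (A ◁ (MonObj.one ≫ ComonObj.comul)) ≫ (α_ A A A).inv ≫ (frobPairing A ▷ A) =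
      (ρ_ A).hom ≫ (λ_ A).inv := by
    have h := congrArg (fun f : A ⊗ A ⟶ A ⊗ A =>
      (show A ⊗ 𝟙_ C ⟶ 𝟙_ C ⊗ A from (A ◁ MonObj.one) ≫ f ≫ (ComonObj.counit ▷ A))) hF.left
    simp only [Category.assoc] at h
    rw [ComonObj.counit_comul, MonObj.mul_one_assoc] at h
    rw [← h]
    simp [frobPairing]
  have hr : ((MonObj.one ≫ ComonObj.comul) ▷ A) ≫ (α_ A A A).hom ≫ (A ◁ frobPairing A) =
      (λ_ A).hom ≫ (ρ_ A).inv := by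
    have h := congrArg (fun f : A ⊗ A ⟶ A ⊗ A =>
      (show 𝟙_ C ⊗ A ⟶ A ⊗ 𝟙_ C from (MonObj.one ▷ A) ≫ f ≫ (A ◁ ComonObj.counit))) hF.right
    simp only [Category.assoc] at h
    rw [ComonObj.comul_counit, MonObj.one_mul_assoc] at h
    rw [← h]
    simp [frobPairing]
  generalize frobPairing A = b at hl hr ⊢
  rw [hc]
  generalize (MonObj.one ≫ ComonObj.comul : 𝟙_ C ⟶ A ⊗ A) = c at hl hr ⊢
  constructor
  · intro n
    have h : ∀ X : C, (A ◁ ((λ_ X).inv ≫ (c ▷ X) ≫ (α_ A A X).hom)) ≫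
        (α_ A A (A ⊗ X)).inv ≫ (b ▷ (A ⊗ X)) ≫ (λ_ (A ⊗ X)).hom = 𝟙 _ := by
      intro X
      calc _ = ((ρ_ A).inv ▷ X) ≫ (((A ◁ c) ≫ (α_ A A A).inv ≫ (b ▷ A)) ▷ X) ≫
            ((λ_ A).hom ▷ X) := by monoidal
        _ = _ := by rw [hl]; simp
    unfold tins tev
    rw [tfront_toTwo, tfront_fromTwo]
    exact h (tpow A n)
  · intro n
    have h : ∀ X : C, ((λ_ (A ⊗ X)).inv ≫ (c ▷ (A ⊗ X)) ≫ (α_ A A (A ⊗ X)).hom) ≫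
        (A ◁ ((α_ A A X).inv ≫ (b ▷ X) ≫ (λ_ X).hom)) = 𝟙 _ := by
      intro X
      calc _ = ((λ_ A).inv ▷ X) ≫ (((c ▷ A) ≫ (α_ A A A).hom ≫ (A ◁ b)) ▷ X) ≫
            ((ρ_ A).hom ▷ X) := by monoidal
        _ = _ := by rw [hr]; simp
    unfold tins tev
    rw [tfront_toTwo, tfront_fromTwo]
    exact h (tpow A n)

theorem turnLeft_eq_nakayama (n : ℕ) :
    IsZigzag.turnLeft (frobCopairing A (-1)) (frobPairing A) n = 
      show A ⊗ tpow A n ⟶ A ⊗ tpow A n from nakayama A ▷ tpow A n := by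
  have e : tperm A (n + 3) (swapMid n) = tcons (tswap A n) := by
    rw [← perm_swap_zero_one, ← perm_consFin]
    refine perm_congr fun x => ?_
    rw [Equiv.val_consFin (Equiv.swap (0 : Fin (n + 2)) 1)
      (fun x => if x = 0 then 1 else if x = 1 then 0 else x) Equiv.val_swap_zero_one x]
    refine (val_swapMid n x).trans ?_
    split_ifs <;> omega
  unfold IsZigzag.turnLeft
  rw [e]
  unfold tins tev
  rw [tfront_toTwo, tfront_fromTwo]
  have h : ∀ (X : C) (c : 𝟙_ C ⟶ A ⊗ A) (b : A ⊗ A ⟶ 𝟙_ C),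
      (A ◁ ((λ_ X).inv ≫ (c ▷ X) ≫ (α_ A A X).hom)) ≫
      (A ◁ ((α_ A A X).inv ≫ ((β_ A A).hom ▷ X) ≫ (α_ A A X).hom)) ≫
      (α_ A A (A ⊗ X)).inv ≫ (b ▷ (A ⊗ X)) ≫ (λ_ (A ⊗ X)).hom =
      ((ρ_ A).inv ≫ (A ◁ c) ≫ (A ◁ (β_ A A).hom) ≫ (α_ A A A).inv ≫ (b ▷ A) ≫ (λ_ A).hom) ▷ X := by
    intro X c b
    monoidal
  exact h _ _ _

variable (A) in
/-- The pairing by which edges are joined when boundaries are glued with sign `ε`. -/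
def gluingPairing (ε : ℤˣ) : A ⊗ A ⟶ 𝟙_ C :=
  if ε = 1 then frobPairing A else (β_ A A).hom ≫ frobPairing A

theorem frobCopairing_braiding (s : ℤˣ) :
    frobCopairing A s ≫ (β_ A A).hom = frobCopairing A (-s) := by
  rcases Int.units_eq_one_or s with rfl | rfl
  · simp [frobCopairing]
  · simp [frobCopairing]

/-- For `ε = 1` all sign combinations are pure zigzags except `s = -1`, `s' = 1`, where a twist
remains that is harmless because `N` is an involution. The case `ε = -1` is the same joint read from
the other side, which flips the resulting sign. -/
theorem joinsTo_frobCopairing (hF : IsFrobenius A) (hN : nakayama A ≫ nakayama A = 𝟙 A)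
    (ε s s' : ℤˣ) : JoinsTo (gluingPairing A ε) (frobCopairing A s) (frobCopairing A s')
      (frobCopairing A (ε * s * s')) := by
  have hz := hF.isZigzag
  -- `turnLeft` is `N` on the first factor, hence an involution; as its composite with `turnRight`
  -- is the identity, the two agree.
  have hM : ∀ n, IsZigzag.turnRight (frobCopairing A (-1)) (frobPairing A) n =
      IsZigzag.turnLeft (frobCopairing A (-1)) (frobPairing A) n := by
    intro n
    have h1 := hz.turnLeft_turnRight n
    have h2 : IsZigzag.turnLeft (frobCopairing A (-1)) (frobPairing A) n ≫
        IsZigzag.turnLeft (frobCopairing A (-1)) (frobPairing A) n = 𝟙 _ := by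
      rw [turnLeft_eq_nakayama]
      have : ∀ X : C, (nakayama A ▷ X) ≫ (nakayama A ▷ X) = 𝟙 (A ⊗ X) := fun X => by
        rw [← comp_whiskerRight, hN, id_whiskerRight]
      exact this _
    have h3 := congrArg
      (fun f => IsZigzag.turnLeft (frobCopairing A (-1)) (frobPairing A) n ≫ f) h1
    rw [reassoc_of% h2] at h3
    exact h3.trans (Category.comp_id _)
  have hc : frobCopairing A 1 = frobCopairing A (-1) ≫ (β_ A A).hom := by
    rw [frobCopairing_braiding, neg_neg]
  have key : ∀ s s', JoinsTo (frobPairing A) (frobCopairing A s) (frobCopairing A s')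
      (frobCopairing A (s * s')) := by
    intro s s'
    rcases Int.units_eq_one_or s with rfl | rfl
    · rw [one_mul]
      exact hc ▸ hz.joinsTo_right _
    · rcases Int.units_eq_one_or s' with rfl | rfl
      · rw [mul_one, hc]
        exact hz.joinsTo_braiding hM
      · rw [neg_mul_neg, one_mul, hc]
        exact hz.joinsTo_left
  rcases Int.units_eq_one_or ε with rfl | rfl
  · rw [one_mul]
    exact key s s'
  · have h := (key s' s).braiding
    rw [frobCopairing_braiding, mul_comm] at h
    rw [neg_one_mul, neg_mul]
    exact h

end Frobenius

/-! ## Adjoints with respect to the pairing of tensor powers -/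

section Pairing

variable {C : Type u₁} [Category.{v₁} C] [MonoidalCategory C] [SymmetricCategory C] {A : C}

/-- The pairing of `A ⊗ X` with `A ⊗ Y`. -/
def consPairing (b : A ⊗ A ⟶ 𝟙_ C) {X Y : C} (p : X ⊗ Y ⟶ 𝟙_ C) : (A ⊗ X) ⊗ (A ⊗ Y) ⟶ 𝟙_ C :=
  tensorμ A X A Y ≫ (b ⊗ₘ p) ≫ (λ_ (𝟙_ C)).hom

/-- The pairing of `A ⊗ A` with itself. -/
def twoPairing (b : A ⊗ A ⟶ 𝟙_ C) : (A ⊗ A) ⊗ (A ⊗ A) ⟶ 𝟙_ C :=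
  tensorμ A A A A ≫ (b ⊗ₘ b) ≫ (λ_ (𝟙_ C)).hom

variable (b : A ⊗ A ⟶ 𝟙_ C)

/-- Coherence of `tensorμ`. It allows the first two factors to be treated as one block with pairing
`b ⊗ b`, so that exchanges and insertions are studied on this block alone. -/
theorem consPairing_consPairing {X Y : C} (p : X ⊗ Y ⟶ 𝟙_ C) :
    ((α_ A A X).hom ⊗ₘ (α_ A A Y).hom) ≫ consPairing b (consPairing b p) =
      tensorμ (A ⊗ A) X (A ⊗ A) Y ≫ (twoPairing b ⊗ₘ p) ≫ (λ_ (𝟙_ C)).hom := by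
  have h := associator_monoidal A A X A A Y
  have hl : ∀ {X Y Z W V U : C} (f : X ⟶ Y) (g : Y ⟶ Z) (h : Z ⟶ W) (k : U ⟶ V),
      (k ⊗ₘ (f ≫ g ≫ h)) = (U ◁ f) ≫ (k ⊗ₘ g) ≫ (V ◁ h) := by
    intro X Y Z W V U f g h k
    simp only [← id_tensorHom, tensorHom_comp_tensorHom, Category.id_comp,
      Category.comp_id]
  have hr : ∀ {X Y Z W V U : C} (f : X ⟶ Y) (g : Y ⟶ Z) (h : Z ⟶ W) (k : U ⟶ V),
      ((f ≫ g ≫ h) ⊗ₘ k) = (f ▷ U) ≫ (g ⊗ₘ k) ≫ (h ▷ V) := by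
    intro X Y Z W V U f g h k
    simp only [← tensorHom_id, tensorHom_comp_tensorHom, Category.id_comp,
      Category.comp_id]
  unfold consPairing twoPairing
  rw [hl, hr]
  simp only [Category.assoc]
  rw [← reassoc_of% h]
  refine congrArg (fun f => tensorμ (A ⊗ A) X (A ⊗ A) Y ≫ (tensorμ A A A A ▷ (X ⊗ Y)) ≫ f) ?_
  rw [← associator_naturality_assoc]
  refine congrArg (fun f => ((b ⊗ₘ b) ⊗ₘ p) ≫ f) ?_
  monoidal

theorem twoPairing_braiding :
    ((β_ A A).hom ⊗ₘ (β_ A A).hom) ≫ twoPairing b = twoPairing b := by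
  have h := SymmetricCategory.tensorμ_braid_swap A A
  unfold twoPairing
  rw [← reassoc_of% h, ← BraidedCategory.braiding_naturality_assoc,
    braiding_tensorUnit_left]
  simp [unitors_equal]

/-- Flipping both arguments of `b ⊗ b` only exchanges the two copies of `b`. As the flip is an
involution, a flip of one argument can be moved to the other. -/
theorem twoPairing_braiding_right :
    ((β_ A A).hom ▷ (A ⊗ A)) ≫ twoPairing b = ((A ⊗ A) ◁ (β_ A A).hom) ≫ twoPairing b := by
  have h := congrArg (fun f => ((A ⊗ A) ◁ (β_ A A).hom) ≫ f) (twoPairing_braiding b)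
  rw [MonoidalCategory.tensorHom_def', Category.assoc,
    ← MonoidalCategory.whiskerLeft_comp_assoc, SymmetricCategory.symmetry,
    MonoidalCategory.whiskerLeft_id, Category.id_comp] at h
  exact h

/-- The pairing that corresponds to the insertion of a copairing. -/
def insPairing (c : 𝟙_ C ⟶ A ⊗ A) : A ⊗ A ⟶ 𝟙_ C :=
  (λ_ (A ⊗ A)).inv ≫ (c ▷ (A ⊗ A)) ≫ twoPairing b

theorem insPairing_braiding (c : 𝟙_ C ⟶ A ⊗ A) :
    insPairing b (c ≫ (β_ A A).hom) = (β_ A A).hom ≫ insPairing b c := by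
  unfold insPairing
  rw [comp_whiskerRight_assoc, twoPairing_braiding_right, ← whisker_exchange_assoc,
    leftUnitor_inv_naturality_assoc]

theorem consPairing_tswap {X Y : C} (p : X ⊗ Y ⟶ 𝟙_ C) :
    (((α_ A A X).inv ≫ ((β_ A A).hom ▷ X) ≫ (α_ A A X).hom) ▷ (A ⊗ (A ⊗ Y))) ≫
        consPairing b (consPairing b p) =
      ((A ⊗ (A ⊗ X)) ◁ ((α_ A A Y).inv ≫ ((β_ A A).hom ▷ Y) ≫ (α_ A A Y).hom)) ≫
        consPairing b (consPairing b p) := by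
  have h := consPairing_consPairing b p
  have h1 : consPairing b (consPairing b p) = ((α_ A A X).inv ⊗ₘ (α_ A A Y).inv) ≫
      tensorμ (A ⊗ A) X (A ⊗ A) Y ≫ (twoPairing b ⊗ₘ p) ≫ (λ_ (𝟙_ C)).hom := by
    rw [← h]; simp
  have hl := tensorμ_natural_left (β_ A A).hom (𝟙 X) (A ⊗ A) Y
  have hr := tensorμ_natural_right (A ⊗ A) X (β_ A A).hom (𝟙 Y)
  rw [h1]
  have e1 : (((α_ A A X).inv ≫ ((β_ A A).hom ▷ X) ≫ (α_ A A X).hom) ▷ (A ⊗ (A ⊗ Y))) ≫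
      ((α_ A A X).inv ⊗ₘ (α_ A A Y).inv) = ((α_ A A X).inv ⊗ₘ (α_ A A Y).inv) ≫
        (((β_ A A).hom ⊗ₘ 𝟙 X) ▷ ((A ⊗ A) ⊗ Y)) := by
    simp only [← tensorHom_id, tensorHom_comp_tensorHom, Category.id_comp,
      Category.comp_id, Category.assoc]
    simp
  have e2 : ((A ⊗ (A ⊗ X)) ◁ ((α_ A A Y).inv ≫ ((β_ A A).hom ▷ Y) ≫ (α_ A A Y).hom)) ≫
      ((α_ A A X).inv ⊗ₘ (α_ A A Y).inv) = ((α_ A A X).inv ⊗ₘ (α_ A A Y).inv) ≫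
        (((A ⊗ A) ⊗ X) ◁ ((β_ A A).hom ⊗ₘ 𝟙 Y)) := by
    simp only [← tensorHom_id, ← id_tensorHom, tensorHom_comp_tensorHom, Category.id_comp,
      Category.comp_id, Category.assoc]
    simp
  rw [reassoc_of% e1, reassoc_of% e2, reassoc_of% hl, reassoc_of% hr]
  have e3 := congrArg (fun f => f ⊗ₘ p) (twoPairing_braiding_right b)
  simp only [id_whiskerRight, whiskerLeft_id] at e3 ⊢
  rw [tensorHom_comp_tensorHom_assoc, tensorHom_comp_tensorHom_assoc,
    Category.id_comp, e3]

theorem consPairing_tins (c : 𝟙_ C ⟶ A ⊗ A) {X Y : C} (p : X ⊗ Y ⟶ 𝟙_ C) :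
    (((λ_ X).inv ≫ (c ▷ X) ≫ (α_ A A X).hom) ▷ (A ⊗ (A ⊗ Y))) ≫
        consPairing b (consPairing b p) =
      (X ◁ ((α_ A A Y).inv ≫ (insPairing b c ▷ Y) ≫ (λ_ Y).hom)) ≫ p := by
  have h := consPairing_consPairing b p
  have h1 : consPairing b (consPairing b p) = ((α_ A A X).inv ⊗ₘ (α_ A A Y).inv) ≫
      tensorμ (A ⊗ A) X (A ⊗ A) Y ≫ (twoPairing b ⊗ₘ p) ≫ (λ_ (𝟙_ C)).hom := by
    rw [← h]; simp
  have hl := tensorμ_natural_left c (𝟙 X) (A ⊗ A) Y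
  have hr := tensorμ_natural_right (𝟙_ C) X (insPairing b c) (𝟙 Y)
  have hu := leftUnitor_monoidal X Y
  have e1 : (((λ_ X).inv ≫ (c ▷ X) ≫ (α_ A A X).hom) ▷ (A ⊗ (A ⊗ Y))) ≫
      ((α_ A A X).inv ⊗ₘ (α_ A A Y).inv) = ((λ_ X).inv ⊗ₘ (α_ A A Y).inv) ≫
        ((c ⊗ₘ 𝟙 X) ▷ ((A ⊗ A) ⊗ Y)) := by
    simp only [← tensorHom_id, tensorHom_comp_tensorHom, Category.id_comp,
      Category.comp_id, Category.assoc]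
    simp
  have e2 : (c ▷ (A ⊗ A)) ≫ twoPairing b =
      ((𝟙_ C) ◁ insPairing b c) ≫ (λ_ (𝟙_ C)).hom := by
    rw [leftUnitor_naturality]
    simp [insPairing]
  rw [h1, reassoc_of% e1, reassoc_of% hl, tensorHom_comp_tensorHom_assoc, e2]
  have e3 : (((𝟙_ C) ◁ insPairing b c) ≫ (λ_ (𝟙_ C)).hom ⊗ₘ (𝟙 X ▷ Y) ≫ p) =
      (((𝟙_ C) ◁ insPairing b c) ⊗ₘ (X ◁ 𝟙 Y)) ≫ ((λ_ (𝟙_ C)).hom ▷ (X ⊗ Y)) ≫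
        ((𝟙_ C) ◁ p) := by
    simp [MonoidalCategory.tensorHom_def]
  rw [e3, Category.assoc, ← reassoc_of% hr, Category.assoc, leftUnitor_naturality, ← reassoc_of% hu]
  simp only [← id_tensorHom, ← tensorHom_id, tensorHom_comp_tensorHom_assoc, Category.id_comp,
    Iso.inv_hom_id]

/-- `f` and `g` are adjoint with respect to the pairings of tensor powers. -/
def IsAdjointTo {m n : ℕ} (f : tpow A m ⟶ tpow A n) (g : tpow A n ⟶ tpow A m) : Prop :=
  (f ▷ tpow A n) ≫ pairing A b n = (tpow A m ◁ g) ≫ pairing A b m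

namespace IsAdjointTo

variable {b}

theorem id (n : ℕ) : IsAdjointTo b (𝟙 (tpow A n)) (𝟙 (tpow A n)) := by
  unfold IsAdjointTo
  rw [id_whiskerRight, whiskerLeft_id]

theorem comp {m n k : ℕ} {f : tpow A m ⟶ tpow A n} {g : tpow A n ⟶ tpow A m}
    {f' : tpow A n ⟶ tpow A k} {g' : tpow A k ⟶ tpow A n} (h : IsAdjointTo b f g)
    (h' : IsAdjointTo b f' g') : IsAdjointTo b (f ≫ f') (g' ≫ g) := by
  unfold IsAdjointTo at *
  rw [comp_whiskerRight_assoc, h', ← whisker_exchange_assoc, h,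
    MonoidalCategory.whiskerLeft_comp_assoc]

theorem tcons {m n : ℕ} {f : tpow A m ⟶ tpow A n} {g : tpow A n ⟶ tpow A m}
    (h : IsAdjointTo b f g) : IsAdjointTo b (tcons f) (tcons g) := by
  have key : ∀ {X Y : C} (f : X ⟶ Y) (g : Y ⟶ X) (p : X ⊗ X ⟶ 𝟙_ C) (q : Y ⊗ Y ⟶ 𝟙_ C),
      (f ▷ Y) ≫ q = (X ◁ g) ≫ p →
      ((A ◁ f) ▷ (A ⊗ Y)) ≫ consPairing b q = ((A ⊗ X) ◁ (A ◁ g)) ≫ consPairing b p := by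
    intro X Y f g p q h
    have h1 := tensorμ_natural_left (𝟙 A) f A Y
    have h2 := tensorμ_natural_right A X (𝟙 A) g
    simp only [id_tensorHom, id_whiskerRight, whiskerLeft_id] at h1 h2
    unfold consPairing
    rw [reassoc_of% h1, reassoc_of% h2]
    simp only [← MonoidalCategory.whiskerLeft_comp_assoc, MonoidalCategory.tensorHom_def',
      Category.assoc, h]
  exact key f g _ _ h

theorem tswap (n : ℕ) : IsAdjointTo b (tswap A n) (tswap A n) :=
  consPairing_tswap b (pairing A b n)

theorem tins (c : 𝟙_ C ⟶ A ⊗ A) (n : ℕ) :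
    IsAdjointTo b (tins c n) (tev (insPairing b c) n) := by
  have h := consPairing_tins b c (pairing A b n)
  unfold IsAdjointTo tev
  rw [tfront_fromTwo]
  refine Eq.trans ?_ h
  unfold _root_.tins
  rw [tfront_toTwo]
  rfl

/-- Adjacent exchanges are their own adjoints and inverses, so the adjoint built from them is an
inverse as well. Recording this permits the adjoint of a permutation to be recognised later as the
inverse permutation, without a recursive formula for the latter. -/
theorem tmove_exists : ∀ (n : ℕ) (i : Fin (n + 1)), ∃ g, IsAdjointTo b (tmove A n i) g ∧
    tmove A n i ≫ g = 𝟙 _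
  | n, i => by
    induction i using Fin.cases with
    | zero =>
      rw [tmove_zero]
      exact ⟨𝟙 _, id _, Category.comp_id _⟩
    | succ i =>
      cases n with
      | zero => exact i.elim0
      | succ n =>
        obtain ⟨g, h1, h2⟩ := tmove_exists n i
        refine ⟨_root_.tcons g ≫ _root_.tswap A n, ?_, ?_⟩
        · rw [tmove_succ]
          exact (tswap n).comp h1.tcons
        · rw [tmove_succ, Category.assoc, ← tcons_comp_assoc, h2, tcons_id]
          exact (congrArg (fun f => _root_.tswap A n ≫ f) (Category.id_comp _)).trans
            (tswap_tswap A n)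

theorem perm_exists : ∀ (n : ℕ) (σ : Equiv.Perm (Fin n)), ∃ g, IsAdjointTo b (perm A n n σ) g ∧
    perm A n n σ ≫ g = 𝟙 _
  | 0, σ => ⟨𝟙 _, id 0, Category.comp_id _⟩
  | n + 1, σ => by
    obtain ⟨g, h1, h2⟩ := perm_exists n (σ.removeFin 0)
    obtain ⟨k, h3, h4⟩ := tmove_exists (b := b) n (σ 0)
    refine ⟨k ≫ _root_.tcons g, ?_, ?_⟩
    · rw [perm_succ]
      exact h1.tcons.comp h3
    · rw [perm_succ, Category.assoc, reassoc_of% h4, ← tcons_comp, h2, tcons_id]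

theorem perm {m n : ℕ} (σ : Fin m ≃ Fin n) :
    IsAdjointTo b (perm A m n σ) (_root_.perm A n m σ.symm) := by
  obtain rfl := Fin.equiv_iff_eq.1 ⟨σ⟩
  obtain ⟨g, h1, h2⟩ := perm_exists (b := b) (A := A) m σ
  -- A right inverse and a left inverse of `perm A m m σ` coincide, which identifies the adjoint
  -- `g`.
  have h3 : _root_.perm A m m σ.symm ≫ _root_.perm A m m σ = 𝟙 _ := by
    rw [perm_comp, Equiv.symm_trans_self, perm_refl]
  have h4 := congrArg (fun f => _root_.perm A m m σ.symm ≫ f) h2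
  rw [reassoc_of% h3, Category.comp_id] at h4
  rw [← h4]
  exact h1

theorem copairs (c : 𝟙_ C ⟶ A ⊗ A) {n : ℕ} : ∀ m : ℕ,
    IsAdjointTo b (copairs A (n := n) (m := m) fun _ => c) (doubles (insPairing b c) m)
  | 0 => id n
  | m + 1 => by
    rw [copairs_succ]
    exact (copairs c m).comp (tins c _)

/-- Carries the gluing morphism from `TA` over to `Ttriang`, on which it acts by its adjoint. -/
theorem comp_pairing {m n : ℕ} {f : tpow A m ⟶ tpow A n} {g : tpow A n ⟶ tpow A m}
    (h : IsAdjointTo b f g) (t : 𝟙_ C ⟶ tpow A n) :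
    f ≫ (ρ_ _).inv ≫ (tpow A n ◁ t) ≫ pairing A b n =
      (ρ_ _).inv ≫ (tpow A m ◁ (t ≫ g)) ≫ pairing A b m := by
  rw [rightUnitor_inv_naturality_assoc, ← whisker_exchange_assoc, h,
    MonoidalCategory.whiskerLeft_comp_assoc]

end IsAdjointTo

/-- With `c = x ⊗ y` the form is `v ⊗ w ↦ b(x, v) b(y, w)`, and the right zigzag `x b(y, w) = w`
makes it `b(w, v)`. -/
theorem IsZigzag.insPairing_eq {b : A ⊗ A ⟶ 𝟙_ C} {c : 𝟙_ C ⟶ A ⊗ A} (h : IsZigzag c b) :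
    insPairing b c = (β_ A A).hom ≫ b := by
  have h1 := h.right 1
  rw [tcons_tev] at h1
  have h2 := tev_tev_comm b b 0
  have h3 := tperm_tins_assoc c 2 (Equiv.swap 0 1) (tperm A 4 (rotOne 1) ≫ tev b 2 ≫ tev b 0)
  have h1' := congrArg (fun f => f ≫ tev b 0) h1
  simp only [Category.assoc] at h1'
  have h4 : tins c 2 ≫ tperm A 4 (swapMid 1) ≫ tev b 2 ≫ tev b 0 =
      tperm A 2 (Equiv.swap 0 1) ≫ tev b 0 := by
    have e : tins c 2 ≫ tperm A 4 (rotOne 1) ≫ tev b 2 ≫ tev b 0 = tev b 0 := 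
      h1'.trans (Category.id_comp _)
    rw [e] at h3
    rw [h3]
    refine congrArg (fun f => tins c 2 ≫ f) ?_
    refine (congrArg (fun f => tperm A 4 (swapMid 1) ≫ f) h2.symm).trans ?_
    refine (tperm_tperm_assoc 4 _ _ _).trans (Eq.trans ?_ (tperm_tperm_assoc 4 _ _ _).symm)
    refine congrArg (fun f => f ≫ tev b 2 ≫ tev b 0) (tperm_congr fun x => ?_)
    rw [Equiv.trans_apply, Equiv.trans_apply]
    revert x
    decide
  have e5 : tperm A 4 (swapMid 1) = tcons (tswap A 1) := by
    rw [← perm_swap_zero_one, ← perm_consFin]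
    refine tperm_congr fun x => ?_
    revert x
    decide
  rw [← tev_braiding, e5] at h4
  unfold tins tev at h4
  rw [tfront_toTwo, tfront_fromTwo, tfront_fromTwo, tfront_fromTwo] at h4
  have h6 : ((λ_ (A ⊗ A ⊗ 𝟙_ C)).inv ≫ (c ▷ (A ⊗ A ⊗ 𝟙_ C)) ≫ (α_ A A (A ⊗ A ⊗ 𝟙_ C)).hom) ≫
      (A ◁ ((α_ A A (A ⊗ 𝟙_ C)).inv ≫ ((β_ A A).hom ▷ (A ⊗ 𝟙_ C)) ≫ (α_ A A (A ⊗ 𝟙_ C)).hom)) ≫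
      ((α_ A A (A ⊗ A ⊗ 𝟙_ C)).inv ≫ (b ▷ (A ⊗ A ⊗ 𝟙_ C)) ≫ (λ_ (A ⊗ A ⊗ 𝟙_ C)).hom) ≫
      (α_ A A (𝟙_ C)).inv ≫ (b ▷ (𝟙_ C)) ≫ (λ_ (𝟙_ C)).hom =
      (α_ A A (𝟙_ C)).inv ≫ (((β_ A A).hom ≫ b) ▷ (𝟙_ C)) ≫ (λ_ (𝟙_ C)).hom := h4
  rw [← cancel_epi (A ◁ (ρ_ A).hom)]
  refine Eq.trans ?_ (h6.trans ?_)
  · unfold insPairing twoPairing tensorμ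
    rw [MonoidalCategory.tensorHom_def]
    monoidal
  · monoidal

theorem insPairing_frobCopairing [MonObj A] [ComonObj A] (hF : IsFrobenius A) (ε : ℤˣ) :
    insPairing (frobPairing A) (frobCopairing A ε) = gluingPairing A ε := by
  have h := hF.isZigzag.insPairing_eq
  rcases Int.units_eq_one_or ε with rfl | rfl
  · have hc : frobCopairing A 1 = frobCopairing A (-1) ≫ (β_ A A).hom := by
      rw [frobCopairing_braiding, neg_neg]
    rw [hc, insPairing_braiding, h]
    simp [gluingPairing]
  · rw [h]
    simp [gluingPairing]

end Pairing

/-! ## The combinatorics of gluing -/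

namespace Gluing

variable {n : ℕ} {Λ : SpinTriangulatedSurface.{u} (n + 2)} {i j : Fin (n + 2)} {hij : i ≠ j}
  {ε : ℤˣ} {Λ' : SpinTriangulatedSurface.{u} n} (G : Gluing Λ hij ε Λ')

theorem _root_.MarkedCombSurface.bdryEdge_injective {B : ℕ} (K : MarkedCombSurface.{u} B)
    {i j : Fin B} {k l : Fin 3} (h : K.bdryEdge i k = K.bdryEdge j l) : i = j ∧ k = l :=
  K.bdry_injective i k j l (congrArg (fun e : K.E => e.1.1) h)

theorem _root_.MarkedCombSurface.left_eq {B : ℕ} (K : MarkedCombSurface.{u} B) {e : K.E}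
    {s : K.Slot} (h : K.slotEnds s = e.1) : K.left e = s :=
  K.slotEnds_injective ((K.left_spec e).trans h.symm)

theorem _root_.MarkedCombSurface.right_eq {B : ℕ} (K : MarkedCombSurface.{u} B) {e : K.E}
    {s : K.T × Fin 3} (h : K.slotEnds (.inl s) = e.1.swap) : K.right e = s :=
  Sum.inl_injective (K.slotEnds_injective ((K.right_spec e).trans h.symm))

theorem _root_.MarkedCombSurface.left_bdryEdge {B : ℕ} (K : MarkedCombSurface.{u} B) (i : Fin B)
    (k : Fin 3) : K.left (K.bdryEdge i k) = .inr (i, k) :=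
  K.left_eq rfl

theorem _root_.MarkedCombSurface.eq_bdryEdge {B : ℕ} (K : MarkedCombSurface.{u} B) {e : K.E}
    {i : Fin B} {k : Fin 3} (h : K.left e = .inr (i, k)) : e = K.bdryEdge i k := by
  have h1 := K.left_spec e
  rw [h] at h1
  exact Subtype.ext h1.symm

/-- The image of an edge which is not on the `i`-th boundary. -/
def mapEdge (e : Λ.E) (he : ∀ k, e ≠ Λ.bdryEdge i k) : Λ'.E :=
  ⟨Prod.map G.vert G.vert e.1, by
    rw [G.edges_eq]
    exact ⟨e.1, ⟨e.2, fun k h => he k (Subtype.ext h)⟩, rfl⟩⟩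

theorem slotEnds_inl (s : Λ.T × Fin 3) : Λ'.slotEnds (.inl (G.triEquiv s.1, s.2)) =
    Prod.map G.vert G.vert (Λ.slotEnds (.inl s)) :=
  Prod.ext (G.tri_eq _ _) (G.tri_eq _ _)

theorem slotEnds_inr (m : Fin n) (l : Fin 3) : Λ'.slotEnds (.inr (m, l)) =
    Prod.map G.vert G.vert (Λ.slotEnds (.inr (remaining hij m, l))) :=
  Prod.ext (G.bdry_eq _ _) (G.bdry_eq _ _)

theorem right_mapEdge (e : Λ.E) (he : ∀ k, e ≠ Λ.bdryEdge i k) :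
    Λ'.right (G.mapEdge e he) = (G.triEquiv (Λ.right e).1, (Λ.right e).2) := by
  refine Λ'.right_eq ((G.slotEnds_inl _).trans ?_)
  rw [Λ.right_spec]
  rfl

theorem left_mapEdge_inl (e : Λ.E) (he : ∀ k, e ≠ Λ.bdryEdge i k) {s : Λ.T × Fin 3}
    (h : Λ.left e = .inl s) :
    Λ'.left (G.mapEdge e he) = .inl (G.triEquiv s.1, s.2) := by
  refine Λ'.left_eq ((G.slotEnds_inl _).trans ?_)
  rw [← h, Λ.left_spec]
  rfl

theorem left_mapEdge_inr (e : Λ.E) (he : ∀ k, e ≠ Λ.bdryEdge i k) {m : Fin n} {l : Fin 3}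
    (h : Λ.left e = .inr (remaining hij m, l)) :
    Λ'.left (G.mapEdge e he) = .inr (m, l) := by
  refine Λ'.left_eq ((G.slotEnds_inr _ _).trans ?_)
  rw [← h, Λ.left_spec]
  rfl

theorem vert_bdry (k : Fin 3) : G.vert (Λ.bdry i (-k)) = G.vert (Λ.bdry j k) :=
  (G.vert_eq_iff _ _).2 (Or.inr ⟨k, Or.inl ⟨rfl, rfl⟩⟩)

include hij in
theorem bdryEdge_j_ne (l k : Fin 3) : Λ.bdryEdge j l ≠ Λ.bdryEdge i k :=
  fun h => hij (Λ.bdryEdge_injective h).1.symm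

/-- The edge that arises by gluing the `k`-th edge of the `j`-th boundary. -/
def gluedEdge (k : Fin 3) : Λ'.E := G.mapEdge (Λ.bdryEdge j k) (bdryEdge_j_ne (hij := hij) k)

/-- A glued edge is oriented as an edge of the `j`-th boundary, where the boundary was on its left;
after gluing its place is taken by the triangle at the `i`-th boundary. -/
theorem left_gluedEdge (k : Fin 3) : Λ'.left (G.gluedEdge k) =
    .inl (G.triEquiv (Λ.right (Λ.bdryEdge i k.rev)).1, (Λ.right (Λ.bdryEdge i k.rev)).2) := by
  refine Λ'.left_eq ((G.slotEnds_inl _).trans ?_)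
  rw [Λ.right_spec]
  have h1 := G.vert_bdry k
  have h2 := G.vert_bdry (k + 1)
  -- Complex conjugation sends vertex `k` to `-k`, and so edge `k`, reversed, to the edge from `-(k
  -- + 1)` to `-k`, which has number `k.rev`.
  have e1 : k.rev + 1 = -k := by clear * -; revert k; decide
  have e2 : k.rev = -(k + 1) := by clear * -; revert k; decide
  refine Prod.ext ?_ ?_
  · change G.vert (Λ.bdry i (k.rev + 1)) = G.vert (Λ.bdry j k)
    rw [e1, h1]
  · change G.vert (Λ.bdry i k.rev) = G.vert (Λ.bdry j (k + 1))
    rw [e2, h2]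

variable (Λ i j) in
/-- The edges away from the glued boundaries. -/
abbrev FreeEdge : Type u :=
  {e : Λ.E // (∀ k, e ≠ Λ.bdryEdge i k) ∧ ∀ k, e ≠ Λ.bdryEdge j k}

theorem left_freeEdge (e : FreeEdge Λ i j) :
    (∃ s, Λ.left e.1 = .inl s) ∨ ∃ m l, Λ.left e.1 = .inr (remaining hij m, l) := by
  rcases h : Λ.left e.1 with s | ⟨b, l⟩
  · exact Or.inl ⟨s, rfl⟩
  · right
    have h1 := Λ.eq_bdryEdge h
    obtain ⟨m, rfl⟩ := (remaining_range hij b).2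
      ⟨fun hb => e.2.1 l (hb ▸ h1), fun hb => e.2.2 l (hb ▸ h1)⟩
    exact ⟨m, l, rfl⟩

/-- Triangles are not identified by gluing, and an edge is determined by the side of a triangle on
its right. -/
theorem mapEdge_injective {e f : Λ.E} (he : ∀ k, e ≠ Λ.bdryEdge i k)
    (hf : ∀ k, f ≠ Λ.bdryEdge i k) (h : G.mapEdge e he = G.mapEdge f hf) : e = f := by
  have h1 := G.right_mapEdge e he
  rw [h, G.right_mapEdge f hf] at h1
  have h2 : Λ.right f = Λ.right e :=
    Prod.ext (G.triEquiv.injective (congrArg Prod.fst h1)) (Prod.ext_iff.1 h1).2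
  have h3 := Λ.right_spec e
  rw [← h2, Λ.right_spec] at h3
  exact (Subtype.ext (Prod.swap_injective h3)).symm

/-- The edges of the surface that is cut open. -/
def sourceEdge : (Fin 3 × Fin 2) ⊕ FreeEdge Λ i j → Λ.E
  | .inl (k, 0) => Λ.bdryEdge i k
  | .inl (k, 1) => Λ.bdryEdge j k.rev
  | .inr e => e.1

include hij in
theorem sourceEdge_bijective : Function.Bijective (sourceEdge (Λ := Λ) (i := i) (j := j)) := by
  constructor
  · rintro (⟨k, a⟩ | e) (⟨l, b⟩ | f) h
    · fin_cases a <;> fin_cases b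
      · rw [(Λ.bdryEdge_injective h).2]
      · exact absurd (Λ.bdryEdge_injective h).1 hij
      · exact absurd (Λ.bdryEdge_injective h).1.symm hij
      · rw [Fin.rev_injective (Λ.bdryEdge_injective h).2]
    · fin_cases a
      · exact absurd h.symm (f.2.1 k)
      · exact absurd h.symm (f.2.2 k.rev)
    · fin_cases b
      · exact absurd h (e.2.1 l)
      · exact absurd h (e.2.2 l.rev)
    · exact congrArg Sum.inr (Subtype.ext h)
  · intro e
    by_cases h1 : ∃ k, e = Λ.bdryEdge i k
    · obtain ⟨k, rfl⟩ := h1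
      exact ⟨.inl (k, 0), rfl⟩
    by_cases h2 : ∃ k, e = Λ.bdryEdge j k
    · obtain ⟨k, rfl⟩ := h2
      exact ⟨.inl (k.rev, 1), by simp [sourceEdge]⟩
    push Not at h1 h2
    exact ⟨.inr ⟨e, h1, h2⟩, rfl⟩

/-- The edges of the glued surface. -/
def targetEdge : Fin 3 ⊕ FreeEdge Λ i j → Λ'.E
  | .inl k => G.gluedEdge k.rev
  | .inr e => G.mapEdge e.1 e.2.1

theorem targetEdge_bijective : Function.Bijective G.targetEdge := by
  have hj := bdryEdge_j_ne (Λ := Λ) (hij := hij)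
  constructor
  · rintro (k | e) (l | f) h
    · have h1 : Λ.bdryEdge j k.rev = Λ.bdryEdge j l.rev :=
        G.mapEdge_injective (hj _) (hj _) h
      rw [Fin.rev_injective (Λ.bdryEdge_injective h1).2]
    · exact absurd (G.mapEdge_injective (hj _) f.2.1 h).symm (f.2.2 _)
    · exact absurd (G.mapEdge_injective e.2.1 (hj _) h) (e.2.2 _)
    · exact congrArg Sum.inr (Subtype.ext (G.mapEdge_injective e.2.1 f.2.1 h))
  · rintro ⟨e', he'⟩
    have h0 := he'
    rw [G.edges_eq] at h0
    obtain ⟨e, ⟨he, hi⟩, rfl⟩ := h0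
    have hi' : ∀ k, (⟨e, he⟩ : Λ.E) ≠ Λ.bdryEdge i k := fun k h => hi k (congrArg Subtype.val h)
    by_cases h2 : ∃ k, (⟨e, he⟩ : Λ.E) = Λ.bdryEdge j k
    · obtain ⟨k, hk⟩ := h2
      refine ⟨.inl k.rev, Subtype.ext ?_⟩
      change Prod.map G.vert G.vert (Λ.bdryEdge j k.rev.rev).1 = _
      rw [Fin.rev_rev, ← hk]
    · push Not at h2
      exact ⟨.inr ⟨⟨e, he⟩, hi', h2⟩, rfl⟩

end Gluing

/-! ## Gluing of state sums -/

section StateSum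

variable {C : Type u₁} [Category.{v₁} C] [MonoidalCategory C] [SymmetricCategory C]
  (A : C) [MonObj A] [ComonObj A]

theorem Ttriang_eq_diagram {B : ℕ} (Λ : SpinTriangulatedSurface.{u} B) :
    Ttriang A Λ = diagram (frobTriple A) (Fintype.equivFin Λ.E) (Fintype.equivFin Λ.T)
      (fun e => frobCopairing A (Λ.edgeSign e))
      (Λ.endsEquiv.trans (Equiv.sumCongr (Equiv.refl _) (prodIndex B 3))) := by
  unfold Ttriang diagram
  have h : connectivity Λ = diagEquiv (Fintype.equivFin Λ.E) (Fintype.equivFin Λ.T)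
      (Λ.endsEquiv.trans (Equiv.sumCongr (Equiv.refl _) (prodIndex B 3))) := by
    ext x : 1
    obtain ⟨e, a, rfl⟩ := diagEquiv_surj (Fintype.equivFin Λ.E) x
    rw [diagEquiv_apply]
    simp only [connectivity, Equiv.trans_apply, Equiv.symm_apply_apply, Equiv.sumEmpty_apply_inl,
      Equiv.prodCongr_apply, Prod.map_apply, Equiv.refl_apply]
    rcases Λ.endsEquiv (e, a) with ⟨x, b⟩ | x <;> rfl
  rw [h]
  rfl

/-- The legs of the surface that is cut open. -/
def legsEquiv {n : ℕ} {i j : Fin (n + 2)} (hij : i ≠ j) :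
    Fin (3 * n + 2 * 3) ≃ Fin (3 * (n + 2)) :=
  (blockIndex (3 * n) 3 2).symm.trans <|
    (Equiv.sumCongr (Equiv.refl _) (prodIndex n 3).symm).trans <|
    (Equiv.ofBijective _ (gluingSlot_bijective hij)).trans (prodIndex (n + 2) 3)

theorem legsEquiv_symm_inl {n : ℕ} {i j : Fin (n + 2)} (hij : i ≠ j) (x : Fin 3 × Fin 2) :
    (legsEquiv hij).symm (prodIndex (n + 2) 3 (gluingSlot hij (.inl x))) =
      blockIndex (3 * n) 3 2 (.inl x) := by
  rw [Equiv.symm_apply_eq]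
  simp [legsEquiv]

theorem legsEquiv_symm_inr {n : ℕ} {i j : Fin (n + 2)} (hij : i ≠ j) (x : Fin n × Fin 3) :
    (legsEquiv hij).symm (prodIndex (n + 2) 3 (gluingSlot hij (.inr x))) =
      blockIndex (3 * n) 3 2 (.inr (prodIndex n 3 x)) := by
  rw [Equiv.symm_apply_eq]
  simp [legsEquiv]

variable {A}

/-- Across the pairing, the gluing morphism becomes the operation that reorders the legs and
evaluates three pairs of them by `gluingPairing`. Applied to the network of `Λ`, which is that of
`Λ'` cut at the glued edges, it rejoins these edges with the sign prescribed by `hg`. -/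
theorem TA_glue (hF : IsFrobenius A) (hN : nakayama A ≫ nakayama A = 𝟙 A) {n : ℕ}
    {Λ : SpinTriangulatedSurface.{u} (n + 2)} {i j : Fin (n + 2)} {hij : i ≠ j} {ε : ℤˣ}
    {Λ' : SpinTriangulatedSurface.{u} n} (G : Gluing Λ hij ε Λ')
    (hg : ∀ k, Λ'.edgeSign (G.gluedEdge k) =
      ε * Λ.edgeSign (Λ.bdryEdge i k.rev) * Λ.edgeSign (Λ.bdryEdge j k))
    (hf : ∀ e : Gluing.FreeEdge Λ i j, Λ'.edgeSign (G.mapEdge e.1 e.2.1) = Λ.edgeSign e.1) :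
    TA A Λ' = gluingMorphism A hij ε ≫ TA A Λ := by
  set t := frobTriple A
  set κ := gluingPairing A ε
  let f := Equiv.ofBijective _ (Gluing.sourceEdge_bijective (Λ := Λ) (hij := hij))
  let f' := Equiv.ofBijective _ G.targetEdge_bijective
  let c : (Fin 3 × Fin 2) ⊕ Gluing.FreeEdge Λ i j → (𝟙_ C ⟶ A ⊗ A) :=
    fun e => frobCopairing A (Λ.edgeSign (f e))
  let c' : Fin 3 ⊕ Gluing.FreeEdge Λ i j → (𝟙_ C ⟶ A ⊗ A) :=
    fun e => frobCopairing A (Λ'.edgeSign (f' e))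
  let σ : Λ.E × Fin 2 ≃ (Λ.T × Fin 3) ⊕ Fin (3 * (n + 2)) :=
    Λ.endsEquiv.trans (Equiv.sumCongr (Equiv.refl _) (prodIndex (n + 2) 3))
  let σ' : Λ'.E × Fin 2 ≃ (Λ'.T × Fin 3) ⊕ Fin (3 * n) :=
    Λ'.endsEquiv.trans (Equiv.sumCongr (Equiv.refl _) (prodIndex n 3))
  let σ'' : (Fin 3 ⊕ Gluing.FreeEdge Λ i j) × Fin 2 ≃ (Λ'.T × Fin 3) ⊕ Fin (3 * n) :=
    (Equiv.prodCongr f' (Equiv.refl _)).trans σ'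
  have hsum : ∀ s : (Λ'.T × Fin 3) ⊕ Fin (3 * n), Sum.map (Prod.map (Equiv.refl _) id) id s = s := by
    rintro (x | x) <;> rfl
  have h1 : Ttriang A Λ' = diagram t (f'.trans (Fintype.equivFin Λ'.E)) (Fintype.equivFin Λ'.T)
      c' σ'' := by
    rw [Ttriang_eq_diagram]
    exact (diagram_reindex t (f'.trans (Fintype.equivFin Λ'.E)) (Fintype.equivFin Λ'.T) _ _ c' _
      σ'' σ' f' (Equiv.refl _) (fun _ => rfl) (fun e a => (hsum _).symm)).symm
  have h2 := diagram_join t κ 3 c c' (f.trans (Fintype.equivFin Λ.E))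
    (f'.trans (Fintype.equivFin Λ'.E)) (Fintype.equivFin Λ'.T) σ''
    (by
      intro k
      have h := joinsTo_frobCopairing hF hN ε (Λ.edgeSign (Λ.bdryEdge i k))
        (Λ.edgeSign (Λ.bdryEdge j k.rev))
      have h3 := hg k.rev
      rw [Fin.rev_rev] at h3
      rw [← h3] at h
      exact h)
    (fun r => congrArg (frobCopairing A) (hf r).symm)
  -- The graph of `Λ'` with its glued edges cut is the graph of `Λ`, up to the order of the legs.
  have h3 : diagram t (f.trans (Fintype.equivFin Λ.E)) (Fintype.equivFin Λ'.T) c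
      (splitEdges σ'') = Ttriang A Λ ≫ perm A _ _ (legsEquiv hij).symm := by
    rw [Ttriang_eq_diagram]
    refine Eq.trans ?_ (diagram_perm t _ _ _ σ (legsEquiv hij).symm).symm
    refine diagram_reindex t _ _ _ _ c _ (splitEdges σ'') _ f G.triEquiv.symm (fun _ => rfl) ?_
    have hright : ∀ e (he : ∀ k, e ≠ Λ.bdryEdge i k), Sum.map (Prod.map G.triEquiv.symm id) id
        (σ' (G.mapEdge e he, 1)) = .inl (Λ.right e) := by
      intro e he
      have : σ' (G.mapEdge e he, 1) = .inl (Λ'.right (G.mapEdge e he)) := rfl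
      rw [this, G.right_mapEdge]
      simp
    have hmap : ∀ (s : (Λ'.T × Fin 3) ⊕ Fin (3 * n)) (x : Λ.T × Fin 3),
        Sum.map (Prod.map G.triEquiv.symm id) id s = .inl x →
        Sum.map (Prod.map G.triEquiv.symm id) id (addLegs Λ'.T (3 * n) 3 s) = .inl x := by
      rintro (s | s) x h
      · exact congrArg Sum.inl (Sum.inl_injective h)
      · simp at h
    rintro (⟨k, b⟩ | r) a
    · have ha : a = 0 ∨ a = 1 := by omega
      have hb : b = 0 ∨ b = 1 := by omega
      rcases ha with rfl | rfl
      · rw [splitEdges_inl_zero]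
        have e1 : Λ.endsEquiv (f (.inl (k, b)), 0) = .inr (gluingSlot hij (.inl (k, b))) := by
          rcases hb with rfl | rfl
          · exact Λ.left_bdryEdge i k
          · exact Λ.left_bdryEdge j k.rev
        rw [Equiv.trans_apply, Equiv.trans_apply, e1]
        exact congrArg Sum.inr (legsEquiv_symm_inl hij (k, b))
      · rw [splitEdges_inl_one]
        refine Eq.trans ?_ (hmap _ (Λ.right (f (.inl (k, b)))) ?_).symm
        · rfl
        · rcases hb with rfl | rfl
          -- The slot to the left of a glued edge belongs to a triangle, so the default value for
          -- boundary slots is never taken.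
          · have e1 : σ'' (.inl k, 0) = .inl (Λ'.left (G.gluedEdge k.rev) |>.elim id 
              fun _ => Λ'.right (G.gluedEdge k.rev)) := by
              have : σ'' (.inl k, 0) = Sum.map id (prodIndex n 3) (Λ'.left (G.gluedEdge k.rev)) := rfl
              rw [this, G.left_gluedEdge]
              rfl
            rw [e1, G.left_gluedEdge, Fin.rev_rev]
            simp
            rfl
          · exact hright _ (Gluing.bdryEdge_j_ne (hij := hij) _)
    · rw [splitEdges_inr]
      have ha : a = 0 ∨ a = 1 := by omega
      rcases ha with rfl | rfl
      · have e1 : σ'' (.inr r, 0) = Sum.map id (prodIndex n 3) (Λ'.left (G.mapEdge r.1 r.2.1)) := rfl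
        have e2 : (σ.trans (Equiv.sumCongr (Equiv.refl _) (legsEquiv hij).symm)) (f (.inr r), 0) =
          Sum.map id (fun x => (legsEquiv hij).symm (prodIndex (n + 2) 3 x)) (Λ.left r.1) := by
          rw [Equiv.trans_apply, Equiv.trans_apply]
          change Sum.map _ _ (Sum.map _ _ (Λ.left r.1)) = _
          rw [Sum.map_map]
          rfl
        rw [e1, e2]
        rcases Gluing.left_freeEdge (hij := hij) r with ⟨s, hs⟩ | ⟨m, l, hs⟩
        · rw [G.left_mapEdge_inl _ _ hs, hs]
          simp [addLegs]
        · rw [G.left_mapEdge_inr _ _ hs, hs]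
          exact congrArg Sum.inr (legsEquiv_symm_inr hij (m, l))
      · refine Eq.trans ?_ (hmap _ (Λ.right (f (.inr r))) (hright _ r.2.1)).symm
        rfl
  have h4 : IsAdjointTo (frobPairing A) (gluingMorphism A hij ε)
      (perm A _ _ (legsEquiv hij).symm ≫ doubles κ 3) := by
    have h := IsAdjointTo.copairs (b := frobPairing A) (frobCopairing A ε) (n := 3 * n) 3
    rw [insPairing_frobCopairing hF] at h
    exact h.comp (IsAdjointTo.perm (legsEquiv hij))
  have h5 := h4.comp_pairing (Ttriang A Λ)
  unfold TA
  rw [h5, h1, ← h2, h3]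
  exact congrArg (fun f => (ρ_ (tpow A (3 * n))).inv ≫ (tpow A (3 * n) ◁ f) ≫
    pairing A (frobPairing A) (3 * n)) (Category.assoc _ _ _)

end StateSum

/-! ## The double cover of `GL(2, ℝ)⁺` -/

namespace GLTilde

/-- An element `(g, ε)` is determined by `g` and `ε(i)`. -/
theorem ext_eps_I {g h : GLTilde} (hm : g.m = h.m)
    (he : g.eps UpperHalfPlane.I = h.eps UpperHalfPlane.I) : g = h := by
  have hmat : g.mat = h.mat := Subtype.ext (Units.ext hm)
  have hc : ∀ g : GLTilde, ContinuousOn g.eps Set.univ := fun g =>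
    g.holo.continuous.continuousOn
  -- Both functions are continuous square roots of the same nowhere vanishing function on the
  -- connected upper half plane, so agreement at `i` suffices.
  have h1 : Set.EqOn g.eps h.eps Set.univ := by
    refine isPreconnected_univ.eq_of_sq_eq (hc g) (hc h) (fun z _ => ?_)
      (fun {z} _ => h.eps_ne_zero z) (Set.mem_univ UpperHalfPlane.I) he
    simp only [Pi.pow_apply]
    rw [g.sq, h.sq, hmat]
  exact GLTilde.ext hmat (funext fun z => h1 (Set.mem_univ z))

theorem m_mul (g h : GLTilde) : (g * h).m = g.m * h.m := rfl

theorem m_one : (1 : GLTilde).m = 1 := rfl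

theorem m_delta {z : ℂ} (hz : z ≠ 0) : (delta z).m = rotMat (z ^ 2) := delta_mat hz

theorem rotMat_mul (z w : ℂ) : rotMat (z * w) = rotMat z * rotMat w := by
  ext a b
  fin_cases a <;> fin_cases b <;> simp [rotMat, Matrix.mul_apply, Fin.sum_univ_two] <;> ring

/-- As scaled rotations fix `i`, right multiplication by `δ(z)` multiplies `ε(i)` by `z`. With
`ext_eps_I` this reduces identities for `δ` to arithmetic. -/
theorem smul_I_delta {z : ℂ} (hz : z ≠ 0) :
    ((delta z).mat : GL (Fin 2) ℝ) • UpperHalfPlane.I = UpperHalfPlane.I := by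
  apply UpperHalfPlane.ext
  rw [UpperHalfPlane.coe_smul_of_det_pos (det_pos (delta z).mat)]
  have hm := delta_mat hz
  have hd := (delta z).sq UpperHalfPlane.I
  rw [delta_eps_I hz] at hd
  rw [← hd, div_eq_iff (pow_ne_zero 2 hz)]
  have e : ∀ a b, ((delta z).mat : GL (Fin 2) ℝ) a b = rotMat (z ^ 2) a b := fun a b => by
    rw [← hm]
  rw [UpperHalfPlane.num, e, e]
  apply Complex.ext <;> simp [rotMat]

theorem eps_mul_delta (g : GLTilde) {z : ℂ} (hz : z ≠ 0) :
    (g * delta z).eps UpperHalfPlane.I = g.eps UpperHalfPlane.I * z := by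
  rw [mul_eps, smul_I_delta hz, delta_eps_I hz]

theorem delta_mul {z w : ℂ} (hz : z ≠ 0) (hw : w ≠ 0) :
    delta (z * w) = delta z * delta w := by
  apply ext_eps_I
  · rw [m_mul, m_delta hz, m_delta hw, m_delta (mul_ne_zero hz hw), mul_pow, rotMat_mul]
  · rw [eps_mul_delta _ hw, delta_eps_I hz, delta_eps_I (mul_ne_zero hz hw)]

theorem delta_one : delta 1 = 1 := by
  apply ext_eps_I
  · rw [m_delta one_ne_zero, m_one]
    ext a b
    fin_cases a <;> fin_cases b <;> simp [rotMat]
  · rw [delta_eps_I one_ne_zero, one_eps]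

theorem delta_inv {z : ℂ} (hz : z ≠ 0) : delta z⁻¹ = (delta z)⁻¹ := by
  rw [eq_inv_iff_mul_eq_one, ← delta_mul (inv_ne_zero hz) hz, inv_mul_cancel₀ hz, delta_one]

theorem delta_injective {z w : ℂ} (hz : z ≠ 0) (hw : w ≠ 0) (h : delta z = delta w) : z = w := by
  rw [← delta_eps_I hz, h, delta_eps_I hw]

theorem delta_comm {z w : ℂ} (hz : z ≠ 0) (hw : w ≠ 0) :
    delta z * delta w = delta w * delta z := by
  rw [← delta_mul hz hw, ← delta_mul hw hz, mul_comm]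

/-- `δ(z)` is central if `z² = ±1`. -/
theorem delta_central {z : ℂ} (hz : z ^ 2 = 1 ∨ z ^ 2 = -1) (g : GLTilde) :
    delta z * g = g * delta z := by
  have hz0 : z ≠ 0 := by
    rintro rfl
    rcases hz with h | h <;> norm_num at h
  apply ext_eps_I
  · rw [m_mul, m_mul, m_delta hz0]
    rcases hz with h | h <;> rw [h] <;> ext a b <;> fin_cases a <;> fin_cases b <;>
      simp [rotMat, Matrix.mul_apply, Fin.sum_univ_two]
  · rw [eps_mul_delta _ hz0, mul_eps, mul_comm]
    congr 1
    -- The quotient under the root is `1`, so the function of `δ(z)` is the constant `z` and its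
    -- value at `g • i` is the one at `i`.
    rcases hz with h | h <;> simp [delta, hz0, h]

theorem m_upper (a b c : ℝ) (ha : 0 < a) (hc : 0 < c) :
    (upper a b c ha hc).m = !![a, b; 0, c] := rfl

theorem upper_mul {a b c a' b' c' : ℝ} (ha : 0 < a) (hc : 0 < c) (ha' : 0 < a') (hc' : 0 < c') :
    upper a b c ha hc * upper a' b' c' ha' hc' =
      upper (a * a') (a * b' + b * c') (c * c') (mul_pos ha ha') (mul_pos hc hc') := by
  apply ext_eps_I
  · rw [m_mul, m_upper, m_upper, m_upper]
    simp
  · rw [mul_eps]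
    simp [upper, Real.sqrt_mul hc.le]

theorem upper_inv {a b c : ℝ} (ha : 0 < a) (hc : 0 < c) :
    (upper a b c ha hc)⁻¹ = upper a⁻¹ (-(b / (a * c))) c⁻¹ (inv_pos.2 ha) (inv_pos.2 hc) := by
  rw [inv_eq_iff_mul_eq_one, upper_mul]
  apply ext_eps_I
  · rw [m_upper, m_one]
    ext x y
    fin_cases x <;> fin_cases y <;> simp <;> field_simp
    ring
  · rw [one_eps]
    simp [upper, hc.ne']

/-- Uniqueness of the QR decomposition: rotations preserve lengths and inner products, so the
formulas of `Rt` return `a`, `b`, `c`, and the positive root `√c` fixes the lift. -/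
theorem Qt_delta_mul_upper {z : ℂ} (hz : ‖z‖ = 1) {a b c : ℝ} (ha : 0 < a) (hc : 0 < c) :
    Qt (delta z * upper a b c ha hc) = delta z := by
  have hz0 : z ≠ 0 := by
    rintro rfl
    simp at hz
  have hm : (delta z * upper a b c ha hc).m = rotMat (z ^ 2) * !![a, b; 0, c] := by
    rw [m_mul, m_delta hz0, m_upper]
  have hw : (z ^ 2).re ^ 2 + (z ^ 2).im ^ 2 = 1 := by
    have h := Complex.normSq_eq_norm_sq (z ^ 2)
    rw [norm_pow, hz, Complex.normSq_apply] at h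
    nlinarith [h]
  generalize z ^ 2 = w at hm hw
  have h00 : (delta z * upper a b c ha hc).m 0 0 = w.re * a := by rw [hm]; simp [rotMat]
  have h10 : (delta z * upper a b c ha hc).m 1 0 = w.im * a := by rw [hm]; simp [rotMat]
  have h01 : (delta z * upper a b c ha hc).m 0 1 = w.re * b - w.im * c := by
    rw [hm]; simp [rotMat]; ring
  have h11 : (delta z * upper a b c ha hc).m 1 1 = w.im * b + w.re * c := by
    rw [hm]; simp [rotMat]
  have hs : Real.sqrt ((w.re * a) ^ 2 + (w.im * a) ^ 2) = a := by
    have : (w.re * a) ^ 2 + (w.im * a) ^ 2 = a ^ 2 := by linear_combination a ^ 2 * hw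
    rw [this, Real.sqrt_sq ha.le]
  have hR : Rt (delta z * upper a b c ha hc) = upper a b c ha hc := by
    have key : ∀ (a' b' c' : ℝ) (ha' : 0 < a') (hc' : 0 < c'), a' = a → b' = b → c' = c →
        upper a' b' c' ha' hc' = upper a b c ha hc := by
      rintro _ _ _ _ _ rfl rfl rfl
      rfl
    refine key _ _ _ _ _ ?_ ?_ ?_
    · rw [h00, h10, hs]
    · rw [h00, h10, h01, h11, hs, div_eq_iff ha.ne']
      linear_combination a * b * hw
    · rw [Matrix.det_fin_two, h00, h10, h01, h11, hs, div_eq_iff ha.ne']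
      linear_combination a * c * hw
  rw [Qt, hR, mul_inv_cancel_right]

/-- An element whose linear map fixes the direction of `1` is triangular up to sign. -/
theorem exists_eq_upper (g : GLTilde) (h0 : 0 < g.m 0 0) (h1 : g.m 1 0 = 0) :
    ∃ (s : ℂ) (a b c : ℝ) (ha : 0 < a) (hc : 0 < c), (s = 1 ∨ s = -1) ∧
      g = delta s * upper a b c ha hc := by
  have hd := g.m_det_pos
  rw [Matrix.det_fin_two, h1, mul_zero, sub_zero] at hd
  have hc : 0 < g.m 1 1 := (mul_pos_iff_of_pos_left h0).1 hd
  have hsq := g.sq UpperHalfPlane.I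
  have hden : UpperHalfPlane.denom (g.mat : GL (Fin 2) ℝ) UpperHalfPlane.I = (g.m 1 1 : ℂ) := by
    have : UpperHalfPlane.denom (g.mat : GL (Fin 2) ℝ) UpperHalfPlane.I =
      (g.m 1 0 : ℂ) * UpperHalfPlane.I + (g.m 1 1 : ℂ) := rfl
    rw [this, h1]
    simp
  rw [hden] at hsq
  have hsqrt : ((Real.sqrt (g.m 1 1) : ℝ) : ℂ) ^ 2 = (g.m 1 1 : ℂ) := by
    rw [← Complex.ofReal_pow, Real.sq_sqrt hc.le]
  rw [← hsqrt, sq_eq_sq_iff_eq_or_eq_neg] at hsq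
  have hs0 : ∀ s : ℂ, (s = 1 ∨ s = -1) → s ≠ 0 ∧ s ^ 2 = 1 := by
    rintro s (rfl | rfl) <;> norm_num
  have key : ∀ s : ℂ, (s = 1 ∨ s = -1) → g.eps UpperHalfPlane.I = (Real.sqrt (g.m 1 1) : ℂ) * s →
      g = delta s * upper (g.m 0 0) (g.m 0 1) (g.m 1 1) h0 hc := by
    intro s hs he
    obtain ⟨hs1, hs2⟩ := hs0 s hs
    apply ext_eps_I
    · rw [m_mul, m_delta hs1, hs2, m_upper]
      ext x y
      fin_cases x <;> fin_cases y <;> simp [rotMat, h1]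
    · rw [delta_central (Or.inl hs2), eps_mul_delta _ hs1, he]
      rfl
  rcases hsq with h | h
  · exact ⟨1, _, _, _, h0, hc, Or.inl rfl, key 1 (Or.inl rfl) (by rw [h, mul_one])⟩
  · exact ⟨-1, _, _, _, h0, hc, Or.inr rfl, key (-1) (Or.inr rfl) (by rw [h, mul_neg_one])⟩

theorem toCLM_apply (g : GLTilde) (w : ℂ) :
    g.toCLM w = ⟨g.m 0 0 * w.re + g.m 0 1 * w.im, g.m 1 0 * w.re + g.m 1 1 * w.im⟩ := by
  have h : g.toCLM w = Matrix.toLin Complex.basisOneI Complex.basisOneI g.m w := rfl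
  rw [h, Matrix.toLin_apply]
  apply Complex.ext <;>
    simp [Matrix.mulVec, dotProduct, Fin.sum_univ_two]

theorem toCLM_mul (g h : GLTilde) (w : ℂ) : (g * h).toCLM w = g.toCLM (h.toCLM w) := by
  simp only [toCLM_apply, m_mul, Matrix.mul_apply, Fin.sum_univ_two]
  apply Complex.ext <;> simp <;> ring

theorem toCLM_delta {z : ℂ} (hz : z ≠ 0) (w : ℂ) : (delta z).toCLM w = z ^ 2 * w := by
  rw [toCLM_apply, m_delta hz]
  apply Complex.ext
  · simp [rotMat]
    ring
  · simp [rotMat]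
    ring

theorem deltaExp_add (x y : ℝ) : deltaExp (x + y) = deltaExp x * deltaExp y := by
  unfold deltaExp
  rw [← delta_mul (Complex.exp_ne_zero _) (Complex.exp_ne_zero _), ← Complex.exp_add]
  congr 2
  push_cast
  ring

theorem deltaExp_neg (x : ℝ) : deltaExp (-x) = (deltaExp x)⁻¹ := by
  rw [eq_inv_iff_mul_eq_one, ← deltaExp_add, neg_add_cancel]
  simp [deltaExp, delta_one]

/-- The rotated triangular group: if `g` rotates the direction `α` by the angle of `u²`, then
`g = δ(±u) α̃ T α̃⁻¹` with `T` triangular. -/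
theorem exists_factorisation (g : GLTilde) {α u : ℂ} (hα : ‖α‖ = 1) (hu : ‖u‖ = 1) {r : ℝ}
    (hr : 0 < r) (h : g.toCLM (α ^ 2) = r * u ^ 2 * α ^ 2) :
    ∃ (s : ℂ) (a b c : ℝ) (ha : 0 < a) (hc : 0 < c), (s = 1 ∨ s = -1) ∧
      g = delta (s * u) * (delta α * upper a b c ha hc * (delta α)⁻¹) := by
  have hα0 : α ≠ 0 := by
    rintro rfl
    simp at hα
  have hu0 : u ≠ 0 := by
    rintro rfl
    simp at hu
  -- Conjugation turns the direction `α²` into `1`, and `δ(u)⁻¹` undoes the rotation; the result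
  -- maps `1` to the positive number `r`.
  set k := (delta u)⁻¹ * ((delta α)⁻¹ * g * delta α) with hk
  have h1 : k.toCLM 1 = r := by
    rw [hk, toCLM_mul, toCLM_mul, toCLM_mul, toCLM_delta hα0, mul_one, h, ← delta_inv hα0,
      ← delta_inv hu0, toCLM_delta (inv_ne_zero hα0), toCLM_delta (inv_ne_zero hu0)]
    field_simp
  rw [toCLM_apply] at h1
  have h2 := congrArg Complex.re h1
  have h3 := congrArg Complex.im h1
  simp only [Complex.one_re, Complex.one_im, mul_one, mul_zero, add_zero, Complex.ofReal_re,
    Complex.ofReal_im] at h2 h3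
  obtain ⟨s, a, b, c, ha, hc, hs, he⟩ := k.exists_eq_upper (h2 ▸ hr) h3
  refine ⟨s, a, b, c, ha, hc, hs, ?_⟩
  have hs0 : s ≠ 0 := by rcases hs with rfl | rfl <;> norm_num
  have hg : g = delta α * (delta u * k) * (delta α)⁻¹ := by
    rw [hk]
    group
  rw [hg, he, delta_mul hs0 hu0, ← mul_assoc (delta u), delta_comm hu0 hs0,
    ← delta_mul hs0 hu0, ← mul_assoc (delta α), delta_comm hα0 (mul_ne_zero hs0 hu0)]
  simp only [mul_assoc]

/-- The direction `α̃` of the `k`-th edge of the standard triangle. -/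
def edgeDir (k : Fin 3) : ℂ :=
  Complex.exp ((Real.pi * ((k : ℕ) / 3 + 5 / 12) : ℝ) * Complex.I)

theorem norm_edgeDir (k : Fin 3) : ‖edgeDir k‖ = 1 := Complex.norm_exp_ofReal_mul_I _

theorem edgeDir_ne_zero (k : Fin 3) : edgeDir k ≠ 0 := Complex.exp_ne_zero _

theorem Qtα_eq (k : Fin 3) (g : GLTilde) : Qtα k g =
    delta (edgeDir k) * Qt ((delta (edgeDir k))⁻¹ * g * delta (edgeDir k)) *
      (delta (edgeDir k))⁻¹ := rfl

/-- Rotations commute, so conjugation by `α̃` leaves `δ(u)` unchanged and removes the rotation of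
the triangular part. -/
theorem Qtα_factorisation (k : Fin 3) {u : ℂ} (hu : ‖u‖ = 1) {a b c : ℝ} (ha : 0 < a)
    (hc : 0 < c) : Qtα k (delta u * (delta (edgeDir k) * upper a b c ha hc *
      (delta (edgeDir k))⁻¹)) = delta u := by
  have hu0 : u ≠ 0 := by
    rintro rfl
    simp at hu
  have e : (delta (edgeDir k))⁻¹ * (delta u * (delta (edgeDir k) * upper a b c ha hc *
      (delta (edgeDir k))⁻¹)) * delta (edgeDir k) = delta u * upper a b c ha hc := by
    rw [← mul_assoc (delta u), ← mul_assoc (delta u), delta_comm hu0 (edgeDir_ne_zero k)]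
    group
  rw [Qtα_eq, e, Qt_delta_mul_upper hu, delta_comm (edgeDir_ne_zero k) hu0, mul_inv_cancel_right]

end GLTilde

/-! ## Spin bundles -/

namespace SpinStructure

variable {M : Type u} [TopologicalSpace M] [ChartedSpace (EuclideanHalfSpace 2) M]
  [IsManifold (𝓡∂ 2) ∞ M] (S : SpinStructure M)

theorem act_injective (p : S.P) : Function.Injective (S.act p) := by
  intro g h e
  obtain ⟨U, Φ, -, hx, hΦ⟩ := S.locallyTrivial (S.proj p)
  obtain ⟨⟨y, g₀⟩, hy⟩ := Φ.surjective ⟨p, hx⟩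
  have h1 : ∀ g, (Φ (y, g₀ * g) : S.P) = S.act p g := fun g => by
    rw [(hΦ y g₀).2 g, hy]
  have h2 : Φ (y, g₀ * g) = Φ (y, g₀ * h) := Subtype.ext (by rw [h1, h1, e])
  exact mul_left_cancel (congrArg Prod.snd (Φ.injective h2))

theorem exists_eq_act {p q : S.P} (e : S.proj p = S.proj q) : ∃ g, p = S.act q g := by
  obtain ⟨U, Φ, -, hx, hΦ⟩ := S.locallyTrivial (S.proj q)
  obtain ⟨⟨y, g₀⟩, hy⟩ := Φ.surjective ⟨q, hx⟩
  have hx' : S.proj p ∈ U := by rw [e]; exact hx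
  obtain ⟨⟨y', g₁⟩, hy'⟩ := Φ.surjective ⟨p, hx'⟩
  have h1 : (y : M) = S.proj q := by rw [← (hΦ y g₀).1, hy]
  have h2 : (y' : M) = S.proj p := by rw [← (hΦ y' g₁).1, hy']
  have h3 : y' = y := Subtype.ext (by rw [h1, h2, e])
  refine ⟨g₀⁻¹ * g₁, ?_⟩
  have h4 := (hΦ y g₀).2 (g₀⁻¹ * g₁)
  rw [mul_inv_cancel_left, hy, ← h3, hy'] at h4
  exact h4

/-- `frame x w` as an element of the model space. -/
def vec (x : S.P) (w : ℂ) : EuclideanSpace ℝ (Fin 2) := S.frame x w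

/-- The base points of the two frames are equal only propositionally; as tangent spaces are copies
of the model space, the vectors can still be compared directly. -/
theorem vec_act (x : S.P) (g : GLTilde) (w : ℂ) : S.vec (S.act x g) w = S.vec x (g.toCLM w) :=
  congrArg (fun v : TangentBundle (𝓡∂ 2) M => (v.2 : EuclideanSpace ℝ (Fin 2))) (S.frame_act x g w)

theorem vec_injective (x : S.P) : Function.Injective (S.vec x) := (S.frame_bijective x).1

variable {S}

/-- The derivative of a curve in the image of a spin map. -/
theorem IsSpinMap.hasMFDerivWithinAt_comp {t : SpinType} {U : Set ℂ} {f : ℂ → S.P}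
    (hf : S.IsSpinMap t U f) {γ : ℝ → ℂ} {s : Set ℝ} {x : ℝ} {v w : ℂ} (hx : x ∈ s)
    (hγ : Set.MapsTo γ s U) (hd : HasDerivWithinAt γ v s x) (hv : v = t.frame (γ x) w) :
    ∃ L : ℝ →L[ℝ] EuclideanSpace ℝ (Fin 2), L 1 = S.vec (f (γ x)) w ∧
      HasMFDerivWithinAt 𝓘(ℝ, ℝ) (𝓡∂ 2) (S.proj ∘ f ∘ γ) s x L := by
  have h1 : MDifferentiableWithinAt 𝓘(ℝ, ℂ) (𝓡∂ 2) (S.proj ∘ f) U (γ x) :=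
    (hf.2.1 _ (hγ hx)).mdifferentiableWithinAt (by simp)
  have h2 := h1.hasMFDerivWithinAt
  have h3 : HasMFDerivWithinAt 𝓘(ℝ, ℝ) 𝓘(ℝ, ℂ) γ s x
      (ContinuousLinearMap.toSpanSingleton ℝ v) := hd.hasFDerivWithinAt.hasMFDerivWithinAt
  have h4 := HasMFDerivWithinAt.comp x h2 h3 hγ
  refine ⟨_, ?_, h4⟩
  have h5 := hf.2.2 _ (hγ hx) w
  refine Eq.trans ?_ h5.symm
  rw [← hv]
  exact congrArg (mfderivWithin 𝓘(ℝ, ℂ) (𝓡∂ 2) (S.proj ∘ f) U (γ x))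
    ((ContinuousLinearMap.toSpanSingleton_apply ℝ v 1).trans (one_smul ℝ v))

/-- Two spin maps which agree along curves are related by an element of `GL̃⁺₂` that maps the
directions of the curves to each other. -/
theorem IsSpinMap.toCLM_eq {t t' : SpinType} {U U' : Set ℂ} {f f' : ℂ → S.P}
    (hf : S.IsSpinMap t U f) (hf' : S.IsSpinMap t' U' f') {γ γ' : ℝ → ℂ} {s : Set ℝ} {x : ℝ}
    {v v' w w' : ℂ} (hx : x ∈ s) (hs : UniqueDiffWithinAt ℝ s x)
    (hγ : Set.MapsTo γ s U) (hd : HasDerivWithinAt γ v s x) (hv : v = t.frame (γ x) w)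
    (hγ' : Set.MapsTo γ' s U') (hd' : HasDerivWithinAt γ' v' s x) (hv' : v' = t'.frame (γ' x) w')
    (he : ∀ y ∈ s, S.proj (f (γ y)) = S.proj (f' (γ' y))) {g : GLTilde}
    (hg : f (γ x) = S.act (f' (γ' x)) g) : g.toCLM w = w' := by
  obtain ⟨L, hL, h1⟩ := hf.hasMFDerivWithinAt_comp hx hγ hd hv
  obtain ⟨L', hL', h2⟩ := hf'.hasMFDerivWithinAt_comp hx hγ' hd' hv'
  have h3 : HasMFDerivWithinAt 𝓘(ℝ, ℝ) (𝓡∂ 2) (S.proj ∘ f ∘ γ) s x L' :=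
    h2.congr_mono he (he x hx) le_rfl
  -- Both are derivatives of the same curve in the surface, on a set with unique derivatives.
  have h4 : L = L' := UniqueMDiffWithinAt.eq
    (uniqueMDiffWithinAt_iff_uniqueDiffWithinAt.2 hs) h1 h3
  apply S.vec_injective (f' (γ' x))
  rw [← S.vec_act, ← hg, ← hL, ← hL', h4]

end SpinStructure

/-! ## The edges of the standard triangle -/

/-- The outer normal direction of the `k`-th edge of the standard triangle. -/
def edgeNormal (k : Fin 3) : ℂ :=
  Complex.exp ((2 * Real.pi * ((k : ℕ) / 3 + 1 / 6) : ℝ) * Complex.I)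

theorem norm_edgeNormal (k : Fin 3) : ‖edgeNormal k‖ = 1 := Complex.norm_exp_ofReal_mul_I _

theorem edgeNormal_ne_zero (k : Fin 3) : edgeNormal k ≠ 0 := Complex.exp_ne_zero _

theorem edgeNormal_rev (k : Fin 3) : edgeNormal k.rev = (edgeNormal k)⁻¹ := by
  unfold edgeNormal
  rw [← Complex.exp_neg, Complex.exp_eq_exp_iff_exists_int]
  -- The angles of edges `k` and `2 - k` add up to one full turn.
  refine ⟨1, ?_⟩
  fin_cases k <;> norm_num [Fin.rev] <;> ring

theorem edgeDir_sq (k : Fin 3) : GLTilde.edgeDir k ^ 2 = Complex.I * edgeNormal k := by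
  unfold GLTilde.edgeDir edgeNormal
  rw [← Complex.exp_nat_mul]
  nth_rw 2 [← Complex.exp_pi_div_two_mul_I]
  rw [← Complex.exp_add]
  congr 1
  push_cast
  ring

theorem exp_pi_div_three : Complex.exp ((Real.pi / 3 : ℝ) * Complex.I) =
    1 / 2 + (Real.sqrt 3 / 2 : ℝ) * Complex.I := by
  rw [Complex.exp_mul_I, ← Complex.ofReal_cos, ← Complex.ofReal_sin, Real.cos_pi_div_three,
    Real.sin_pi_div_three]
  norm_num

theorem exp_neg_pi_div_three : Complex.exp ((-(Real.pi / 3) : ℝ) * Complex.I) =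
    1 / 2 - (Real.sqrt 3 / 2 : ℝ) * Complex.I := by
  rw [Complex.exp_mul_I, ← Complex.ofReal_cos, ← Complex.ofReal_sin, Real.cos_neg, Real.sin_neg,
    Real.cos_pi_div_three, Real.sin_pi_div_three]
  push_cast
  ring

theorem stdVertex_eq (k : Fin 3) : stdVertex k =
    edgeNormal k * (1 / 2 - (Real.sqrt 3 / 2 : ℝ) * Complex.I) := by
  rw [← exp_neg_pi_div_three, stdVertex, edgeNormal, ← Complex.exp_add]
  congr 1
  push_cast
  ring

theorem stdVertex_succ_eq (k : Fin 3) : stdVertex (k + 1) =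
    edgeNormal k * (1 / 2 + (Real.sqrt 3 / 2 : ℝ) * Complex.I) := by
  rw [← exp_pi_div_three, stdVertex, edgeNormal, ← Complex.exp_add,
    Complex.exp_eq_exp_iff_exists_int]
  obtain rfl | rfl | rfl : k = 0 ∨ k = 1 ∨ k = 2 := by omega
  · refine ⟨0, ?_⟩
    norm_num
    ring
  · refine ⟨0, ?_⟩
    rw [show (1 + 1 : Fin 3) = 2 from rfl]
    norm_num
    ring
  -- The last edge returns to vertex `0`, which accounts for a full turn.
  · refine ⟨-1, ?_⟩
    rw [show (2 + 1 : Fin 3) = 0 from rfl]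
    norm_num
    ring

/-- The barycentric coordinates of a parametrisation of the `k`-th edge by `[-1/2, 1/2]`. -/
def edgeWeight (k : Fin 3) (t : ℝ) : Fin 3 → ℝ :=
  Pi.single k (1 / 2 - t) + Pi.single (k + 1) (1 / 2 + t)

theorem edgeWeight_mem {t : ℝ} (ht : t ∈ Set.Icc (-1 / 2 : ℝ) (1 / 2)) (k : Fin 3) :
    edgeWeight k t ∈ stdSimplex ℝ (Fin 3) := by
  have h1 : 0 ≤ 1 / 2 - t := by linarith [ht.2]
  have h2 : 0 ≤ 1 / 2 + t := by linarith [ht.1]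
  refine ⟨fun x => add_nonneg ?_ ?_, ?_⟩
  · exact (Pi.single_nonneg.2 h1 : (0 : Fin 3 → ℝ) ≤ _) x
  · exact (Pi.single_nonneg.2 h2 : (0 : Fin 3 → ℝ) ≤ _) x
  · simp only [edgeWeight, Pi.add_apply, Finset.sum_add_distrib, Finset.sum_pi_single',
      Finset.mem_univ, if_true]
    ring

theorem exists_edgeWeight_eq_zero (k : Fin 3) (t : ℝ) : ∃ l, edgeWeight k t l = 0 := by
  refine ⟨k + 2, ?_⟩
  fin_cases k <;> simp [edgeWeight]

theorem sum_edgeWeight {E : Type*} [AddCommGroup E] [Module ℝ E] (k : Fin 3) (t : ℝ)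
    (f : Fin 3 → E) :
    ∑ l, edgeWeight k t l • f l = (1 / 2 - t) • f k + (1 / 2 + t) • f (k + 1) := by
  simp [edgeWeight, add_smul, Finset.sum_add_distrib, Pi.single_apply, ite_smul]

theorem MarkedCombSurface.point_edgeWeight {B : ℕ} (K : MarkedCombSurface.{u} B)
    {f f' : Fin 3 → K.V} {k k' : Fin 3} (h : f k = f' (k' + 1)) (h' : f (k + 1) = f' k') (t : ℝ) :
    K.point f (edgeWeight k t) = K.point f' (edgeWeight k' (-t)) := by
  unfold MarkedCombSurface.point
  rw [sum_edgeWeight, sum_edgeWeight, h, h', add_comm, sub_neg_eq_add, ← sub_eq_add_neg]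

/-- The parametrisation of the `k`-th edge of the standard triangle by `[-1/2, 1/2]`. -/
def edgePoint (k : Fin 3) (t : ℝ) : ℂ := edgeNormal k * (1 / 2 + (t * Real.sqrt 3 : ℝ) * Complex.I)

theorem sum_edgeWeight_stdVertex (k : Fin 3) (t : ℝ) :
    ∑ l, edgeWeight k t l • stdVertex l = edgePoint k t := by
  rw [sum_edgeWeight, stdVertex_eq, stdVertex_succ_eq, edgePoint]
  simp only [Complex.real_smul]
  push_cast
  ring

theorem edgePoint_zero (k : Fin 3) : edgePoint k 0 = stdMidpoint k := by
  rw [← sum_edgeWeight_stdVertex, sum_edgeWeight, stdMidpoint, midpoint_eq_smul_add]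
  norm_num

theorem edgePoint_mem {t : ℝ} (ht : t ∈ Set.Icc (-1 / 2 : ℝ) (1 / 2)) (k : Fin 3) :
    edgePoint k t ∈ stdTriangle := by
  rw [← sum_edgeWeight_stdVertex]
  have h := edgeWeight_mem ht k
  exact (convex_convexHull ℝ _).sum_mem (fun i _ => h.1 i) h.2
    fun i _ => subset_convexHull ℝ _ (Set.mem_range_self i)

theorem stdMidpoint_mem (k : Fin 3) : stdMidpoint k ∈ stdTriangle := by
  rw [← edgePoint_zero]
  exact edgePoint_mem (by norm_num) k

theorem norm_edgePoint (k : Fin 3) (t : ℝ) : ‖edgePoint k t‖ = Real.sqrt (1 / 4 + 3 * t ^ 2) := by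
  rw [edgePoint, norm_mul, norm_edgeNormal, one_mul, Complex.norm_eq_sqrt_sq_add_sq]
  congr 1
  simp [mul_pow]
  ring

theorem edgePoint_ne_zero (k : Fin 3) (t : ℝ) : edgePoint k t ≠ 0 := by
  rw [← norm_pos_iff, norm_edgePoint]
  positivity

theorem hasDerivAt_edgePoint (k : Fin 3) (t : ℝ) :
    HasDerivAt (edgePoint k) ((Real.sqrt 3 : ℝ) * GLTilde.edgeDir k ^ 2) t := by
  rw [edgeDir_sq]
  have h1 : HasDerivAt (fun t : ℝ => t * Real.sqrt 3) (Real.sqrt 3) t := by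
    simpa using (hasDerivAt_id t).mul_const (Real.sqrt 3)
  have h2 := ((h1.ofReal_comp.mul_const Complex.I).const_add (1 / 2 : ℂ)).const_mul (edgeNormal k)
  refine h2.congr_deriv ?_
  ring

/-- The parametrisation of the unit circle by the `k`-th edge of the standard triangle, in the
opposite direction. -/
def arcPoint (k : Fin 3) (t : ℝ) : ℂ := edgePoint k (-t) / (‖edgePoint k (-t)‖ : ℝ)

theorem norm_arcPoint (k : Fin 3) (t : ℝ) : ‖arcPoint k t‖ = 1 := by
  rw [arcPoint, norm_div, Complex.norm_real, norm_norm,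
    div_self (norm_ne_zero_iff.2 (edgePoint_ne_zero k _))]

theorem arcPoint_zero (k : Fin 3) : arcPoint k 0 = edgeNormal k := by
  rw [arcPoint, norm_edgePoint, edgePoint]
  norm_num

/-- The distance from the origin is stationary at the midpoint of an edge, with value `1/2`, so the
projection to the circle merely doubles the velocity. The sign comes from the reversed direction. -/
theorem hasDerivAt_arcPoint (k : Fin 3) :
    HasDerivAt (arcPoint k) (-2 * (Real.sqrt 3 : ℝ) * Complex.I * edgeNormal k) 0 := by
  have h1 : HasDerivAt (fun t : ℝ => edgePoint k (-t))
      (-((Real.sqrt 3 : ℝ) * GLTilde.edgeDir k ^ 2)) 0 := by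
    have h := (hasDerivAt_edgePoint k (-0)).scomp (0 : ℝ) (hasDerivAt_neg (0 : ℝ))
    simpa [Function.comp_def] using h
  have h2 : HasDerivAt (fun t : ℝ => Real.sqrt (1 / 4 + 3 * t ^ 2)) 0 0 := by
    have h := (((hasDerivAt_id (0 : ℝ)).pow 2).const_mul 3).const_add (1 / 4)
    have h' := h.sqrt (by norm_num)
    simpa using h'
  have h3 : HasDerivAt (fun t : ℝ => ((‖edgePoint k (-t)‖ : ℝ) : ℂ)) 0 0 := by
    have h := h2.ofReal_comp
    simpa [norm_edgePoint] using h
  have h4 := h1.div h3 (by simpa using edgePoint_ne_zero k 0)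
  refine h4.congr_deriv ?_
  have h5 : ((‖edgePoint k (-0)‖ : ℝ) : ℂ) = 1 / 2 := by
    rw [norm_edgePoint]
    norm_num
  rw [h5, edgeDir_sq]
  ring

/-! ## Edge signs -/

/-- The rotation angle, divided by `2π`, between a triangle and the collar at a boundary edge. -/
def SpinType.edgeAngle (l k : Fin 3) : SpinType → ℝ
  | .NS => (l : ℕ) / 3 - (k : ℕ) / 3 + 1 / 2
  | .R => -((k : ℕ) / 3) - 1 / 6 + 1 / 2

/-- `e^{πiθ}` for the angle `2πθ` between a triangle and the collar at a boundary edge. -/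
def SpinType.edgeUnit (t : SpinType) (l k : Fin 3) : ℂ :=
  Complex.exp ((Real.pi * t.edgeAngle l k : ℝ) * Complex.I)

theorem SpinType.norm_edgeUnit (t : SpinType) (l k : Fin 3) : ‖t.edgeUnit l k‖ = 1 :=
  Complex.norm_exp_ofReal_mul_I _

theorem SpinType.edgeUnit_ne_zero (t : SpinType) (l k : Fin 3) : t.edgeUnit l k ≠ 0 :=
  Complex.exp_ne_zero _

/-- This is what the reference angle means: in the frame of the collar, the square of `edgeUnit`
rotates the direction of the triangle's edge to the clockwise tangent of the circle. -/
theorem SpinType.frame_edgeUnit (t : SpinType) (l k : Fin 3) :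
    t.frame (edgeNormal l) (t.edgeUnit l k ^ 2 * GLTilde.edgeDir k ^ 2) =
      -Complex.I * edgeNormal l := by
  have hI : Complex.exp ((3 * Real.pi / 2 : ℝ) * Complex.I) = -Complex.I := by
    have h : ((3 * Real.pi / 2 : ℝ) : ℂ) * Complex.I =
        Real.pi * Complex.I + Real.pi / 2 * Complex.I := by
      push_cast
      ring
    rw [h, Complex.exp_add, Complex.exp_pi_mul_I, Complex.exp_pi_div_two_mul_I]
    ring
  cases t
  · simp only [SpinType.frame, SpinType.edgeUnit, GLTilde.edgeDir, edgeNormal,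
      SpinType.edgeAngle]
    rw [← hI, ← Complex.exp_nat_mul, ← Complex.exp_nat_mul, ← Complex.exp_add, ← Complex.exp_add]
    congr 1
    push_cast
    ring
  · simp only [SpinType.frame]
    rw [mul_comm]
    congr 1
    simp only [SpinType.edgeUnit, GLTilde.edgeDir, SpinType.edgeAngle]
    rw [← hI, ← Complex.exp_nat_mul, ← Complex.exp_nat_mul, ← Complex.exp_add]
    congr 1
    push_cast
    ring

/-- The product of `edgeUnit` and `edgeDir` does not depend on the triangle's edge number: it is
`e^{πi(l/3 + 11/12)}` for `NS` and `e^{3πi/4}` for `R`. For `NS` the factor `1/z` of the inversion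
accounts for the passage from `l` to `l.rev`. -/
theorem SpinType.inversionFactor_edgeNormal (t : SpinType) (ε : ℤˣ) (l k k' : Fin 3) :
    t.inversionFactor ε (edgeNormal l) * (t.edgeUnit l k * GLTilde.edgeDir k) =
      Complex.I * ((ε : ℤ) : ℂ) * (t.edgeUnit l.rev k' * GLTilde.edgeDir k') := by
  cases t
  · have hπ : (-Complex.I) = Complex.I * Complex.exp (Real.pi * Complex.I) := by
      rw [Complex.exp_pi_mul_I, mul_neg_one]
    have hl : ((l.rev : ℕ) : ℂ) = 2 - (l : ℕ) := by
      obtain rfl | rfl | rfl : l = 0 ∨ l = 1 ∨ l = 2 := by omega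
      all_goals norm_num [Fin.rev]
    rw [SpinType.inversionFactor, div_mul_eq_mul_div, div_eq_iff (edgeNormal_ne_zero l), hπ]
    simp only [SpinType.edgeUnit, GLTilde.edgeDir, SpinType.edgeAngle, edgeNormal]
    rw [← Complex.exp_add, ← Complex.exp_add]
    have h : ∀ a b c d x y : ℂ, a + b = c + d → x * Complex.exp a * y * Complex.exp b =
        x * y * Complex.exp c * Complex.exp d := by
      intro a b c d x y h
      calc _ = x * y * (Complex.exp a * Complex.exp b) := by ring
        _ = _ := by rw [← Complex.exp_add, h, Complex.exp_add, ← mul_assoc]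
    apply h
    push_cast
    rw [hl]
    ring
  · simp only [SpinType.inversionFactor]
    congr 1
    simp only [SpinType.edgeUnit, GLTilde.edgeDir, SpinType.edgeAngle]
    rw [← Complex.exp_add, ← Complex.exp_add]
    congr 1
    push_cast
    ring

theorem exists_units_eq {s : ℂ} (hs : s = 1 ∨ s = -1) : ∃ s' : ℤˣ, s = ((s' : ℤ) : ℂ) := by
  rcases hs with rfl | rfl
  · exact ⟨1, by simp⟩
  · exact ⟨-1, by simp⟩

theorem norm_intUnit (s : ℤˣ) : ‖((s : ℤ) : ℂ)‖ = 1 := by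
  rcases Int.units_eq_one_or s with rfl | rfl <;> simp

theorem intUnit_ne_zero (s : ℤˣ) : ((s : ℤ) : ℂ) ≠ 0 := by
  rw [← norm_pos_iff, norm_intUnit]
  exact one_pos

namespace SpinTriangulatedSurface

variable {B : ℕ} (Λ : SpinTriangulatedSurface.{u} B)

theorem proj_χ_edgePoint (σ : Λ.T) (k : Fin 3) {t : ℝ} (ht : t ∈ Set.Icc (-1 / 2 : ℝ) (1 / 2)) :
    Λ.spin.proj (Λ.χ σ (edgePoint k t)) = Λ.φ (Λ.point (Λ.tri σ) (edgeWeight k t)) := by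
  rw [← Λ.χ_cover σ _ (edgeWeight_mem ht k), sum_edgeWeight_stdVertex]

theorem neg_mem_Icc {t : ℝ} (ht : t ∈ Set.Icc (-1 / 2 : ℝ) (1 / 2)) :
    -t ∈ Set.Icc (-1 / 2 : ℝ) (1 / 2) := ⟨by linarith [ht.2], by linarith [ht.1]⟩

theorem tri_right {e : Λ.E} {s : Λ.T × Fin 3} (hr : Λ.right e = s) :
    Λ.tri s.1 s.2 = e.1.2 ∧ Λ.tri s.1 (s.2 + 1) = e.1.1 := by
  have h := Λ.right_spec e
  rw [hr] at h
  exact ⟨congrArg Prod.fst h, congrArg Prod.snd h⟩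

theorem proj_stdMidpoint {e : Λ.E} {sR sL : Λ.T × Fin 3} (hr : Λ.right e = sR)
    (hl : Λ.left e = .inl sL) : Λ.spin.proj (Λ.χ sR.1 (stdMidpoint sR.2)) =
      Λ.spin.proj (Λ.χ sL.1 (stdMidpoint sL.2)) := by
  have h := Λ.left_spec e
  rw [hl] at h
  have h0 : (0 : ℝ) ∈ Set.Icc (-1 / 2 : ℝ) (1 / 2) := by norm_num
  rw [← edgePoint_zero, ← edgePoint_zero, Λ.proj_χ_edgePoint _ _ h0, Λ.proj_χ_edgePoint _ _ h0,
    Λ.point_edgeWeight (f' := Λ.tri sL.1) (k' := sL.2)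
      ((Λ.tri_right hr).1.trans (congrArg Prod.snd h).symm)
      ((Λ.tri_right hr).2.trans (congrArg Prod.fst h).symm), neg_zero]

theorem proj_arcPoint {e : Λ.E} {sR : Λ.T × Fin 3} {i : Fin B} {l : Fin 3} (hr : Λ.right e = sR)
    (hl : Λ.left e = .inr (i, l)) {t : ℝ} (ht : t ∈ Set.Icc (-1 / 2 : ℝ) (1 / 2)) :
    Λ.spin.proj (Λ.χ sR.1 (edgePoint sR.2 t)) = Λ.spin.proj (Λ.collar i (arcPoint l t)) := by
  have h := Λ.left_spec e
  rw [hl] at h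
  rw [Λ.proj_χ_edgePoint _ _ ht, Λ.point_edgeWeight (f' := Λ.bdry i) (k' := l)
      ((Λ.tri_right hr).1.trans (congrArg Prod.snd h).symm)
      ((Λ.tri_right hr).2.trans (congrArg Prod.fst h).symm),
    Λ.bdry_cover i _ (edgeWeight_mem (neg_mem_Icc ht) l) (exists_edgeWeight_eq_zero l _),
    sum_edgeWeight_stdVertex]
  rfl

theorem proj_edgeNormal {e : Λ.E} {sR : Λ.T × Fin 3} {i : Fin B} {l : Fin 3}
    (hr : Λ.right e = sR) (hl : Λ.left e = .inr (i, l)) :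
    Λ.spin.proj (Λ.χ sR.1 (stdMidpoint sR.2)) = Λ.spin.proj (Λ.collar i (edgeNormal l)) := by
  rw [← edgePoint_zero, ← arcPoint_zero]
  exact Λ.proj_arcPoint hr hl (by norm_num)

open Classical in
-- The structure group acts freely, so the group element in the definition of the edge sign is
-- unique and any given one may be tested.
theorem edgeSign_inl {e : Λ.E} {sR sL : Λ.T × Fin 3} (hr : Λ.right e = sR)
    (hl : Λ.left e = .inl sL) {g : GLTilde}
    (hg : Λ.χ sR.1 (stdMidpoint sR.2) = Λ.spin.act (Λ.χ sL.1 (stdMidpoint sL.2)) g) :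
    Λ.edgeSign e = if GLTilde.Qtα sR.2 g * GLTilde.deltaExp
      (-(Real.pi * ((sL.2 : ℕ) / 3 - (sR.2 : ℕ) / 3 + 1 / 2))) = GLTilde.delta 1
      then 1 else -1 := by
  obtain ⟨σL, kL⟩ := sL
  unfold edgeSign
  rw [hl, hr]
  dsimp only
  refine if_congr ⟨?_, fun h => ⟨g, hg, h⟩⟩ rfl rfl
  rintro ⟨g', hg', h⟩
  rwa [Λ.spin.act_injective _ (hg.symm.trans hg')]

open Classical in
theorem edgeSign_inr {e : Λ.E} {sR : Λ.T × Fin 3} {i : Fin B} {l : Fin 3} (hr : Λ.right e = sR)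
    (hl : Λ.left e = .inr (i, l)) {g : GLTilde}
    (hg : Λ.χ sR.1 (stdMidpoint sR.2) = Λ.spin.act (Λ.collar i (edgeNormal l)) g) :
    Λ.edgeSign e = if GLTilde.Qtα sR.2 g * GLTilde.deltaExp
      (-(Real.pi * (Λ.type i).edgeAngle l sR.2)) = GLTilde.delta 1 then 1 else -1 := by
  unfold edgeSign
  rw [hl, hr]
  dsimp only
  refine if_congr ⟨?_, fun h => ⟨g, hg, ?_⟩⟩ rfl rfl
  · rintro ⟨g', hg', h⟩
    rw [Λ.spin.act_injective _ (hg.symm.trans hg')]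
    cases ht : Λ.type i <;> rw [ht] at h <;> exact h
  · cases ht : Λ.type i <;> rw [ht] at h <;> exact h

open Classical in
theorem ite_delta_eq {h : GLTilde} {s : ℤˣ} (hs : h = GLTilde.delta ((s : ℤ) : ℂ)) :
    (if h = GLTilde.delta 1 then (1 : ℤˣ) else -1) = s := by
  rcases Int.units_eq_one_or s with rfl | rfl
  · rw [if_pos (by rw [hs]; simp)]
  · rw [if_neg]
    intro h1
    rw [hs] at h1
    have := GLTilde.delta_injective (intUnit_ne_zero _) one_ne_zero h1
    norm_num at this

/-- The transition at a boundary edge. -/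
theorem exists_bdry_transition {e : Λ.E} {sR : Λ.T × Fin 3} {i : Fin B} {l : Fin 3}
    (hr : Λ.right e = sR) (hl : Λ.left e = .inr (i, l)) :
    ∃ (a b c : ℝ) (ha : 0 < a) (hc : 0 < c), Λ.χ sR.1 (stdMidpoint sR.2) =
      Λ.spin.act (Λ.collar i (edgeNormal l))
        (GLTilde.delta (((Λ.edgeSign e : ℤ) : ℂ) * (Λ.type i).edgeUnit l sR.2) *
          (GLTilde.delta (GLTilde.edgeDir sR.2) * GLTilde.upper a b c ha hc *
            (GLTilde.delta (GLTilde.edgeDir sR.2))⁻¹)) := by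
  obtain ⟨g, hg⟩ := Λ.spin.exists_eq_act (Λ.proj_edgeNormal hr hl)
  have h3 : (Real.sqrt 3 : ℂ) ≠ 0 := by
    rw [Complex.ofReal_ne_zero]
    positivity
  -- Triangle and collar agree only along the edge, so `g` is known only on the edge direction. This
  -- determines the rotation part up to the sign of its lift.
  have h1 : g.toCLM ((Real.sqrt 3 : ℝ) * GLTilde.edgeDir sR.2 ^ 2) =
      2 * (Real.sqrt 3 : ℝ) * ((Λ.type i).edgeUnit l sR.2 ^ 2 * GLTilde.edgeDir sR.2 ^ 2) := by
    have h0 : (0 : ℝ) ∈ Set.Icc (-1 / 2 : ℝ) (1 / 2) := by norm_num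
    refine (Λ.χ_spin sR.1).toCLM_eq (Λ.collar_embedding i).1 h0
      (uniqueDiffOn_Icc (by norm_num) 0 h0) (fun t ht => edgePoint_mem ht sR.2)
      (hasDerivAt_edgePoint sR.2 0).hasDerivWithinAt rfl (γ' := arcPoint l) (fun t _ => ?_)
      (hasDerivAt_arcPoint l).hasDerivWithinAt ?_ (fun t ht => Λ.proj_arcPoint hr hl ht) ?_
    · simp only [Set.mem_ofPred_eq, norm_arcPoint]
      exact ⟨le_rfl, Λ.one_lt_radius i⟩
    · have h := (Λ.type i).frame_edgeUnit l sR.2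
      rw [arcPoint_zero]
      cases ht : Λ.type i <;> rw [ht] at h <;> simp only [SpinType.frame] at h ⊢ <;>
        linear_combination (-(2 * (Real.sqrt 3 : ℂ))) * h
    · rw [edgePoint_zero, arcPoint_zero]
      exact hg
  have h2 : g.toCLM (GLTilde.edgeDir sR.2 ^ 2) =
      (2 : ℝ) * (Λ.type i).edgeUnit l sR.2 ^ 2 * GLTilde.edgeDir sR.2 ^ 2 := by
    have h : ((Real.sqrt 3 : ℝ) : ℂ) * GLTilde.edgeDir sR.2 ^ 2 =
      Real.sqrt 3 • GLTilde.edgeDir sR.2 ^ 2 := (Complex.real_smul).symm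
    rw [h, map_smul, Complex.real_smul] at h1
    apply mul_left_cancel₀ h3
    rw [h1]
    push_cast
    ring
  obtain ⟨s, a, b, c, ha, hc, hs, he⟩ := g.exists_factorisation (GLTilde.norm_edgeDir sR.2)
    ((Λ.type i).norm_edgeUnit l sR.2) two_pos h2
  obtain ⟨s, rfl⟩ := exists_units_eq hs
  refine ⟨a, b, c, ha, hc, ?_⟩
  rw [Λ.edgeSign_inr hr hl hg, ite_delta_eq (s := s), ← he]
  · exact hg
  · rw [he, GLTilde.Qtα_factorisation, GLTilde.deltaExp_neg, mul_inv_eq_iff_eq_mul,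
      GLTilde.delta_mul (intUnit_ne_zero s) ((Λ.type i).edgeUnit_ne_zero _ _)]
    · rfl
    · rw [norm_mul, norm_intUnit, SpinType.norm_edgeUnit, one_mul]

end SpinTriangulatedSurface

/-! ### Transition elements of the glued spin bundle -/

namespace Gluing

variable {n : ℕ} {Λ : SpinTriangulatedSurface.{u} (n + 2)} {i j : Fin (n + 2)} {hij : i ≠ j}
  {ε : ℤˣ} {Λ' : SpinTriangulatedSurface.{u} n} (G : Gluing Λ hij ε Λ')

theorem χ_stdMidpoint (s : Λ.T × Fin 3) :
    Λ'.χ (G.triEquiv s.1) (stdMidpoint s.2) = G.Q (Λ.χ s.1 (stdMidpoint s.2)) :=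
  G.χ_eq s.1 (stdMidpoint_mem s.2)

theorem collar_edgeNormal (m : Fin n) (l : Fin 3) :
    Λ'.collar m (edgeNormal l) = G.Q (Λ.collar (remaining hij m) (edgeNormal l)) :=
  G.collar_eq m ⟨(norm_edgeNormal l).ge, (norm_edgeNormal l).trans_lt (Λ'.one_lt_radius m)⟩

/-- The signs of the edges away from the glued boundaries do not change. -/
theorem edgeSign_freeEdge (e : FreeEdge Λ i j) :
    Λ'.edgeSign (G.mapEdge e.1 e.2.1) = Λ.edgeSign e.1 := by
  have hr' := G.right_mapEdge e.1 e.2.1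
  rcases left_freeEdge (hij := hij) e with ⟨s, hl⟩ | ⟨m, l, hl⟩
  · obtain ⟨g, hg⟩ := Λ.spin.exists_eq_act (Λ.proj_stdMidpoint rfl hl)
    rw [Λ.edgeSign_inl rfl hl hg, Λ'.edgeSign_inl hr' (G.left_mapEdge_inl _ e.2.1 hl) (g := g)]
    rw [G.χ_stdMidpoint, G.χ_stdMidpoint, hg, G.Q_act]
  · obtain ⟨g, hg⟩ := Λ.spin.exists_eq_act (Λ.proj_edgeNormal rfl hl)
    rw [Λ.edgeSign_inr rfl hl hg, Λ'.edgeSign_inr hr' (G.left_mapEdge_inr _ e.2.1 hl) (g := g),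
      G.type_eq]
    rw [G.χ_stdMidpoint, G.collar_edgeNormal, hg, G.Q_act]

/-- The transition at a glued edge. -/
theorem glued_transition (k : Fin 3) {si sj : Λ.T × Fin 3} {gi gj : GLTilde}
    (hi : Λ.χ si.1 (stdMidpoint si.2) = Λ.spin.act (Λ.collar i (edgeNormal k.rev)) gi)
    (hj : Λ.χ sj.1 (stdMidpoint sj.2) = Λ.spin.act (Λ.collar j (edgeNormal k)) gj) :
    Λ'.χ (G.triEquiv sj.1) (stdMidpoint sj.2) =
      Λ'.spin.act (Λ'.χ (G.triEquiv si.1) (stdMidpoint si.2))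
        (gi⁻¹ * GLTilde.delta ((Λ.type i).inversionFactor ε (edgeNormal k)) * gj) := by
  -- The bundle identification replaces the `j`-th collar at `edgeNormal k` by the `i`-th at the
  -- inverse point `edgeNormal k.rev`; the transition `gi` there is then inverted to reach the
  -- triangle.
  rw [G.χ_stdMidpoint, G.χ_stdMidpoint, hj, hi, G.Q_act, G.Q_collar _ (norm_edgeNormal k),
    edgeNormal_rev, G.Q_act, G.Q_act, Λ'.spin.act_mul, Λ'.spin.act_mul, ← Λ'.spin.act_mul _ gi,
    mul_inv_cancel, Λ'.spin.act_one]

end Gluing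

namespace GLTilde

/-- The composition of two rotated triangular transitions with a rotation. -/
theorem inv_mul_delta_mul_eq {u u' c m α α' : ℂ} (hu : u ≠ 0) (hu' : u' ≠ 0) (hc : c ≠ 0)
    (hα : α ≠ 0) (hα' : α' ≠ 0) (hm : m ^ 2 = 1 ∨ m ^ 2 = -1)
    (h : c * (u' * α') = m * (u * α)) (T T' : GLTilde) :
    (delta u * (delta α * T * (delta α)⁻¹))⁻¹ * delta c *
      (delta u' * (delta α' * T' * (delta α')⁻¹)) =
      delta (m * (α / α')) * (delta α' * (T⁻¹ * T') * (delta α')⁻¹) := by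
  have hm0 : m ≠ 0 := by
    rintro rfl
    norm_num at hm
  have h1 : delta c * (delta u' * delta α') = delta m * (delta u * delta α) := by
    rw [← delta_mul hu' hα', ← delta_mul hc (mul_ne_zero hu' hα'), h, ← delta_mul hu hα,
      ← delta_mul hm0 (mul_ne_zero hu hα)]
  have h2 : delta (m * (α / α')) = delta m * (delta α * (delta α')⁻¹) := by
    rw [delta_mul hm0 (div_ne_zero hα hα'), div_eq_mul_inv, delta_mul hα (inv_ne_zero hα'),
      delta_inv hα']
  -- Inserting `h` cancels `δ(u) δ(α)` up to `δ(m)`, which is central and so passes the triangular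
  -- factor; the conjugation is then rewritten relative to `α'`.
  calc _ = delta α * T⁻¹ * (delta α)⁻¹ * (delta u)⁻¹ * (delta c * (delta u' * delta α')) * T' *
        (delta α')⁻¹ := by group
    _ = delta α * T⁻¹ * (delta α)⁻¹ * (delta u)⁻¹ * (delta u * delta α * delta m) * T' *
        (delta α')⁻¹ := by rw [h1, delta_central hm]
    _ = delta α * T⁻¹ * delta m * T' * (delta α')⁻¹ := by group
    _ = delta m * (delta α * T⁻¹) * T' * (delta α')⁻¹ := by rw [delta_central hm]
    _ = _ := by
      rw [h2]
      group

end GLTilde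

/-! ### The sign of a glued edge -/

namespace Gluing

variable {n : ℕ} {Λ : SpinTriangulatedSurface.{u} (n + 2)} {i j : Fin (n + 2)} {hij : i ≠ j}
  {ε : ℤˣ} {Λ' : SpinTriangulatedSurface.{u} n} (G : Gluing Λ hij ε Λ')

/-- The sign of a glued edge. -/
theorem edgeSign_gluedEdge (htype : Λ.type i = Λ.type j) (k : Fin 3) :
    Λ'.edgeSign (G.gluedEdge k) =
      ε * Λ.edgeSign (Λ.bdryEdge i k.rev) * Λ.edgeSign (Λ.bdryEdge j k) := by
  obtain ⟨a, b, c, ha, hc, hi⟩ := Λ.exists_bdry_transition (e := Λ.bdryEdge i k.rev) rfl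
    (Λ.left_bdryEdge i k.rev)
  obtain ⟨a', b', c', ha', hc', hj⟩ := Λ.exists_bdry_transition (e := Λ.bdryEdge j k) rfl
    (Λ.left_bdryEdge j k)
  have hg := G.glued_transition k hi hj
  have hfac := (Λ.type i).inversionFactor_edgeNormal ε k (Λ.right (Λ.bdryEdge j k)).2
    (Λ.right (Λ.bdryEdge i k.rev)).2
  rw [← htype] at hg
  rw [Λ'.edgeSign_inl (e := G.gluedEdge k)
    (G.right_mapEdge _ (bdryEdge_j_ne (hij := hij) k)) (G.left_gluedEdge k) hg]
  dsimp only
  generalize Λ.edgeSign (Λ.bdryEdge i k.rev) = s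
  generalize Λ.edgeSign (Λ.bdryEdge j k) = s'
  generalize (Λ.right (Λ.bdryEdge j k)).2 = kj at *
  generalize (Λ.right (Λ.bdryEdge i k.rev)).2 = ki at *
  have hss : ((s : ℤ) : ℂ) * ((s : ℤ) : ℂ) = 1 := by
    rcases Int.units_eq_one_or s with rfl | rfl <;> simp
  apply SpinTriangulatedSurface.ite_delta_eq
  have hu : ∀ (s : ℤˣ) (l k : Fin 3), ((s : ℤ) : ℂ) * (Λ.type i).edgeUnit l k ≠ 0 := fun s l k =>
    mul_ne_zero (intUnit_ne_zero s) ((Λ.type i).edgeUnit_ne_zero l k)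
  have hc0 : (Λ.type i).inversionFactor ε (edgeNormal k) ≠ 0 := by
    intro h
    rw [h, zero_mul] at hfac
    exact mul_ne_zero (mul_ne_zero Complex.I_ne_zero (intUnit_ne_zero ε))
      (mul_ne_zero ((Λ.type i).edgeUnit_ne_zero _ _) (GLTilde.edgeDir_ne_zero ki)) hfac.symm
  have hm : (Complex.I * (((ε * s * s' : ℤˣ) : ℤ) : ℂ)) ^ 2 = -1 := by
    rw [mul_pow, Complex.I_sq]
    rcases Int.units_eq_one_or (ε * s * s') with h | h <;> rw [h] <;> simp
  -- The new triangles have `k_L = ki` and `k_R = kj`. The `i` in `m` is the `e^{πi/2}` of the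
  -- reference rotation and the quotient of edge directions is its remaining part, so that `ε s s'`
  -- is left over.
  rw [GLTilde.inv_mul_delta_mul_eq (m := Complex.I * (((ε * s * s' : ℤˣ) : ℤ) : ℂ)) (hu _ _ _)
    (hu _ _ _) hc0 (GLTilde.edgeDir_ne_zero _) (GLTilde.edgeDir_ne_zero _) (Or.inr hm),
    GLTilde.upper_inv, GLTilde.upper_mul, GLTilde.Qtα_factorisation, GLTilde.deltaExp_neg,
    mul_inv_eq_iff_eq_mul, GLTilde.deltaExp, ← GLTilde.delta_mul (intUnit_ne_zero _)
      (Complex.exp_ne_zero _)]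
  · congr 1
    have e1 : GLTilde.edgeDir ki / GLTilde.edgeDir kj =
        Complex.exp ((Real.pi * ((ki : ℕ) / 3 - (kj : ℕ) / 3) : ℝ) * Complex.I) := by
      unfold GLTilde.edgeDir
      rw [← Complex.exp_sub]
      congr 1
      push_cast
      ring
    rw [e1, mul_comm Complex.I, mul_assoc]
    congr 1
    nth_rw 1 [← Complex.exp_pi_div_two_mul_I]
    rw [← Complex.exp_add]
    congr 1
    push_cast
    ring
  · rw [norm_mul, norm_mul, norm_intUnit, Complex.norm_I, norm_div, GLTilde.norm_edgeDir,
      GLTilde.norm_edgeDir]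
    norm_num
  -- The required relation is `hfac` multiplied by `s'`; the sign `s` occurs twice and drops out
  -- because `s² = 1`.
  · push_cast
    linear_combination ((s' : ℤ) : ℂ) * hfac - Complex.I * ((ε : ℤ) : ℂ) * ((s' : ℤ) : ℂ) *
      ((Λ.type i).edgeUnit k.rev ki * GLTilde.edgeDir ki) * hss

end Gluing

end

theorem mainTheorem5 {C : Type u₁} [Category.{v₁} C] [MonoidalCategory C] [SymmetricCategory C]
    (A : C) [MonObj A] [ComonObj A] (hF : IsFrobenius A) (hsep : IsDeltaSeparable A)
    (hN : nakayama A ≫ nakayama A = 𝟙 A) {n : ℕ} (Λ : SpinTriangulatedSurface.{u} (n + 2))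
    {i j : Fin (n + 2)} (hij : i ≠ j) (htype : Λ.type i = Λ.type j) (ε : ℤˣ)
    (Λ' : SpinTriangulatedSurface.{u} n) (G : Gluing Λ hij ε Λ') :
    (∀ (k : Fin 3) (e : Λ'.E),
      e.1 = (G.vert (Λ.bdry j k), G.vert (Λ.bdry j (k + 1))) →
        Λ'.edgeSign e =
          ε * Λ.edgeSign (Λ.bdryEdge i k.rev) * Λ.edgeSign (Λ.bdryEdge j k)) ∧
    TA A Λ' = gluingMorphism A hij ε ≫ TA A Λ := by
  constructor
  · intro k e he
    have h : e = G.gluedEdge k := Subtype.ext he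
    rw [h, G.edgeSign_gluedEdge htype]
  · exact TA_glue hF hN G (G.edgeSign_gluedEdge htype) G.edgeSign_freeEdge
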